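/- Let $q\in\mathbb{C}$ with $|q|=1$ not be a root of unity, and fix a square root $q^{1/2}$ (the forms below do not depend on this choice). Write $[k]=\frac{q^k-q^{-k}}{q-q^{-1}}$, $[k]!=[1]\cdots[k]$ and $\binom{x}{m}_q=\frac{[x][x-1]\cdots[x-m+1]}{[m]!}$ for $x\in\mathbb{Z}$, $m\in\mathbb{Z}_{\ge0}$; these are real numbers. Let $U_q(\mathfrak{sl}_2)$ be generated by $E,F,K^{\pm1}$ with $KEK^{-1}=q^2E$, $KFK^{-1}=q^{-2}F$, $EF-FE=\frac{K-K^{-1}}{q-q^{-1}}$ and coproduct $\Delta(E)=E\otimes1+K\otimes E$, $\Delta(F)=1\otimes F+F\otimes K^{-1}$, $\Delta(K)=K\otimes K$. For $a\ge0$ let $\widetilde V_a$ be the $(a+1)$-dimensional simple module with basis $v_0,\dots,v_a$, $Ev_i=[a-i+1]v_{i-1}$, $Fv_i=[i+1]v_{i+1}$, $Kv_i=q^{a-2i}v_i$ (where $v_{-1}=v_{a+1}=0$), with its Shapovalov form $(v_i,v_j)=\delta_{ij}\binom{a}{i}_q$. Forms are linear in the first and antilinear in the second argument; a form is contravariant if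 $E^*=F$, $F^*=E$, $K^*=K^{-1}$. Let $$R=q^{H\otimes H/2}\sum_{i\ge0}q^{\binom i2}\frac{(q-q^{-1})^i}{[i]!}F^i\otimes E^i,\qquad \overline R=R\,(R^{21}R)^{-1/2},$$ where $q^{H\otimes H/2}$ multiplies a tensor of vectors with $K$-eigenvalues $q^{h},q^{h'}$ by $(q^{1/2})^{hh'}$, and where $(R^{21}R)^{-1/2}$ acts as $(q^{1/2})^{-k}$ on the eigenspace of $R^{21}R$ with eigenvalue $q^k$, $k\in\mathbb{Z}$ (on the tensor products below $R^{21}R$ is diagonalizable with eigenvalues of this kind, and $((R^{21}R)^{-1/2})^2R^{21}R=1$). If $V,W$ carry forms, give $V\otimes W$ the form $(v_1\otimes w_1,v_2\otimes w_2)=\sum_i(a_iv_1,v_2)(b_iw_1,w_2)$, where $\overline R=\sum_ia_i\otimes b_i$. Iterating this from left to right defines a form on $T=\widetilde V_{a_1}\otimes\cdots\otimes\widetilde V_{a_n}$ for all $n\ge1$ and $a_1,\dots,a_n\ge0$. Put $A=\sum_ia_i$. (1) The form on $T$ is Hermitian, nondegenerate and contravariant. With $\widetilde E_m=\operatorname{Hom}_{U_q(\mathfrak{sl}_2)}(\widetilde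 V_{A-2m},T)$, evaluation gives an isomorphism of $U_q(\mathfrak{sl}_2)$-modules $$\bigoplus_{0\le 2m\le A}\widetilde V_{A-2m}\otimes\widetilde E_m\;\cong\;\bigotimes_{i=1}^n\widetilde V_{a_i}.$$ Its summands are mutually orthogonal, and on the $m$-th one the form is the tensor product of the Shapovalov form on $\widetilde V_{A-2m}$ with the nondegenerate Hermitian form $(f,g)=(f(v_0),g(v_0))$ on $\widetilde E_m$. (2) The signature (maximal dimension of a positive definite subspace minus maximal dimension of a negative definite subspace) of $\widetilde E_m$ is $$\operatorname{sgn}(\widetilde E_m)=\sum_{m_1+\cdots+m_{n-1}=m}\ \prod_{j=1}^{n-1}\operatorname{sign}\left[\binom{1+\sum_{k=1}^{j+1}a_k-2\sum_{k=1}^{j-1}m_k-m_j}{m_j}_q\binom{\sum_{k=1}^{j}a_k-2\sum_{k=1}^{j-1}m_k}{m_j}_q\binom{a_{j+1}}{m_j}_q\right],$$ the sum being over $(n-1)$-tuples of nonnegative integers, for all $m\ge0$ with $2m\le A$; for $2m>A$ the right-hand side is $0$ (and there is no such summand). (3) Let $n=2$, $a,b\ge0$ and $0\le m\le\min(a,b)$,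 and let $v_i$, $w_j$ be the bases of $\widetilde V_a$, $\widetilde V_b$. There is exactly one vector $u\in\widetilde V_a\otimes\widetilde V_b$ of the form $u=v_0\otimes w_m+\sum_{i=1}^mc_i\,v_i\otimes w_{m-i}$ with $Eu=0$, and $$(u,u)=\frac{\binom{b}{m}_q}{\binom{a}{m}_q}\binom{a+b+1-m}{m}_q.$$ -/

import Mathlib

open scoped Matrix Kronecker TensorProduct DirectSum ComplexConjugate

namespace QSig

/-- The quantum integer `[k] = (q^k - q^(-k)) / (q - q^(-1))`. -/
noncomputable def qInt (q : Circle) (k : ℤ) : ℂ :=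
  ((q : ℂ) ^ k - (q : ℂ) ^ (-k)) / ((q : ℂ) - (q : ℂ)⁻¹)

/-- The quantum factorial `[i]! = [1][2]⋯[i]`. -/
noncomputable def qFact (q : Circle) (i : ℕ) : ℂ :=
  ∏ j ∈ Finset.range i, qInt q ((j : ℤ) + 1)

/-- The `q`-binomial coefficient with integer upper entry,
`[x][x-1]⋯[x-m+1] / ([1][2]⋯[m])`. -/
noncomputable def qBinom (q : Circle) (x : ℤ) (m : ℕ) : ℂ :=
  (∏ i ∈ Finset.range m, qInt q (x - i)) / qFact q m

/-- Quantum integers (hence `q`-binomial coefficients) are real, because `q` is on the unit circle. -/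
theorem conj_qInt (q : Circle) (k : ℤ) : conj (qInt q k) = qInt q k := by
  have h : conj (q : ℂ) = (q : ℂ)⁻¹ := by
    rw [← Circle.coe_inv_eq_conj, Circle.coe_inv]
  simp only [qInt, map_div₀, map_sub, map_zpow₀, map_inv₀, h, inv_inv, inv_zpow', neg_neg]
  rw [← neg_sub ((q : ℂ) ^ k), ← neg_sub (q : ℂ), neg_div_neg_eq]

theorem conj_qBinom (q : Circle) (x : ℤ) (m : ℕ) : conj (qBinom q x m) = qBinom q x m := by
  simp [qBinom, qFact, map_prod, conj_qInt]

/-- The sign of a real number given as a complex number, as an integer. -/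
noncomputable def csign (z : ℂ) : ℤ := (SignType.sign z.re : ℤ)

/-- The diagonal matrix with entries `q ^ wt i`. -/
noncomputable def kMat (q : Circle) {ι : Type} [DecidableEq ι] (wt : ι → ℤ) : Matrix ι ι ℂ :=
  Matrix.diagonal fun i => (q : ℂ) ^ wt i

/-- A finite-dimensional `U_q(sl₂)`-module (of type 1) in a weight basis indexed by `ι`, together with
the Gram matrix of a sesquilinear form. The underlying space is `ι → ℂ`, the generators act by the
matrices `E`, `F` and `K = diag (q ^ wt i)`, and the defining relations of `U_q(sl₂)` hold. -/
structure QMod (q : Circle) where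
  ι : Type
  [fintype : Fintype ι]
  [decEq : DecidableEq ι]
  wt : ι → ℤ
  E : Matrix ι ι ℂ
  F : Matrix ι ι ℂ
  gram : Matrix ι ι ℂ
  relE : kMat q wt * E * kMat q (-wt) = (q : ℂ) ^ (2 : ℤ) • E
  relF : kMat q wt * F * kMat q (-wt) = (q : ℂ) ^ (-2 : ℤ) • F
  relEF : E * F - F * E = ((q : ℂ) - (q : ℂ)⁻¹)⁻¹ • (kMat q wt - kMat q (-wt))

attribute [instance] QMod.fintype QMod.decEq

variable {q : Circle}

/-- The action of `K`. -/
noncomputable def QMod.K (V : QMod q) : Matrix V.ι V.ι ℂ := kMat q V.wt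

/-- The action of `K⁻¹`. -/
noncomputable def QMod.Kinv (V : QMod q) : Matrix V.ι V.ι ℂ := kMat q (-V.wt)

/-- The sesquilinear form with the given Gram matrix, linear in the first argument and antilinear in
the second one. -/
noncomputable def QMod.form (V : QMod q) (x y : V.ι → ℂ) : ℂ := x ⬝ᵥ (V.gram *ᵥ star y)

theorem kMat_mul_kMat_neg {ι : Type} [Fintype ι] [DecidableEq ι] (q : Circle) (wt : ι → ℤ) :
    kMat q wt * kMat q (-wt) = 1 := by
  have h : ∀ i, (q : ℂ) ^ wt i ≠ 0 := fun i => zpow_ne_zero _ q.coe_ne_zero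
  simp [kMat, Matrix.diagonal_mul_diagonal, h]

theorem kMat_neg_mul_kMat {ι : Type} [Fintype ι] [DecidableEq ι] (q : Circle) (wt : ι → ℤ) :
    kMat q (-wt) * kMat q wt = 1 := by
  have h : ∀ i, (q : ℂ) ^ wt i ≠ 0 := fun i => zpow_ne_zero _ q.coe_ne_zero
  simp [kMat, Matrix.diagonal_mul_diagonal, h]

theorem kMat_kronecker {ι κ : Type} [DecidableEq ι] [DecidableEq κ]
    (q : Circle) (w : ι → ℤ) (w' : κ → ℤ) :
    kMat q (fun p : ι × κ => w p.1 + w' p.2) = kMat q w ⊗ₖ kMat q w' := by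
  simp only [kMat, Matrix.diagonal_kronecker_diagonal]
  congr 1
  funext p
  exact zpow_add₀ q.coe_ne_zero _ _

theorem kMat_kronecker_neg {ι κ : Type} [DecidableEq ι] [DecidableEq κ]
    (q : Circle) (w : ι → ℤ) (w' : κ → ℤ) :
    kMat q (-(fun p : ι × κ => w p.1 + w' p.2)) = kMat q (-w) ⊗ₖ kMat q (-w') := by
  rw [← kMat_kronecker]
  congr 1
  funext p
  simp [add_comm]

theorem kronecker_smul' {ι κ : Type} (c : ℂ) (A : Matrix ι ι ℂ) (B : Matrix κ κ ℂ) :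
    A ⊗ₖ (c • B) = c • (A ⊗ₖ B) := by
  ext p r
  simp [Matrix.kroneckerMap_apply, mul_left_comm]

/-! ### The simple modules -/

theorem qInt_identity (q : Circle) (a i : ℤ) :
    qInt q (a - i) * qInt q (i + 1) - qInt q i * qInt q (a - i + 1) =
      ((q : ℂ) - (q : ℂ)⁻¹)⁻¹ * ((q : ℂ) ^ (a - 2 * i) - (q : ℂ) ^ (-(a - 2 * i))) := by
  have h0 : (q : ℂ) ≠ 0 := q.coe_ne_zero
  by_cases h : (q : ℂ) - (q : ℂ)⁻¹ = 0
  · simp [qInt, h]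
  · have key : ((q : ℂ) ^ (a - i) - (q : ℂ) ^ (-(a - i))) * ((q : ℂ) ^ (i + 1) - (q : ℂ) ^ (-(i + 1)))
        - ((q : ℂ) ^ i - (q : ℂ) ^ (-i)) * ((q : ℂ) ^ (a - i + 1) - (q : ℂ) ^ (-(a - i + 1))) =
        ((q : ℂ) - (q : ℂ)⁻¹) * ((q : ℂ) ^ (a - 2 * i) - (q : ℂ) ^ (-(a - 2 * i))) := by
      have e1 : (q : ℂ) ^ (a - 2 * i) = (q : ℂ) ^ (a - i) * (q : ℂ) ^ (-i) := by
        rw [← zpow_add₀ h0]; congr 1; ring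
      have e2 : (q : ℂ) ^ (-(a - 2 * i)) = (q : ℂ) ^ (-(a - i)) * (q : ℂ) ^ i := by
        rw [← zpow_add₀ h0]; congr 1; ring
      rw [e1, e2, neg_add, neg_add, zpow_add₀ h0, zpow_add₀ h0, zpow_add₀ h0, zpow_add₀ h0, zpow_one,
        zpow_neg_one]
      ring
    simp only [qInt]
    rw [div_mul_div_comm, div_mul_div_comm, ← sub_div, key]
    field_simp

/-- The simple module `V_a` with basis `v_0, …, v_a`, where `E v_i = [a-i+1] v_{i-1}`,
`F v_i = [i+1] v_{i+1}`, `K v_i = q^(a-2i) v_i`, with its Shapovalov form,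
`(v_i, v_j) = δ_ij * binom(a, i)_q`. -/
noncomputable def simple (q : Circle) (a : ℕ) : QMod q where
  ι := Fin (a + 1)
  wt := fun i => (a : ℤ) - 2 * (i : ℕ)
  E := Matrix.of fun i j => if (j : ℕ) = i + 1 then qInt q ((a : ℤ) - (j : ℕ) + 1) else 0
  F := Matrix.of fun i j => if (i : ℕ) = j + 1 then qInt q ((j : ℕ) + 1) else 0
  gram := Matrix.diagonal fun i => qBinom q a i
  relE := by
    ext i j
    simp only [kMat, Matrix.mul_diagonal, Matrix.diagonal_mul, Matrix.smul_apply, Matrix.of_apply,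
      Pi.neg_apply, smul_eq_mul]
    split_ifs with h
    · rw [mul_right_comm, ← zpow_add₀ q.coe_ne_zero]
      congr 2
      rw [h]; push_cast; ring
    · simp
  relF := by
    ext i j
    simp only [kMat, Matrix.mul_diagonal, Matrix.diagonal_mul, Matrix.smul_apply, Matrix.of_apply,
      Pi.neg_apply, smul_eq_mul]
    split_ifs with h
    · rw [mul_right_comm, ← zpow_add₀ q.coe_ne_zero]
      congr 2
      rw [h]; push_cast; ring
    · simp
  relEF := by
    ext i j
    have h1 := qInt_identity q a (i : ℕ)
    simp only [kMat, Matrix.sub_apply, Matrix.mul_apply, Matrix.of_apply, Matrix.smul_apply,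
      Matrix.diagonal_apply, Pi.neg_apply, smul_eq_mul, mul_ite, ite_mul, zero_mul, mul_zero]
    by_cases hij : i = j
    · subst hij
      simp only [if_true]
      rw [← h1]
      congr 1
      · by_cases hi : (i : ℕ) < a
        · rw [Finset.sum_eq_single (⟨i + 1, by omega⟩ : Fin (a + 1))]
          · simp only [if_true]
            congr 2; push_cast; ring
          · intro k _ hk
            have : (k : ℕ) ≠ i + 1 := fun h => hk (Fin.ext h)
            simp [this]
          · simp
        · have hia : (i : ℕ) = a := by omega
          rw [Finset.sum_eq_zero]
          · simp [hia, qInt]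
          · intro k _
            have : (k : ℕ) ≠ i + 1 := by omega
            simp [this]
      · by_cases hi : 0 < (i : ℕ)
        · rw [Finset.sum_eq_single (⟨i - 1, by omega⟩ : Fin (a + 1))]
          · have : (i : ℕ) = (i : ℕ) - 1 + 1 := by omega
            simp only [← this, if_true]
            congr 2
            omega
          · intro k _ hk
            have : (i : ℕ) ≠ k + 1 := fun h => hk (Fin.ext (by simp [h]))
            simp [this]
          · simp
        · have hi0 : (i : ℕ) = 0 := by omega
          rw [Finset.sum_eq_zero]
          · simp [hi0, qInt]
          · intro k _
            have : (i : ℕ) ≠ k + 1 := by omega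
            simp [this]
    · have hij' : (i : ℕ) ≠ j := fun h => hij (Fin.ext h)
      simp only [hij, if_false, sub_zero, mul_zero]
      rw [Finset.sum_eq_zero, Finset.sum_eq_zero, sub_zero]
      · intro k _
        split_ifs <;> first | rfl | omega
      · intro k _
        split_ifs <;> first | rfl | omega

/-! ### Tensor products and the unitarized R-matrix -/

/-- The matrix by which the universal R-matrix
`R = q^(H⊗H/2) ∑_i q^(i choose 2) (q - q⁻¹)^i / [i]! F^i ⊗ E^i` acts on `V ⊗ W`. Here `s` is a square
root of `q`, so that `q^(h*h'/2) = s^(h*h')`; since `F ^ dim V = 0`, the sum is finite. -/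
noncomputable def RMat (s : Circle) (V W : QMod q) : Matrix (V.ι × W.ι) (V.ι × W.ι) ℂ :=
  Matrix.diagonal (fun p => (s : ℂ) ^ (V.wt p.1 * W.wt p.2)) *
    ∑ i ∈ Finset.range (Fintype.card V.ι),
      ((q : ℂ) ^ (i.choose 2) * ((q : ℂ) - (q : ℂ)⁻¹) ^ i / qFact q i) • ((V.F ^ i) ⊗ₖ (W.E ^ i))

/-- The matrix by which `R²¹` acts on `V ⊗ W`: conjugate the action of `R` on `W ⊗ V` by the twist. -/
noncomputable def R21Mat (s : Circle) (V W : QMod q) : Matrix (V.ι × W.ι) (V.ι × W.ι) ℂ :=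
  (RMat s W V).submatrix Prod.swap Prod.swap

open Classical in
/-- The branch of `z ↦ z^(-1/2)` on the powers of `q = s^2` that sends `q^k` to `q^(-k/2) = s^(-k)`
(well defined when `q` is not a root of unity). -/
noncomputable def invSqrtBranch (q s : Circle) (z : ℂ) : ℂ :=
  if h : ∃ k : ℤ, z = (q : ℂ) ^ k then (s : ℂ) ^ (-h.choose) else 0

/-- The inverse square root of a diagonalizable matrix whose eigenvalues are powers of `q`: the
operator acting by `q^(-k/2) = s^(-k)` on the eigenspace with eigenvalue `q^k`. It is obtained by
applying to `M` the polynomial that interpolates the branch above on the eigenvalues of `M`. -/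
noncomputable def invSqrt (q s : Circle) {ι : Type} [Fintype ι] [DecidableEq ι]
    (M : Matrix ι ι ℂ) : Matrix ι ι ℂ :=
  Polynomial.aeval M (Lagrange.interpolate M.charpoly.roots.toFinset id (invSqrtBranch q s))

/-- The unitarized R-matrix `R (R²¹ R)^(-1/2)` of the Drinfeld coboundary structure, on `V ⊗ W`. -/
noncomputable def RBar (s : Circle) (V W : QMod q) : Matrix (V.ι × W.ι) (V.ι × W.ι) ℂ :=
  RMat s V W * invSqrt q s (R21Mat s V W * RMat s V W)

/-- The tensor product `V ⊗ W`, with the action given by `Δ E = E ⊗ 1 + K ⊗ E`,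
`Δ F = 1 ⊗ F + F ⊗ K⁻¹`, `Δ K = K ⊗ K`, and with the form `(x, y) = ⟨RBar x, y⟩`, where `⟨ , ⟩` is the
product of the forms on `V` and `W`. -/
noncomputable def tensor (s : Circle) (V W : QMod q) : QMod q where
  ι := V.ι × W.ι
  wt := fun p => V.wt p.1 + W.wt p.2
  E := V.E ⊗ₖ (1 : Matrix W.ι W.ι ℂ) + V.K ⊗ₖ W.E
  F := (1 : Matrix V.ι V.ι ℂ) ⊗ₖ W.F + V.F ⊗ₖ W.Kinv
  gram := (RBar s V W)ᵀ * (V.gram ⊗ₖ W.gram)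
  relE := by
    rw [kMat_kronecker, kMat_kronecker_neg]
    simp only [QMod.K, mul_add, add_mul, ← Matrix.mul_kronecker_mul, mul_one, V.relE, W.relE,
      kMat_mul_kMat_neg, Matrix.smul_kronecker, kronecker_smul', smul_add]
    rw [mul_assoc (kMat q V.wt), kMat_mul_kMat_neg, mul_one]
  relF := by
    rw [kMat_kronecker, kMat_kronecker_neg]
    simp only [QMod.Kinv, mul_add, add_mul, ← Matrix.mul_kronecker_mul, mul_one, V.relF, W.relF,
      kMat_mul_kMat_neg, Matrix.smul_kronecker, kronecker_smul', smul_add, one_mul]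
  relEF := by
    have hV : V.E * V.F = V.F * V.E +
        ((q : ℂ) - (q : ℂ)⁻¹)⁻¹ • (kMat q V.wt - kMat q (-V.wt)) := by
      rw [← V.relEF]; abel
    have hW : W.E * W.F = W.F * W.E +
        ((q : ℂ) - (q : ℂ)⁻¹)⁻¹ • (kMat q W.wt - kMat q (-W.wt)) := by
      rw [← W.relEF]; abel
    have hF : kMat q V.wt * V.F = (q : ℂ) ^ (-2 : ℤ) • (V.F * kMat q V.wt) := by
      rw [← Matrix.smul_mul, ← V.relF, mul_assoc, kMat_neg_mul_kMat, mul_one]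
    have hE : W.E * kMat q (-W.wt) = (q : ℂ) ^ (2 : ℤ) • (kMat q (-W.wt) * W.E) := by
      rw [← Matrix.mul_smul, ← W.relE, ← mul_assoc, ← mul_assoc, kMat_neg_mul_kMat, one_mul]
    have hq : (q : ℂ) ^ (2 : ℤ) * (q : ℂ) ^ (-2 : ℤ) = 1 := by
      rw [← zpow_add₀ q.coe_ne_zero]; simp
    rw [kMat_kronecker, kMat_kronecker_neg]
    simp only [QMod.K, QMod.Kinv, mul_add, add_mul, ← Matrix.mul_kronecker_mul, mul_one, one_mul,
      hV, hW, hF, hE]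
    ext p r
    simp only [Matrix.kroneckerMap_apply, Matrix.add_apply, Matrix.sub_apply, Matrix.smul_apply,
      smul_eq_mul]
    linear_combination ((V.F * kMat q V.wt) p.1 r.1 * (kMat q (-W.wt) * W.E) p.2 r.2) * hq

/-- The tensor product `V_{a 1} ⊗ V_{a 2} ⊗ ⋯ ⊗ V_{a n}`, with its action of `U_q(sl₂)` and the form
obtained by iterating the construction of `tensor` (for `n = 0`: the trivial module). -/
noncomputable def tensorProd (q s : Circle) (a : ℕ → ℕ) : ℕ → QMod q
  | 0 => simple q 0
  | 1 => simple q (a 1)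
  | n + 2 => tensor s (tensorProd q s a (n + 1)) (simple q (a (n + 2)))

/-! ### Multiplicity spaces -/

/-- The multiplicity space `Hom (V, T)`: linear maps (as matrices) intertwining the actions of
`U_q(sl₂)`. -/
def Mult (V T : QMod q) : Submodule ℂ (Matrix T.ι V.ι ℂ) where
  carrier := {A | A * V.E = T.E * A ∧ A * V.F = T.F * A ∧ A * V.K = T.K * A}
  add_mem' := by
    rintro A B ⟨h1, h2, h3⟩ ⟨h4, h5, h6⟩
    exact ⟨by rw [Matrix.add_mul, Matrix.mul_add, h1, h4],
      by rw [Matrix.add_mul, Matrix.mul_add, h2, h5], by rw [Matrix.add_mul, Matrix.mul_add, h3, h6]⟩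
  zero_mem' := by simp
  smul_mem' := by
    rintro c A ⟨h1, h2, h3⟩
    exact ⟨by rw [Matrix.smul_mul, Matrix.mul_smul, h1], by rw [Matrix.smul_mul, Matrix.mul_smul, h2],
      by rw [Matrix.smul_mul, Matrix.mul_smul, h3]⟩

/-- The evaluation map `⨁_{0 ≤ 2m ≤ A} V_{A-2m} ⊗ Hom (V_{A-2m}, T) → T`, `x ⊗ f ↦ f x`. -/
noncomputable def decompMap (T : QMod q) (A : ℕ) :
    (⨁ m : Fin (A / 2 + 1),
      (((simple q (A - 2 * m)).ι → ℂ) ⊗[ℂ] Mult (simple q (A - 2 * m)) T)) →ₗ[ℂ] (T.ι → ℂ) :=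
  DirectSum.toModule ℂ _ _ fun m => TensorProduct.lift
    (LinearMap.mk₂ ℂ (fun x (f : Mult (simple q (A - 2 * m)) T) => f.1 *ᵥ x)
      (fun _ _ _ => Matrix.mulVec_add _ _ _)
      (fun _ _ _ => Matrix.mulVec_smul _ _ _)
      (fun _ _ _ => Matrix.add_mulVec _ _ _)
      (fun _ _ _ => Matrix.smul_mulVec _ _ _))

/-- The highest weight vector `v_0` of `V_c`. -/
noncomputable def highest (q : Circle) (c : ℕ) : (simple q c).ι → ℂ :=
  Pi.single (M := fun _ : Fin (c + 1) => ℂ) 0 1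

/-- The form induced on the multiplicity space `Hom (V_c, T)`: as `(v_0, v_0) = 1` in `V_c`, it is
`(f, g) = (f v_0, g v_0)`. -/
noncomputable def multForm {c : ℕ} {T : QMod q} (f g : Mult (simple q c) T) : ℂ :=
  T.form (f.1 *ᵥ highest q c) (g.1 *ᵥ highest q c)

/-- The signature of a Hermitian form `h` on a finite-dimensional complex vector space: the maximal
dimension of a positive definite subspace minus that of a negative definite subspace. -/
noncomputable def signature {X : Type} [AddCommGroup X] [Module ℂ X] (h : X → X → ℂ) : ℤ :=
  ((sSup {d : ℕ | ∃ W : Submodule ℂ X, Module.finrank ℂ W = d ∧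
      ∀ w ∈ W, w ≠ 0 → 0 < (h w w).re} : ℕ) : ℤ) -
  ((sSup {d : ℕ | ∃ W : Submodule ℂ X, Module.finrank ℂ W = d ∧
      ∀ w ∈ W, w ≠ 0 → (h w w).re < 0} : ℕ) : ℤ)

/-- The sum, over all compositions `m_1 + ⋯ + m_{n-1} = m` into nonnegative integers, of the products
of signs of `q`-binomial coefficients. -/
noncomputable def signFormula (q : Circle) (a : ℕ → ℕ) (n m : ℕ) : ℤ :=
  ∑ μ ∈ Finset.piAntidiag (Finset.Icc 1 (n - 1)) m, ∏ j ∈ Finset.Icc 1 (n - 1),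
    csign (
      qBinom q (1 + (∑ k ∈ Finset.Icc 1 (j + 1), (a k : ℤ))
        - 2 * (∑ k ∈ Finset.Icc 1 (j - 1), (μ k : ℤ)) - μ j) (μ j) *
      qBinom q ((∑ k ∈ Finset.Icc 1 j, (a k : ℤ))
        - 2 * (∑ k ∈ Finset.Icc 1 (j - 1), (μ k : ℤ))) (μ j) *
      qBinom q (a (j + 1)) (μ j))

/-- `u` is the unit-normalized highest weight vector of the summand `V_{a+b-2m}` of `V_a ⊗ V_b`:
`E u = 0` and `u = v_0 ⊗ w_m + ∑_{i=1}^m c_i v_i ⊗ w_{m-i}` for some scalars `c_i`. -/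
def IsUnitHighest (s : Circle) (a b m : ℕ)
    (u : (tensor s (simple q a) (simple q b)).ι → ℂ) : Prop :=
  (tensor s (simple q a) (simple q b)).E *ᵥ u = 0 ∧
  (∀ (i : Fin (a + 1)) (j : Fin (b + 1)), (i : ℕ) + j ≠ m → u (i, j) = 0) ∧
  (∀ (i : Fin (a + 1)) (j : Fin (b + 1)), (i : ℕ) = 0 → (j : ℕ) = m → u (i, j) = 1)

end QSig

namespace QSig

variable {q : Circle}

/-! ### Quantum integers and the `q`-Vandermonde identity -/

/-! The element `R` intertwines Δ with the opposite coproduct, because its coefficients satisfy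
exactly the recursion needed to telescope the commutators of E with powers of F (`thetaMat_mul_E`,
`thetaMat_mul_F`). Hence R²¹R commutes with the action, the unitarized matrix also carries Δ to
Δ^op, and the tensor product of two contravariant forms is contravariant (`tensor_isContravariant`).

On V_a ⊗ V_b a highest weight vector of level m is determined by its coefficient at v_0 ⊗ w_m.
Explicit ones are u for Δ and u' for Δ^op. By uniqueness R u is a multiple of u' and R²¹ u' a
multiple of u. The first scalar is read off at v_0 ⊗ w_m and the second at v_m ⊗ w_0, where only the
Cartan factor contributes. This gives the eigenvalue q^(ab-2m(a+b+1-m)) of R²¹R and the image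
q^(m(b-m+1)) u' of u under the unitarized matrix, with no half powers left. The square norm of u is
then a sum that the q-Vandermonde identity evaluates (`qBinom_vandermonde`, `form_levelVec`). It is
nonzero because q is not a root of unity, so the copies of V_(a+b-2m) are orthogonal and
independent, and a dimension count shows that they fill V_a ⊗ V_b.

For n factors, induct on an orthogonal decomposition `Decomp` of T into images of simple modules
with real nonzero norms ε_i. A contravariant form on a simple module is unique up to a scalar, so
the form of T pulls back along the i-th embedding to ε_i times the Shapovalov form. Since R and R²¹R
are natural, the summands V_(c_i) ⊗ V_b of T ⊗ V_b stay orthogonal, and the norms multiply: ε_i is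
replaced by ε_i times the two-factor norm (`tensor_pairing`, `Decomp.form_tensorF_same`). Everything
about T is read from the decomposition: the form is Hermitian since the ε_i are real, the embeddings
with c_i = c form an orthogonal basis of the multiplicity space of V_c, and its signature is the sum
of the signs of their ε_i. The sign formula satisfies the same recursion in the number of factors
(`signFormula_add_two`, `Decomp.sum_sign_tensor`), because replacing a quotient of binomials by a
product changes the norm by a square only. -/

theorem zpow_inj (hq : ∀ k : ℕ, 0 < k → q ^ k ≠ 1) {k l : ℤ} :
    (q : ℂ) ^ k = (q : ℂ) ^ l ↔ k = l := by
  constructor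
  · intro h
    by_contra hne
    have h1 : q ^ (k - l) = 1 := by
      rw [zpow_sub, mul_inv_eq_one]
      ext
      simpa using h
    have h2 : q ^ (k - l).natAbs = 1 := by
      rcases Int.natAbs_eq (k - l) with h3 | h3
      · rw [h3, zpow_natCast] at h1
        exact h1
      · rw [h3, zpow_neg, zpow_natCast, inv_eq_one] at h1
        exact h1
    exact hq _ (by omega) h2
  · rintro rfl; rfl

theorem sub_inv_ne_zero (hq : ∀ k : ℕ, 0 < k → q ^ k ≠ 1) : (q : ℂ) - (q : ℂ)⁻¹ ≠ 0 := by
  intro h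
  have : (q : ℂ) ^ (1 : ℤ) = (q : ℂ) ^ (-1 : ℤ) := by simpa using sub_eq_zero.1 h
  exact absurd ((zpow_inj hq).1 this) (by norm_num)

theorem qInt_ne_zero (hq : ∀ k : ℕ, 0 < k → q ^ k ≠ 1) {k : ℤ} (hk : k ≠ 0) : qInt q k ≠ 0 := by
  refine div_ne_zero (fun h => hk ?_) (sub_inv_ne_zero hq)
  have := (zpow_inj hq).1 (sub_eq_zero.1 h)
  omega

@[simp] theorem qInt_zero (q : Circle) : qInt q 0 = 0 := by simp [qInt]

theorem qInt_one (hq : ∀ k : ℕ, 0 < k → q ^ k ≠ 1) : qInt q 1 = 1 := by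
  simp [qInt, div_self (sub_inv_ne_zero hq)]

@[simp] theorem qFact_zero (q : Circle) : qFact q 0 = 1 := by simp [qFact]

theorem qFact_succ (q : Circle) (i : ℕ) : qFact q (i + 1) = qFact q i * qInt q ((i : ℤ) + 1) := by
  simp [qFact, Finset.prod_range_succ]

theorem qFact_ne_zero (hq : ∀ k : ℕ, 0 < k → q ^ k ≠ 1) (i : ℕ) : qFact q i ≠ 0 :=
  Finset.prod_ne_zero_iff.2 fun j _ => qInt_ne_zero hq (by omega)

@[simp] theorem qBinom_zero (q : Circle) (x : ℤ) : qBinom q x 0 = 1 := by simp [qBinom]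

theorem qBinom_eq_zero (q : Circle) {n m : ℕ} (h : n < m) : qBinom q n m = 0 := by
  rw [qBinom, Finset.prod_eq_zero (Finset.mem_range.2 h) (by simp), zero_div]

theorem qBinom_ne_zero (hq : ∀ k : ℕ, 0 < k → q ^ k ≠ 1) {x : ℤ} {m : ℕ} (h : (m : ℤ) ≤ x) :
    qBinom q x m ≠ 0 :=
  div_ne_zero (Finset.prod_ne_zero_iff.2 fun i hi => qInt_ne_zero hq (by
    have := Finset.mem_range.1 hi; omega)) (qFact_ne_zero hq m)

theorem qBinom_eq_qFact (hq : ∀ k : ℕ, 0 < k → q ^ k ≠ 1) (n m : ℕ) :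
    qBinom q ((n + m : ℕ) : ℤ) m = qFact q (n + m) / (qFact q m * qFact q n) := by
  have key : ∀ m : ℕ, (∏ i ∈ Finset.range m, qInt q (((n + m : ℕ) : ℤ) - i)) * qFact q n =
      qFact q (n + m) := by
    intro m
    induction m with
    | zero => simp
    | succ m ih =>
      rw [Finset.prod_range_succ', ← add_assoc, qFact_succ, ← ih, mul_right_comm]
      congr 2
      · refine Finset.prod_congr rfl fun i _ => ?_
        congr 1; push_cast; ring
  rw [qBinom, ← key, mul_div_mul_right _ _ (qFact_ne_zero hq n)]

/-- After cancelling the common product this is [x+1] = q^(-(m+1)) [x-m] + q^(x-m) [m+1]. -/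
theorem qBinom_pascal (hq : ∀ k : ℕ, 0 < k → q ^ k ≠ 1) (x : ℤ) (m : ℕ) :
    qBinom q (x + 1) (m + 1) = (q : ℂ) ^ (-((m : ℤ) + 1)) * qBinom q x (m + 1) +
      (q : ℂ) ^ (x - m) * qBinom q x m := by
  have h0 : (q : ℂ) ≠ 0 := q.coe_ne_zero
  have h1 : qInt q (x + 1) = (q : ℂ) ^ (-((m : ℤ) + 1)) * qInt q (x - m) +
      (q : ℂ) ^ (x - m) * qInt q (m + 1) := by
    simp only [qInt]
    have e1 : (q : ℂ) ^ (x + 1) = (q : ℂ) ^ (x - m) * (q : ℂ) ^ ((m : ℤ) + 1) := by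
      rw [← zpow_add₀ h0]; congr 1; ring
    have e2 : (q : ℂ) ^ (-(x + 1)) = (q : ℂ) ^ (-((m : ℤ) + 1)) * (q : ℂ) ^ (-(x - m)) := by
      rw [← zpow_add₀ h0]; congr 1; ring
    rw [e1, e2]
    ring
  have h2 : qInt q ((m : ℤ) + 1) ≠ 0 := qInt_ne_zero hq (by omega)
  have h3 := qFact_ne_zero hq m
  have h4 : ∏ i ∈ Finset.range m, qInt q (x + 1 - ((i + 1 : ℕ) : ℤ)) =
      ∏ i ∈ Finset.range m, qInt q (x - i) :=
    Finset.prod_congr rfl fun i _ => by congr 1; push_cast; ring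
  simp only [qBinom]
  rw [Finset.prod_range_succ', Finset.prod_range_succ, h4, qFact_succ]
  simp only [Nat.cast_zero, sub_zero]
  rw [h1]
  field_simp

/-- Double induction on α and m: the Pascal rule applied to the right side and to the factor
containing α produces the same two sums, namely (α, m+1) and (α+1, m). At α = 0 only j = 0 survives,
since [j-1 choose j] = 0 for j > 0. The norm computation uses it with α = a-m+1 and β = b-m+1. -/
theorem qBinom_vandermonde (hq : ∀ k : ℕ, 0 < k → q ^ k ≠ 1) (β : ℤ) (α m : ℕ) :
    ∑ p ∈ Finset.HasAntidiagonal.antidiagonal m, (q : ℂ) ^ ((p.2 : ℤ) * β - p.1 * α) *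
      (qBinom q (β - 1 + p.1) p.1 * qBinom q ((α : ℤ) - 1 + p.2) p.2) =
      qBinom q (α + β + m - 1) m := by
  have h0 : (q : ℂ) ≠ 0 := q.coe_ne_zero
  induction α generalizing m with
  | zero =>
    rw [Finset.sum_eq_single (m, 0)]
    · simp only [Nat.cast_zero, zero_mul, mul_zero, sub_zero, zpow_zero, one_mul, qBinom_zero,
        mul_one]
      congr 1; ring
    · rintro ⟨i, j⟩ hij hne
      have hj : j ≠ 0 := by
        rintro rfl
        simp at hij hne
        exact hne hij
      have : qBinom q (((0 : ℕ) : ℤ) - 1 + j) j = 0 := by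
        have := qBinom_eq_zero q (show j - 1 < j by omega)
        rw [Nat.cast_sub (by omega)] at this
        rw [← this]
        congr 1
      simp only [this, mul_zero]
    · simp
  | succ α ihα =>
    induction m with
    | zero => simp
    | succ m ihm =>
      have hR := qBinom_pascal hq (((α + 1 : ℕ) : ℤ) + β + m - 1) m
      rw [← ihm, show (((α + 1 : ℕ) : ℤ) + β + m - 1) = (α : ℤ) + β + ((m + 1 : ℕ) : ℤ) - 1 by
        push_cast; ring, ← ihα, Finset.Nat.sum_antidiagonal_succ'] at hR
      rw [show ((α + 1 : ℕ) : ℤ) + β + ((m + 1 : ℕ) : ℤ) - 1 =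
        (α : ℤ) + β + ((m + 1 : ℕ) : ℤ) - 1 + 1 by push_cast; ring, hR,
        Finset.Nat.sum_antidiagonal_succ', mul_add, add_assoc, Finset.mul_sum, Finset.mul_sum,
        ← Finset.sum_add_distrib]
      congr 1
      · simp only [Nat.cast_zero, zero_mul, qBinom_zero, mul_one]
        rw [← mul_assoc, ← zpow_add₀ h0]
        congr 2; push_cast; ring
      · refine Finset.sum_congr rfl ?_
        rintro ⟨i, j⟩ hij
        have hij' : (m : ℤ) = i + j := by
          have := Finset.HasAntidiagonal.mem_antidiagonal.1 hij
          simp only at this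
          omega
        have hP := qBinom_pascal hq ((α : ℤ) + j) j
        simp only
        rw [show ((α + 1 : ℕ) : ℤ) - 1 + ((j + 1 : ℕ) : ℤ) = (α : ℤ) + j + 1 by push_cast; ring, hP,
          show (α : ℤ) - 1 + ((j + 1 : ℕ) : ℤ) = (α : ℤ) + j by push_cast; ring,
          show ((α + 1 : ℕ) : ℤ) - 1 + (j : ℤ) = (α : ℤ) + j by push_cast; ring]
        have e1 : (q : ℂ) ^ (((j + 1 : ℕ) : ℤ) * β - i * ((α + 1 : ℕ) : ℤ)) *
            (q : ℂ) ^ (-((j : ℤ) + 1)) = (q : ℂ) ^ (-((m : ℤ) + 1)) *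
            (q : ℂ) ^ (((j + 1 : ℕ) : ℤ) * β - i * (α : ℤ)) := by
          rw [← zpow_add₀ h0, ← zpow_add₀ h0, hij']
          congr 1; push_cast; ring
        have e2 : (q : ℂ) ^ (((j + 1 : ℕ) : ℤ) * β - i * ((α + 1 : ℕ) : ℤ)) *
            (q : ℂ) ^ ((α : ℤ) + j - j) =
            (q : ℂ) ^ ((α : ℤ) + β + ((m + 1 : ℕ) : ℤ) - 1 - m) *
            (q : ℂ) ^ ((j : ℤ) * β - i * ((α + 1 : ℕ) : ℤ)) := by
          rw [← zpow_add₀ h0, ← zpow_add₀ h0]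
          congr 1; push_cast; ring
        linear_combination (qBinom q (β - 1 + i) i * qBinom q ((α : ℤ) + j) (j + 1)) * e1 +
          (qBinom q (β - 1 + i) i * qBinom q ((α : ℤ) + j) j) * e2

/-! ### Weights -/

/-- Entrywise the relation K E K⁻¹ = q² E compares two powers of q, which are distinct for distinct
exponents. Integer weights are needed, and not only the action of K, because the Cartan factor of R
involves half powers of q. -/
theorem QMod.wt_of_E_ne_zero (hq : ∀ k : ℕ, 0 < k → q ^ k ≠ 1) (V : QMod q) {i j : V.ι}
    (h : V.E i j ≠ 0) : V.wt i = V.wt j + 2 := by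
  have h1 := congrFun (congrFun V.relE i) j
  simp only [kMat, Matrix.mul_diagonal, Matrix.diagonal_mul, Matrix.smul_apply, Pi.neg_apply,
    smul_eq_mul] at h1
  rw [mul_right_comm, ← zpow_add₀ q.coe_ne_zero, mul_left_inj' h, zpow_inj hq] at h1
  omega

theorem QMod.wt_of_F_ne_zero (hq : ∀ k : ℕ, 0 < k → q ^ k ≠ 1) (V : QMod q) {i j : V.ι}
    (h : V.F i j ≠ 0) : V.wt i = V.wt j - 2 := by
  have h1 := congrFun (congrFun V.relF i) j
  simp only [kMat, Matrix.mul_diagonal, Matrix.diagonal_mul, Matrix.smul_apply, Pi.neg_apply,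
    smul_eq_mul] at h1
  rw [mul_right_comm, ← zpow_add₀ q.coe_ne_zero, mul_left_inj' h, zpow_inj hq] at h1
  omega

theorem QMod.wt_of_F_pow_ne_zero (hq : ∀ k : ℕ, 0 < k → q ^ k ≠ 1) (V : QMod q) (n : ℕ)
    {i j : V.ι} (h : (V.F ^ n) i j ≠ 0) : V.wt i = V.wt j - 2 * n := by
  induction n generalizing i with
  | zero =>
    rw [pow_zero, Matrix.one_apply] at h
    have : i = j := by by_contra hij; simp [hij] at h
    simp [this]
  | succ n ih =>
    rw [pow_succ', Matrix.mul_apply] at h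
    obtain ⟨l, -, hl⟩ := Finset.exists_ne_zero_of_sum_ne_zero h
    have h1 := V.wt_of_F_ne_zero hq (left_ne_zero_of_mul hl)
    have h2 := ih (right_ne_zero_of_mul hl)
    push_cast
    omega

/-- The N-th power of F lowers weights by 2N, which exceeds the spread of the weights when N bounds
all their absolute values. -/
theorem QMod.isNilpotent_F (hq : ∀ k : ℕ, 0 < k → q ^ k ≠ 1) (V : QMod q) : IsNilpotent V.F := by
  obtain ⟨N, hN⟩ : ∃ N : ℕ, ∀ i : V.ι, |V.wt i| < N := by
    refine ⟨∑ i, (V.wt i).natAbs + 1, fun i => ?_⟩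
    have := Finset.single_le_sum (f := fun i => (V.wt i).natAbs) (fun _ _ => Nat.zero_le _)
      (Finset.mem_univ i)
    rw [Int.abs_eq_natAbs]
    exact_mod_cast Nat.lt_succ_of_le this
  refine ⟨N, ?_⟩
  ext i j
  by_contra h
  have h1 := V.wt_of_F_pow_ne_zero hq N h
  have h2 := abs_lt.1 (hN i)
  have h3 := abs_lt.1 (hN j)
  omega

theorem pow_card_eq_zero_of_isNilpotent {ι : Type} [Fintype ι] [DecidableEq ι]
    {M : Matrix ι ι ℂ} (h : IsNilpotent M) : M ^ Fintype.card ι = 0 := by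
  have h1 := sub_eq_zero.1 (Matrix.isNilpotent_charpoly_sub_pow_of_isNilpotent h).eq_zero
  have h2 := Matrix.aeval_self_charpoly M
  rwa [h1, map_pow, Polynomial.aeval_X] at h2

/-- This justifies truncating the universal R-matrix at the dimension of the first factor, or at any
larger bound. -/
theorem QMod.F_pow_card (hq : ∀ k : ℕ, 0 < k → q ^ k ≠ 1) (V : QMod q) :
    V.F ^ Fintype.card V.ι = 0 :=
  pow_card_eq_zero_of_isNilpotent (V.isNilpotent_F hq)

/-! ### Commutation relations -/

/-- The coefficient of `F^i ⊗ E^i` in the universal `R`-matrix. -/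
noncomputable def rCoeff (q : Circle) (i : ℕ) : ℂ :=
  (q : ℂ) ^ (i.choose 2) * ((q : ℂ) - (q : ℂ)⁻¹) ^ i / qFact q i

/-- The factor on the left is the scalar that appears when e is commuted past the (i+1)-st power of
f, so this is the recursion that intertwining the two coproducts imposes on the coefficients of R.
-/
theorem rCoeff_succ (hq : ∀ k : ℕ, 0 < k → q ^ k ≠ 1) (i : ℕ) :
    rCoeff q (i + 1) * (((q : ℂ) - (q : ℂ) ^ (-(2 * i + 1 : ℤ))) / ((q : ℂ) - (q : ℂ)⁻¹) ^ 2) =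
      rCoeff q i := by
  have h0 : (q : ℂ) ≠ 0 := q.coe_ne_zero
  have h1 := qFact_ne_zero hq i
  have h2 := sub_inv_ne_zero hq
  have h3 : qInt q ((i : ℤ) + 1) ≠ 0 := qInt_ne_zero hq (by omega)
  have h4 : (q : ℂ) ^ i * ((q : ℂ) - (q : ℂ) ^ (-(2 * i + 1 : ℤ))) =
      qInt q ((i : ℤ) + 1) * ((q : ℂ) - (q : ℂ)⁻¹) := by
    rw [qInt, div_mul_cancel₀ _ h2, mul_sub, ← zpow_natCast, ← zpow_add₀ h0, ← zpow_add_one₀ h0]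
    congr 2
    ring
  have h5 : (i + 1).choose 2 = i + i.choose 2 := by
    rw [Nat.choose_succ_succ' i 1, Nat.choose_one_right]
  rw [rCoeff, rCoeff, qFact_succ, h5, pow_add, pow_succ]
  rw [div_mul_div_comm, div_eq_div_iff (by positivity) h1]
  linear_combination ((q : ℂ) ^ i.choose 2 * ((q : ℂ) - (q : ℂ)⁻¹) ^ i *
    ((q : ℂ) - (q : ℂ)⁻¹) * qFact q i) * h4

/-- Stated in an abstract algebra so that it serves both for (E, F, K, K⁻¹) and, with the roles
exchanged, for (F, E, K⁻¹, K). -/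
theorem rCoeff_smul_commutator {R : Type*} [Ring R] [Algebra ℂ R]
    (hq : ∀ k : ℕ, 0 < k → q ^ k ≠ 1) {e f k k' : R}
    (hk : k * f = (q : ℂ) ^ (-2 : ℤ) • (f * k)) (hk' : k' * f = (q : ℂ) ^ (2 : ℤ) • (f * k'))
    (hef : e * f - f * e = ((q : ℂ) - (q : ℂ)⁻¹)⁻¹ • (k - k')) (i : ℕ) :
    rCoeff q (i + 1) • (e * f ^ (i + 1) - f ^ (i + 1) * e) =
      rCoeff q i • (f ^ i * k - k' * f ^ i) := by
  have h0 : (q : ℂ) ≠ 0 := q.coe_ne_zero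
  have h2 := sub_inv_ne_zero hq
  have hk'' : ∀ n : ℕ, k' * f ^ n = (q : ℂ) ^ (2 * n : ℤ) • (f ^ n * k') := by
    intro n
    induction n with
    | zero => simp
    | succ n ih =>
      rw [pow_succ, ← mul_assoc, ih, smul_mul_assoc, mul_assoc, hk', mul_smul_comm, smul_smul,
        ← zpow_add₀ h0, mul_assoc]
      congr 2
  have key : ∀ n : ℕ, e * f ^ (n + 1) - f ^ (n + 1) * e =
      (((q : ℂ) - (q : ℂ) ^ (-(2 * n + 1 : ℤ))) / ((q : ℂ) - (q : ℂ)⁻¹) ^ 2) •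
        (f ^ n * k - k' * f ^ n) := by
    intro n
    induction n with
    | zero =>
      simp only [zero_add, pow_one, hef, pow_zero, one_mul, mul_one]
      congr 1
      simp only [Nat.cast_zero, mul_zero, zero_add, zpow_neg_one]
      field_simp
    | succ n ih =>
      have e1 : e * f ^ (n + 1 + 1) - f ^ (n + 1 + 1) * e =
          (e * f ^ (n + 1) - f ^ (n + 1) * e) * f + f ^ (n + 1) * (e * f - f * e) := by
        rw [pow_succ f (n + 1)]; noncomm_ring
      have e2 : f ^ n * k * f = (q : ℂ) ^ (-2 : ℤ) • (f ^ (n + 1) * k) := by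
        rw [mul_assoc, hk, mul_smul_comm, ← mul_assoc, ← pow_succ]
      have e3 : f ^ (n + 1) * k' = (q : ℂ) ^ (-(2 * n + 2) : ℤ) • (k' * f ^ (n + 1)) := by
        rw [hk'', smul_smul, ← zpow_add₀ h0]
        have : -(2 * (n : ℤ) + 2) + 2 * ((n + 1 : ℕ) : ℤ) = 0 := by push_cast; ring
        rw [this, zpow_zero, one_smul]
      rw [e1, ih, hef, mul_smul_comm, mul_sub, e3, smul_mul_assoc, sub_mul, e2, mul_assoc k',
        ← pow_succ, ← sub_eq_zero]
      have e4 : (q : ℂ) ^ (-(2 * (n + 1 : ℕ) + 1 : ℤ)) =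
          (q : ℂ) ^ (-(2 * n + 1) : ℤ) * (q : ℂ) ^ (-2 : ℤ) := by
        rw [← zpow_add₀ h0]; congr 1
      have e5 : (q : ℂ) ^ (-(2 * n + 2) : ℤ) = (q : ℂ) ^ (-(2 * n + 1) : ℤ) * (q : ℂ)⁻¹ := by
        rw [← zpow_sub_one₀ h0]; congr 1
      rw [e4, e5]
      set a := (q : ℂ) ^ (-(2 * n + 1) : ℤ)
      have e6 : (q : ℂ) ^ (-2 : ℤ) = (q : ℂ)⁻¹ * (q : ℂ)⁻¹ := by
        rw [← zpow_neg_one, ← zpow_add₀ h0]; norm_num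
      rw [e6]
      have e7 : (q : ℂ) * (q : ℂ)⁻¹ = 1 := mul_inv_cancel₀ h0
      set b := (q : ℂ)⁻¹
      set c := ((q : ℂ) - b)⁻¹
      have e8 : c * ((q : ℂ) - b) = 1 := inv_mul_cancel₀ h2
      have e9 : ∀ z : ℂ, z / ((q : ℂ) - b) ^ 2 = z * c ^ 2 := fun z => by
        rw [div_eq_mul_inv, inv_pow]
      rw [e9, e9]
      -- With b = q⁻¹ and c = (q - q⁻¹)⁻¹, the claim is an identity between combinations of f^(n+1)
      -- k and k' f^(n+1). Here `s1` and `s2` say that the two coefficients agree.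
      have s1 : ((q : ℂ) - a) * c ^ 2 * (b * b) + c - ((q : ℂ) - a * (b * b)) * c ^ 2 = 0 := by
        linear_combination (b * c ^ 2) * e7 - c * e8
      have s2 : ((q : ℂ) - a) * c ^ 2 + c * (a * b) - ((q : ℂ) - a * (b * b)) * c ^ 2 = 0 := by
        linear_combination (a * c ^ 2) * e7 - (a * b * c) * e8
      generalize f ^ (n + 1) * k = X
      generalize k' * f ^ (n + 1) = Y
      have s3 : (((q : ℂ) - a) * c ^ 2) • ((b * b) • X - Y) + c • (X - (a * b) • Y) -
          (((q : ℂ) - a * (b * b)) * c ^ 2) • (X - Y) =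
          (((q : ℂ) - a) * c ^ 2 * (b * b) + c - ((q : ℂ) - a * (b * b)) * c ^ 2) • X -
          (((q : ℂ) - a) * c ^ 2 + c * (a * b) - ((q : ℂ) - a * (b * b)) * c ^ 2) • Y := by
        module
      rw [s3, s1, s2, zero_smul, zero_smul, sub_zero]
  rw [key, smul_smul, rCoeff_succ hq]

/-! ### The `R`-matrix intertwines the coproduct and the opposite coproduct -/

theorem QMod.K_mul_F (V : QMod q) : V.K * V.F = (q : ℂ) ^ (-2 : ℤ) • (V.F * V.K) := by
  rw [QMod.K, ← Matrix.smul_mul, ← V.relF, mul_assoc, kMat_neg_mul_kMat, mul_one]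

theorem QMod.K_mul_E (V : QMod q) : V.K * V.E = (q : ℂ) ^ (2 : ℤ) • (V.E * V.K) := by
  rw [QMod.K, ← Matrix.smul_mul, ← V.relE, mul_assoc, kMat_neg_mul_kMat, mul_one]

theorem QMod.K_mul_Kinv (V : QMod q) : V.K * V.Kinv = 1 := kMat_mul_kMat_neg q V.wt

theorem QMod.Kinv_mul_K (V : QMod q) : V.Kinv * V.K = 1 := kMat_neg_mul_kMat q V.wt

theorem QMod.Kinv_mul_F (V : QMod q) : V.Kinv * V.F = (q : ℂ) ^ (2 : ℤ) • (V.F * V.Kinv) := by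
  have h0 : (q : ℂ) ≠ 0 := q.coe_ne_zero
  have h : V.F * V.K = (q : ℂ) ^ (2 : ℤ) • (V.K * V.F) := by
    rw [V.K_mul_F, smul_smul, ← zpow_add₀ h0]; simp
  calc V.Kinv * V.F = V.Kinv * (V.F * V.K) * V.Kinv := by
        rw [mul_assoc, mul_assoc, V.K_mul_Kinv, mul_one]
    _ = _ := by
        rw [h, Matrix.mul_smul, Matrix.smul_mul, ← mul_assoc, V.Kinv_mul_K, one_mul]

theorem QMod.Kinv_mul_E (V : QMod q) : V.Kinv * V.E = (q : ℂ) ^ (-2 : ℤ) • (V.E * V.Kinv) := by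
  have h0 : (q : ℂ) ≠ 0 := q.coe_ne_zero
  have h : V.E * V.K = (q : ℂ) ^ (-2 : ℤ) • (V.K * V.E) := by
    rw [V.K_mul_E, smul_smul, ← zpow_add₀ h0]; simp
  calc V.Kinv * V.E = V.Kinv * (V.E * V.K) * V.Kinv := by
        rw [mul_assoc, mul_assoc, V.K_mul_Kinv, mul_one]
    _ = _ := by
        rw [h, Matrix.mul_smul, Matrix.smul_mul, ← mul_assoc, V.Kinv_mul_K, one_mul]

theorem QMod.rCoeff_commutator_E (hq : ∀ k : ℕ, 0 < k → q ^ k ≠ 1) (V : QMod q) (i : ℕ) :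
    rCoeff q (i + 1) • (V.E * V.F ^ (i + 1) - V.F ^ (i + 1) * V.E) =
      rCoeff q i • (V.F ^ i * V.K - V.Kinv * V.F ^ i) :=
  rCoeff_smul_commutator hq V.K_mul_F V.Kinv_mul_F V.relEF i

theorem QMod.rCoeff_commutator_F (hq : ∀ k : ℕ, 0 < k → q ^ k ≠ 1) (V : QMod q) (i : ℕ) :
    rCoeff q (i + 1) • (V.F * V.E ^ (i + 1) - V.E ^ (i + 1) * V.F) =
      rCoeff q i • (V.E ^ i * V.Kinv - V.K * V.E ^ i) := by
  refine rCoeff_smul_commutator hq V.Kinv_mul_E V.K_mul_E ?_ i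
  rw [← neg_sub, V.relEF, ← smul_neg, neg_sub]
  rfl

/-- The Cartan factor `q^(H⊗H/2)` of the universal `R`-matrix. -/
noncomputable def cartanMat (s : Circle) (V W : QMod q) : Matrix (V.ι × W.ι) (V.ι × W.ι) ℂ :=
  Matrix.diagonal fun p => (s : ℂ) ^ (V.wt p.1 * W.wt p.2)

/-- The unipotent factor of the universal `R`-matrix, truncated after `n` terms. -/
noncomputable def thetaMat (V W : QMod q) (n : ℕ) : Matrix (V.ι × W.ι) (V.ι × W.ι) ℂ :=
  ∑ i ∈ Finset.range n, rCoeff q i • ((V.F ^ i) ⊗ₖ (W.E ^ i))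

theorem RMat_eq (hq : ∀ k : ℕ, 0 < k → q ^ k ≠ 1) (s : Circle) (V W : QMod q) {n : ℕ}
    (hn : Fintype.card V.ι ≤ n) : RMat s V W = cartanMat s V W * thetaMat V W n := by
  rw [RMat, cartanMat, thetaMat]
  congr 1
  refine Finset.sum_subset (Finset.range_subset_range.2 hn) fun i _ hi => ?_
  have hi' : Fintype.card V.ι ≤ i := by simpa using hi
  rw [← Nat.sub_add_cancel hi', pow_add V.F, V.F_pow_card hq, mul_zero, Matrix.zero_kronecker,
    smul_zero]

/-- E shifts the weight of one tensor factor by 2, so moving it past s^(hh') costs s raised to ±2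
times the weight of the other factor, which is the action of K or K⁻¹ there. -/
theorem opE_mul_cartanMat (hq : ∀ k : ℕ, 0 < k → q ^ k ≠ 1) {s : Circle} (hs : s ^ 2 = q)
    (V W : QMod q) :
    ((1 : Matrix V.ι V.ι ℂ) ⊗ₖ W.E + V.E ⊗ₖ W.K) * cartanMat s V W =
      cartanMat s V W * (V.Kinv ⊗ₖ W.E + V.E ⊗ₖ (1 : Matrix W.ι W.ι ℂ)) := by
  have h0 : (s : ℂ) ≠ 0 := s.coe_ne_zero
  have hqs : (q : ℂ) = (s : ℂ) ^ (2 : ℤ) := by rw [← hs]; simp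
  ext ⟨i, j⟩ ⟨i', j'⟩
  simp only [cartanMat, QMod.K, QMod.Kinv, kMat, Matrix.mul_diagonal, Matrix.diagonal_mul,
    Matrix.add_apply, Matrix.kroneckerMap_apply, Matrix.one_apply, Matrix.diagonal_apply,
    Pi.neg_apply]
  rw [add_mul, mul_add]
  congr 1
  · by_cases hi : i = i'
    · subst hi
      by_cases hE : W.E j j' = 0
      · simp [hE]
      · simp only [if_true]
        rw [W.wt_of_E_ne_zero hq hE, one_mul, hqs, ← zpow_mul, mul_left_comm, ← mul_assoc,
          ← zpow_add₀ h0, mul_comm]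
        congr 2
        ring
    · simp [hi]
  · by_cases hj : j = j'
    · subst hj
      by_cases hE : V.E i i' = 0
      · simp [hE]
      · simp only [if_true]
        rw [V.wt_of_E_ne_zero hq hE, mul_one, hqs, ← zpow_mul, mul_assoc, ← zpow_add₀ h0, mul_comm]
        congr 2
        ring
    · simp [hj]

theorem opF_mul_cartanMat (hq : ∀ k : ℕ, 0 < k → q ^ k ≠ 1) {s : Circle} (hs : s ^ 2 = q)
    (V W : QMod q) :
    (V.F ⊗ₖ (1 : Matrix W.ι W.ι ℂ) + V.Kinv ⊗ₖ W.F) * cartanMat s V W =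
      cartanMat s V W * (V.F ⊗ₖ W.K + (1 : Matrix V.ι V.ι ℂ) ⊗ₖ W.F) := by
  have h0 : (s : ℂ) ≠ 0 := s.coe_ne_zero
  have hqs : (q : ℂ) = (s : ℂ) ^ (2 : ℤ) := by rw [← hs]; simp
  ext ⟨i, j⟩ ⟨i', j'⟩
  simp only [cartanMat, QMod.K, QMod.Kinv, kMat, Matrix.mul_diagonal, Matrix.diagonal_mul,
    Matrix.add_apply, Matrix.kroneckerMap_apply, Matrix.one_apply, Matrix.diagonal_apply,
    Pi.neg_apply]
  rw [add_mul, mul_add]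
  congr 1
  · by_cases hj : j = j'
    · subst hj
      by_cases hF : V.F i i' = 0
      · simp [hF]
      · simp only [if_true]
        rw [V.wt_of_F_ne_zero hq hF, mul_one, hqs, ← zpow_mul, mul_left_comm, ← zpow_add₀ h0]
        congr 2
        ring
    · simp [hj]
  · by_cases hi : i = i'
    · subst hi
      by_cases hF : W.F j j' = 0
      · simp [hF]
      · simp only [if_true]
        rw [W.wt_of_F_ne_zero hq hF, one_mul, hqs, ← zpow_mul, mul_right_comm, ← zpow_add₀ h0]
        congr 2
        ring
    · simp [hi]

theorem sub_kronecker' {ι κ : Type} (A B : Matrix ι ι ℂ) (C : Matrix κ κ ℂ) :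
    (A - B) ⊗ₖ C = A ⊗ₖ C - B ⊗ₖ C := by
  ext; simp [sub_mul]

theorem kronecker_sub' {ι κ : Type} (A : Matrix ι ι ℂ) (B C : Matrix κ κ ℂ) :
    A ⊗ₖ (B - C) = A ⊗ₖ B - A ⊗ₖ C := by
  ext; simp [mul_sub]

theorem sum_range_eq_sum_range_succ {M : Type*} [AddCommGroup M] {g : ℕ → M} {n : ℕ}
    (h0 : g 0 = 0) (hn : g n = 0) :
    ∑ i ∈ Finset.range n, g i = ∑ i ∈ Finset.range n, g (i + 1) := by
  have h := (Finset.sum_range_succ g n).symm.trans (Finset.sum_range_succ' g n)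
  rwa [h0, hn, add_zero, add_zero] at h

/-- The terms of degree i + 1 in E on the second factor are balanced by the commutator of E with the
(i+1)-st power of F on the first. The resulting sums differ by an index shift. -/
theorem thetaMat_mul_E (hq : ∀ k : ℕ, 0 < k → q ^ k ≠ 1) (V W : QMod q) :
    thetaMat V W (Fintype.card V.ι) * (V.E ⊗ₖ (1 : Matrix W.ι W.ι ℂ) + V.K ⊗ₖ W.E) =
      (V.Kinv ⊗ₖ W.E + V.E ⊗ₖ (1 : Matrix W.ι W.ι ℂ)) * thetaMat V W (Fintype.card V.ι) := by
  have key : ∑ i ∈ Finset.range (Fintype.card V.ι),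
      rCoeff q i • ((V.E * V.F ^ i - V.F ^ i * V.E) ⊗ₖ (W.E ^ i)) =
      ∑ i ∈ Finset.range (Fintype.card V.ι),
        rCoeff q i • ((V.F ^ i * V.K - V.Kinv * V.F ^ i) ⊗ₖ (W.E ^ (i + 1))) := by
    -- The boundary terms of the shift vanish: at 0 the commutator with 1 is zero, and at the top
    -- the power of F is zero.
    rw [sum_range_eq_sum_range_succ]
    · refine Finset.sum_congr rfl fun i _ => ?_
      rw [← Matrix.smul_kronecker, V.rCoeff_commutator_E hq, Matrix.smul_kronecker]
    · simp
    · simp [V.F_pow_card hq]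
  rw [← sub_eq_zero] at key ⊢
  rw [thetaMat, Finset.sum_mul, Finset.mul_sum, ← Finset.sum_sub_distrib]
  rw [← Finset.sum_sub_distrib, ← neg_eq_zero, ← Finset.sum_neg_distrib] at key
  rw [← key]
  refine Finset.sum_congr rfl fun i _ => ?_
  simp only [mul_add, add_mul, Matrix.smul_mul, Matrix.mul_smul, ← Matrix.mul_kronecker_mul,
    mul_one, one_mul, sub_kronecker', smul_sub, ← pow_succ, ← pow_succ']
  abel

theorem thetaMat_mul_F (hq : ∀ k : ℕ, 0 < k → q ^ k ≠ 1) (V W : QMod q) :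
    thetaMat V W (Fintype.card V.ι) * ((1 : Matrix V.ι V.ι ℂ) ⊗ₖ W.F + V.F ⊗ₖ W.Kinv) =
      (V.F ⊗ₖ W.K + (1 : Matrix V.ι V.ι ℂ) ⊗ₖ W.F) * thetaMat V W (Fintype.card V.ι) := by
  have key : ∑ i ∈ Finset.range (Fintype.card V.ι),
      rCoeff q i • ((V.F ^ i) ⊗ₖ (W.F * W.E ^ i - W.E ^ i * W.F)) =
      ∑ i ∈ Finset.range (Fintype.card V.ι),
        rCoeff q i • ((V.F ^ (i + 1)) ⊗ₖ (W.E ^ i * W.Kinv - W.K * W.E ^ i)) := by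
    rw [sum_range_eq_sum_range_succ]
    · refine Finset.sum_congr rfl fun i _ => ?_
      rw [← Matrix.kronecker_smul, W.rCoeff_commutator_F hq, Matrix.kronecker_smul]
    · simp
    · simp [V.F_pow_card hq]
  rw [← sub_eq_zero] at key ⊢
  rw [thetaMat, Finset.sum_mul, Finset.mul_sum, ← Finset.sum_sub_distrib]
  rw [← Finset.sum_sub_distrib, ← neg_eq_zero, ← Finset.sum_neg_distrib] at key
  rw [← key]
  refine Finset.sum_congr rfl fun i _ => ?_
  simp only [mul_add, add_mul, Matrix.smul_mul, Matrix.mul_smul, ← Matrix.mul_kronecker_mul,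
    mul_one, one_mul, kronecker_sub', smul_sub, ← pow_succ, ← pow_succ']
  abel

theorem RMat_mul_E (hq : ∀ k : ℕ, 0 < k → q ^ k ≠ 1) {s : Circle} (hs : s ^ 2 = q) (V W : QMod q) :
    RMat s V W * (V.E ⊗ₖ (1 : Matrix W.ι W.ι ℂ) + V.K ⊗ₖ W.E) =
      ((1 : Matrix V.ι V.ι ℂ) ⊗ₖ W.E + V.E ⊗ₖ W.K) * RMat s V W := by
  rw [RMat_eq hq s V W le_rfl, mul_assoc, thetaMat_mul_E hq, ← mul_assoc, ← mul_assoc,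
    opE_mul_cartanMat hq hs]

theorem RMat_mul_F (hq : ∀ k : ℕ, 0 < k → q ^ k ≠ 1) {s : Circle} (hs : s ^ 2 = q) (V W : QMod q) :
    RMat s V W * ((1 : Matrix V.ι V.ι ℂ) ⊗ₖ W.F + V.F ⊗ₖ W.Kinv) =
      (V.F ⊗ₖ (1 : Matrix W.ι W.ι ℂ) + V.Kinv ⊗ₖ W.F) * RMat s V W := by
  rw [RMat_eq hq s V W le_rfl, mul_assoc, thetaMat_mul_F hq, ← mul_assoc, ← mul_assoc,
    opF_mul_cartanMat hq hs]

theorem RMat_mul_K (s : Circle) (V W : QMod q) :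
    RMat s V W * (V.K ⊗ₖ W.K) = (V.K ⊗ₖ W.K) * RMat s V W := by
  have h0 : (q : ℂ) ≠ 0 := q.coe_ne_zero
  have hF : ∀ i : ℕ, V.K * V.F ^ i = (q : ℂ) ^ (-2 * i : ℤ) • (V.F ^ i * V.K) := by
    intro i
    induction i with
    | zero => simp
    | succ i ih =>
      rw [pow_succ, ← mul_assoc, ih, Matrix.smul_mul, mul_assoc, V.K_mul_F, Matrix.mul_smul,
        smul_smul, ← zpow_add₀ h0, mul_assoc]
      congr 2; push_cast; ring
  have hE : ∀ i : ℕ, W.K * W.E ^ i = (q : ℂ) ^ (2 * i : ℤ) • (W.E ^ i * W.K) := by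
    intro i
    induction i with
    | zero => simp
    | succ i ih =>
      rw [pow_succ, ← mul_assoc, ih, Matrix.smul_mul, mul_assoc, W.K_mul_E, Matrix.mul_smul,
        smul_smul, ← zpow_add₀ h0, mul_assoc]
      congr 2
  have hD : Matrix.diagonal (fun p : V.ι × W.ι => (s : ℂ) ^ (V.wt p.1 * W.wt p.2)) * (V.K ⊗ₖ W.K) =
      (V.K ⊗ₖ W.K) * Matrix.diagonal (fun p => (s : ℂ) ^ (V.wt p.1 * W.wt p.2)) := by
    rw [QMod.K, QMod.K, ← kMat_kronecker, kMat, Matrix.diagonal_mul_diagonal,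
      Matrix.diagonal_mul_diagonal]
    simp only [mul_comm]
  rw [RMat, ← mul_assoc, ← hD, mul_assoc, mul_assoc]
  congr 1
  rw [Finset.sum_mul, Finset.mul_sum]
  refine Finset.sum_congr rfl fun i _ => ?_
  rw [Matrix.mul_smul, Matrix.smul_mul, ← Matrix.mul_kronecker_mul, ← Matrix.mul_kronecker_mul,
    hF, hE, Matrix.smul_kronecker, Matrix.kronecker_smul, smul_smul (_ ^ _), ← zpow_add₀ h0]
  simp

theorem kronecker_submatrix_swap {ι κ : Type} (A : Matrix ι ι ℂ) (B : Matrix κ κ ℂ) :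
    (A ⊗ₖ B).submatrix Prod.swap Prod.swap = B ⊗ₖ A := by
  ext ⟨i, j⟩ ⟨i', j'⟩
  simp [mul_comm]

theorem submatrix_swap_mul {ι κ : Type} [Fintype ι] [Fintype κ]
    (A B : Matrix (ι × κ) (ι × κ) ℂ) :
    (A * B).submatrix Prod.swap Prod.swap =
      A.submatrix Prod.swap Prod.swap * B.submatrix Prod.swap Prod.swap :=
  Matrix.submatrix_mul A B _ _ _ Prod.swap_bijective

theorem R21Mat_mul_E (hq : ∀ k : ℕ, 0 < k → q ^ k ≠ 1) {s : Circle} (hs : s ^ 2 = q)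
    (V W : QMod q) :
    R21Mat s V W * ((1 : Matrix V.ι V.ι ℂ) ⊗ₖ W.E + V.E ⊗ₖ W.K) =
      (V.E ⊗ₖ (1 : Matrix W.ι W.ι ℂ) + V.K ⊗ₖ W.E) * R21Mat s V W := by
  have h := congrArg (fun M => M.submatrix Prod.swap Prod.swap) (RMat_mul_E hq hs W V)
  simpa only [submatrix_swap_mul, Matrix.submatrix_add, Pi.add_apply, kronecker_submatrix_swap, R21Mat,
    add_comm] using h

theorem R21Mat_mul_F (hq : ∀ k : ℕ, 0 < k → q ^ k ≠ 1) {s : Circle} (hs : s ^ 2 = q)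
    (V W : QMod q) :
    R21Mat s V W * (V.F ⊗ₖ (1 : Matrix W.ι W.ι ℂ) + V.Kinv ⊗ₖ W.F) =
      ((1 : Matrix V.ι V.ι ℂ) ⊗ₖ W.F + V.F ⊗ₖ W.Kinv) * R21Mat s V W := by
  have h := congrArg (fun M => M.submatrix Prod.swap Prod.swap) (RMat_mul_F hq hs W V)
  simpa only [submatrix_swap_mul, Matrix.submatrix_add, Pi.add_apply, kronecker_submatrix_swap, R21Mat,
    add_comm] using h

theorem R21Mat_mul_K (s : Circle) (V W : QMod q) :
    R21Mat s V W * (V.K ⊗ₖ W.K) = (V.K ⊗ₖ W.K) * R21Mat s V W := by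
  have h := congrArg (fun M => M.submatrix Prod.swap Prod.swap) (RMat_mul_K s W V)
  simpa only [submatrix_swap_mul, kronecker_submatrix_swap, R21Mat] using h

/-! ### The inverse square root on eigenspaces -/

theorem aeval_mul_of_mul_eq_smul {ι κ : Type} [Fintype ι] [DecidableEq ι] {M : Matrix ι ι ℂ}
    {g : Matrix ι κ ℂ} {z : ℂ} (h : M * g = z • g) (p : Polynomial ℂ) :
    Polynomial.aeval M p * g = p.eval z • g := by
  induction p using Polynomial.induction_on' with
  | add p r hp hr => rw [map_add, Matrix.add_mul, hp, hr, Polynomial.eval_add, add_smul]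
  | monomial n c =>
    have hn : M ^ n * g = z ^ n • g := by
      induction n with
      | zero => simp
      | succ n ih => rw [pow_succ, Matrix.mul_assoc, h, Matrix.mul_smul, ih, smul_smul, pow_succ']
    rw [Polynomial.aeval_monomial, Polynomial.eval_monomial, Matrix.mul_assoc, hn,
      Algebra.algebraMap_eq_smul_one, Matrix.smul_mul, Matrix.one_mul, smul_smul]

theorem invSqrtBranch_zpow (hq : ∀ k : ℕ, 0 < k → q ^ k ≠ 1) (s : Circle) (k : ℤ) :
    invSqrtBranch q s ((q : ℂ) ^ k) = (s : ℂ) ^ (-k) := by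
  have h : ∃ l : ℤ, (q : ℂ) ^ k = (q : ℂ) ^ l := ⟨k, rfl⟩
  rw [invSqrtBranch, dif_pos h, ← (zpow_inj hq).1 h.choose_spec]

/-- The matrix `g` is rectangular, so that it can be a whole morphism whose columns are
eigenvectors. The interpolating polynomial takes the value of the branch at q^k because q^k is one
of its nodes. -/
theorem invSqrt_mul (hq : ∀ k : ℕ, 0 < k → q ^ k ≠ 1) (s : Circle) {ι κ : Type} [Fintype ι]
    [DecidableEq ι] {M : Matrix ι ι ℂ} {g : Matrix ι κ ℂ} {k : ℤ}
    (h : M * g = (q : ℂ) ^ k • g) : invSqrt q s M * g = (s : ℂ) ^ (-k) • g := by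
  by_cases hg : g = 0
  · simp [hg]
  have h1 := aeval_mul_of_mul_eq_smul h M.charpoly
  -- By Cayley–Hamilton the characteristic polynomial annihilates `g`, on which it acts by its value
  -- at q^k. As `g` is nonzero, q^k is a root.
  rw [Matrix.aeval_self_charpoly, Matrix.zero_mul, eq_comm, smul_eq_zero, or_iff_left hg] at h1
  have h2 : (q : ℂ) ^ k ∈ M.charpoly.roots.toFinset := by
    rw [Multiset.mem_toFinset, Polynomial.mem_roots M.charpoly_monic.ne_zero]
    exact h1
  rw [invSqrt, aeval_mul_of_mul_eq_smul h]
  have h3 := Lagrange.eval_interpolate_at_node (s := M.charpoly.roots.toFinset) (v := id)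
    (invSqrtBranch q s) Function.injective_id.injOn h2
  rw [id] at h3
  rw [h3, invSqrtBranch_zpow hq]

/-! ### Morphisms -/

theorem Mult.E_comm {V T : QMod q} {f : Matrix T.ι V.ι ℂ} (hf : f ∈ Mult V T) :
    f * V.E = T.E * f := hf.1

theorem Mult.F_comm {V T : QMod q} {f : Matrix T.ι V.ι ℂ} (hf : f ∈ Mult V T) :
    f * V.F = T.F * f := hf.2.1

theorem Mult.K_comm {V T : QMod q} {f : Matrix T.ι V.ι ℂ} (hf : f ∈ Mult V T) :
    f * V.K = T.K * f := hf.2.2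

theorem Mult.mul_mem {V T S : QMod q} {f : Matrix T.ι V.ι ℂ} {g : Matrix S.ι T.ι ℂ}
    (hg : g ∈ Mult T S) (hf : f ∈ Mult V T) : g * f ∈ Mult V S := by
  refine ⟨?_, ?_, ?_⟩
  · rw [Matrix.mul_assoc, Mult.E_comm hf, ← Matrix.mul_assoc, Mult.E_comm hg, Matrix.mul_assoc]
  · rw [Matrix.mul_assoc, Mult.F_comm hf, ← Matrix.mul_assoc, Mult.F_comm hg, Matrix.mul_assoc]
  · rw [Matrix.mul_assoc, Mult.K_comm hf, ← Matrix.mul_assoc, Mult.K_comm hg, Matrix.mul_assoc]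

theorem Mult.wt_eq (hq : ∀ k : ℕ, 0 < k → q ^ k ≠ 1) {V T : QMod q} {f : Matrix T.ι V.ι ℂ}
    (hf : f ∈ Mult V T) {i : T.ι} {j : V.ι} (h : f i j ≠ 0) : T.wt i = V.wt j := by
  have h1 := congrFun (congrFun (Mult.K_comm hf) i) j
  simp only [QMod.K, kMat, Matrix.mul_diagonal, Matrix.diagonal_mul] at h1
  rw [mul_comm, mul_left_inj' h, zpow_inj hq] at h1
  exact h1.symm

theorem Mult.F_pow_comm {V T : QMod q} {f : Matrix T.ι V.ι ℂ} (hf : f ∈ Mult V T) (n : ℕ) :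
    T.F ^ n * f = f * V.F ^ n := by
  induction n with
  | zero => simp
  | succ n ih =>
    rw [pow_succ, Matrix.mul_assoc, ← Mult.F_comm hf, ← Matrix.mul_assoc, ih, Matrix.mul_assoc,
      ← pow_succ]

theorem Mult.E_pow_comm {V T : QMod q} {f : Matrix T.ι V.ι ℂ} (hf : f ∈ Mult V T) (n : ℕ) :
    T.E ^ n * f = f * V.E ^ n := by
  induction n with
  | zero => simp
  | succ n ih =>
    rw [pow_succ, Matrix.mul_assoc, ← Mult.E_comm hf, ← Matrix.mul_assoc, ih, Matrix.mul_assoc,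
      ← pow_succ]

/-! ### Naturality of the R-matrix and of the monodromy R²¹R -/

theorem RMat_mul_kronecker_one (hq : ∀ k : ℕ, 0 < k → q ^ k ≠ 1) (s : Circle) {V T : QMod q}
    (W : QMod q) {f : Matrix T.ι V.ι ℂ} (hf : f ∈ Mult V T) :
    RMat s T W * (f ⊗ₖ (1 : Matrix W.ι W.ι ℂ)) = (f ⊗ₖ (1 : Matrix W.ι W.ι ℂ)) * RMat s V W := by
  -- The two R-matrices are truncated at different dimensions, so both are first rewritten with a
  -- common bound.
  rw [RMat_eq hq s T W (Nat.le_add_left _ (Fintype.card V.ι)),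
    RMat_eq hq s V W (Nat.le_add_right _ (Fintype.card T.ι)), Matrix.mul_assoc]
  have h1 : thetaMat T W (Fintype.card V.ι + Fintype.card T.ι) * (f ⊗ₖ (1 : Matrix W.ι W.ι ℂ)) =
      (f ⊗ₖ (1 : Matrix W.ι W.ι ℂ)) * thetaMat V W (Fintype.card V.ι + Fintype.card T.ι) := by
    rw [thetaMat, thetaMat, Matrix.sum_mul, Matrix.mul_sum]
    refine Finset.sum_congr rfl fun i _ => ?_
    rw [Matrix.smul_mul, Matrix.mul_smul, ← Matrix.mul_kronecker_mul, ← Matrix.mul_kronecker_mul,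
      Mult.F_pow_comm hf, mul_one, one_mul]
  have h2 : cartanMat s T W * (f ⊗ₖ (1 : Matrix W.ι W.ι ℂ)) =
      (f ⊗ₖ (1 : Matrix W.ι W.ι ℂ)) * cartanMat s V W := by
    ext ⟨i, j⟩ ⟨i', j'⟩
    simp only [cartanMat, Matrix.mul_diagonal, Matrix.diagonal_mul, Matrix.kroneckerMap_apply,
      Matrix.one_apply]
    by_cases h : f i i' = 0
    · simp [h]
    · by_cases hj : j = j'
      · rw [Mult.wt_eq hq hf h, hj, mul_comm]
      · simp [hj]
  rw [h1, ← Matrix.mul_assoc, h2, Matrix.mul_assoc]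

theorem RMat_mul_one_kronecker (hq : ∀ k : ℕ, 0 < k → q ^ k ≠ 1) (s : Circle) {V T : QMod q}
    (W : QMod q) {f : Matrix T.ι V.ι ℂ} (hf : f ∈ Mult V T) :
    RMat s W T * ((1 : Matrix W.ι W.ι ℂ) ⊗ₖ f) = ((1 : Matrix W.ι W.ι ℂ) ⊗ₖ f) * RMat s W V := by
  rw [RMat_eq hq s W T le_rfl, RMat_eq hq s W V le_rfl, Matrix.mul_assoc]
  have h1 : thetaMat W T (Fintype.card W.ι) * ((1 : Matrix W.ι W.ι ℂ) ⊗ₖ f) =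
      ((1 : Matrix W.ι W.ι ℂ) ⊗ₖ f) * thetaMat W V (Fintype.card W.ι) := by
    rw [thetaMat, thetaMat, Matrix.sum_mul, Matrix.mul_sum]
    refine Finset.sum_congr rfl fun i _ => ?_
    rw [Matrix.smul_mul, Matrix.mul_smul, ← Matrix.mul_kronecker_mul, ← Matrix.mul_kronecker_mul,
      Mult.E_pow_comm hf, mul_one, one_mul]
  have h2 : cartanMat s W T * ((1 : Matrix W.ι W.ι ℂ) ⊗ₖ f) =
      ((1 : Matrix W.ι W.ι ℂ) ⊗ₖ f) * cartanMat s W V := by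
    ext ⟨j, i⟩ ⟨j', i'⟩
    simp only [cartanMat, Matrix.mul_diagonal, Matrix.diagonal_mul, Matrix.kroneckerMap_apply,
      Matrix.one_apply]
    by_cases h : f i i' = 0
    · simp [h]
    · by_cases hj : j = j'
      · rw [Mult.wt_eq hq hf h, hj, mul_comm]
      · simp [hj]
  rw [h1, ← Matrix.mul_assoc, h2, Matrix.mul_assoc]

theorem R21Mat_mul_kronecker_one (hq : ∀ k : ℕ, 0 < k → q ^ k ≠ 1) (s : Circle) {V T : QMod q}
    (W : QMod q) {f : Matrix T.ι V.ι ℂ} (hf : f ∈ Mult V T) :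
    R21Mat s T W * (f ⊗ₖ (1 : Matrix W.ι W.ι ℂ)) =
      (f ⊗ₖ (1 : Matrix W.ι W.ι ℂ)) * R21Mat s V W := by
  have h := congrArg (fun M => M.submatrix Prod.swap Prod.swap) (RMat_mul_one_kronecker hq s W hf)
  have h1 : ((1 : Matrix W.ι W.ι ℂ) ⊗ₖ f).submatrix Prod.swap Prod.swap =
      f ⊗ₖ (1 : Matrix W.ι W.ι ℂ) := by
    ext ⟨i, j⟩ ⟨i', j'⟩
    simp [mul_comm]
  simp only at h
  rw [Matrix.submatrix_mul _ _ _ _ _ Prod.swap_bijective,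
    Matrix.submatrix_mul _ _ _ _ _ Prod.swap_bijective, h1] at h
  exact h

/-- The operator by which `R²¹ R` acts on `V ⊗ W`. -/
noncomputable def monodromy (s : Circle) (V W : QMod q) : Matrix (V.ι × W.ι) (V.ι × W.ι) ℂ :=
  R21Mat s V W * RMat s V W

theorem monodromy_mul_kronecker_one (hq : ∀ k : ℕ, 0 < k → q ^ k ≠ 1) (s : Circle) {V T : QMod q}
    (W : QMod q) {f : Matrix T.ι V.ι ℂ} (hf : f ∈ Mult V T) :
    monodromy s T W * (f ⊗ₖ (1 : Matrix W.ι W.ι ℂ)) =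
      (f ⊗ₖ (1 : Matrix W.ι W.ι ℂ)) * monodromy s V W := by
  rw [monodromy, monodromy, Matrix.mul_assoc, RMat_mul_kronecker_one hq s W hf, ← Matrix.mul_assoc,
    R21Mat_mul_kronecker_one hq s W hf, Matrix.mul_assoc]

theorem tensor_K (s : Circle) (V W : QMod q) : (tensor s V W).K = V.K ⊗ₖ W.K :=
  kMat_kronecker q V.wt W.wt

/-- R carries Δ to Δ^op and R²¹ carries Δ^op back to Δ. -/
theorem monodromy_mem_Mult (hq : ∀ k : ℕ, 0 < k → q ^ k ≠ 1) {s : Circle} (hs : s ^ 2 = q)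
    (V W : QMod q) : monodromy s V W ∈ Mult (tensor s V W) (tensor s V W) := by
  have hE : monodromy s V W * (V.E ⊗ₖ (1 : Matrix W.ι W.ι ℂ) + V.K ⊗ₖ W.E) =
      (V.E ⊗ₖ (1 : Matrix W.ι W.ι ℂ) + V.K ⊗ₖ W.E) * monodromy s V W := by
    rw [monodromy, mul_assoc, RMat_mul_E hq hs, ← mul_assoc, R21Mat_mul_E hq hs, mul_assoc]
  have hF : monodromy s V W * ((1 : Matrix V.ι V.ι ℂ) ⊗ₖ W.F + V.F ⊗ₖ W.Kinv) =
      ((1 : Matrix V.ι V.ι ℂ) ⊗ₖ W.F + V.F ⊗ₖ W.Kinv) * monodromy s V W := by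
    rw [monodromy, mul_assoc, RMat_mul_F hq hs, ← mul_assoc, R21Mat_mul_F hq hs, mul_assoc]
  have hK : monodromy s V W * kMat q (fun p : V.ι × W.ι => V.wt p.1 + W.wt p.2) =
      kMat q (fun p : V.ι × W.ι => V.wt p.1 + W.wt p.2) * monodromy s V W := by
    have := R21Mat_mul_K s V W
    rw [QMod.K, QMod.K, ← kMat_kronecker] at this
    have h' := RMat_mul_K s V W
    rw [QMod.K, QMod.K, ← kMat_kronecker] at h'
    rw [monodromy, mul_assoc, h', ← mul_assoc, this, mul_assoc]
  exact ⟨hE, hF, hK⟩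

theorem kronecker_one_mem_Mult (s : Circle) {V T : QMod q}
    (W : QMod q) {f : Matrix T.ι V.ι ℂ} (hf : f ∈ Mult V T) :
    f ⊗ₖ (1 : Matrix W.ι W.ι ℂ) ∈ Mult (tensor s V W) (tensor s T W) := by
  have hE : f ⊗ₖ (1 : Matrix W.ι W.ι ℂ) * (V.E ⊗ₖ (1 : Matrix W.ι W.ι ℂ) + V.K ⊗ₖ W.E) =
      (T.E ⊗ₖ (1 : Matrix W.ι W.ι ℂ) + T.K ⊗ₖ W.E) * f ⊗ₖ (1 : Matrix W.ι W.ι ℂ) := by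
    simp only [Matrix.mul_add, Matrix.add_mul, ← Matrix.mul_kronecker_mul, Mult.E_comm hf,
      Mult.K_comm hf, mul_one, one_mul]
  have hF : f ⊗ₖ (1 : Matrix W.ι W.ι ℂ) *
        ((1 : Matrix V.ι V.ι ℂ) ⊗ₖ W.F + V.F ⊗ₖ W.Kinv) =
      ((1 : Matrix T.ι T.ι ℂ) ⊗ₖ W.F + T.F ⊗ₖ W.Kinv) * f ⊗ₖ (1 : Matrix W.ι W.ι ℂ) := by
    simp only [Matrix.mul_add, Matrix.add_mul, ← Matrix.mul_kronecker_mul, Mult.F_comm hf,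
      Matrix.mul_one, Matrix.one_mul]
  have hK : f ⊗ₖ (1 : Matrix W.ι W.ι ℂ) * kMat q (fun p : V.ι × W.ι => V.wt p.1 + W.wt p.2) =
      kMat q (fun p : T.ι × W.ι => T.wt p.1 + W.wt p.2) * f ⊗ₖ (1 : Matrix W.ι W.ι ℂ) := by
    have hK' := Mult.K_comm hf
    rw [QMod.K, QMod.K] at hK'
    rw [kMat_kronecker, kMat_kronecker, ← Matrix.mul_kronecker_mul, ← Matrix.mul_kronecker_mul,
      hK', Matrix.mul_one, Matrix.one_mul]
  exact ⟨hE, hF, hK⟩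

/-! ### Contravariant forms -/

/-- The form of `V` is contravariant. -/
structure QMod.IsContravariant (V : QMod q) : Prop where
  E : V.Eᵀ * V.gram = V.gram * V.F.map star
  F : V.Fᵀ * V.gram = V.gram * V.E.map star
  K : V.K * V.gram = V.gram * V.K

theorem map_star_mul {ι κ l : Type} [Fintype κ] (A : Matrix ι κ ℂ) (B : Matrix κ l ℂ) :
    (A * B).map star = A.map star * B.map star :=
  Matrix.map_mul (f := starRingEnd ℂ)

theorem map_star_kronecker {ι κ l m : Type} (A : Matrix ι κ ℂ) (B : Matrix l m ℂ) :
    (A ⊗ₖ B).map star = A.map star ⊗ₖ B.map star := by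
  ext; simp

theorem map_star_add {ι κ : Type} (A B : Matrix ι κ ℂ) :
    (A + B).map star = A.map star + B.map star := by
  ext; simp

theorem map_star_one {ι : Type} [DecidableEq ι] :
    (1 : Matrix ι ι ℂ).map star = 1 := by
  ext i j
  by_cases h : i = j <;> simp [h, Matrix.one_apply]

theorem map_star_mulVec {ι κ : Type} [Fintype κ] (A : Matrix ι κ ℂ) (x : κ → ℂ) :
    A.map star *ᵥ star x = star (A *ᵥ x) := by
  ext i
  simp [Matrix.mulVec, dotProduct]

theorem star_coe_zpow (q : Circle) (k : ℤ) : star ((q : ℂ) ^ k) = (q : ℂ) ^ (-k) := by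
  have h : conj (q : ℂ) = (q : ℂ)⁻¹ := by
    rw [← Circle.coe_inv_eq_conj, Circle.coe_inv]
  rw [RCLike.star_def, map_zpow₀, h, inv_zpow']

theorem QMod.K_map_star (V : QMod q) : V.K.map star = V.Kinv := by
  rw [QMod.K, QMod.Kinv, kMat, kMat, Matrix.diagonal_map (star_zero _)]
  simp only [star_coe_zpow, Pi.neg_apply]

theorem QMod.Kinv_map_star (V : QMod q) : V.Kinv.map star = V.K := by
  rw [QMod.K, QMod.Kinv, kMat, kMat, Matrix.diagonal_map (star_zero _)]
  simp only [star_coe_zpow, Pi.neg_apply, neg_neg]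

theorem QMod.K_transpose (V : QMod q) : V.Kᵀ = V.K := Matrix.diagonal_transpose _

theorem QMod.Kinv_transpose (V : QMod q) : V.Kinvᵀ = V.Kinv := Matrix.diagonal_transpose _

theorem QMod.form_mulVec_left (V : QMod q) {A B : Matrix V.ι V.ι ℂ}
    (h : Aᵀ * V.gram = V.gram * B.map star) (x y : V.ι → ℂ) :
    V.form (A *ᵥ x) y = V.form x (B *ᵥ y) := by
  rw [QMod.form, QMod.form, ← map_star_mulVec, Matrix.mulVec_mulVec, ← h, ← Matrix.mulVec_mulVec,
    Matrix.dotProduct_transpose_mulVec, dotProduct_comm]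

theorem QMod.IsContravariant.Kinv {V : QMod q} (h : V.IsContravariant) :
    V.Kinv * V.gram = V.gram * V.Kinv := by
  calc V.Kinv * V.gram = V.Kinv * (V.gram * V.K) * V.Kinv := by
        rw [mul_assoc, mul_assoc, V.K_mul_Kinv, mul_one]
    _ = V.gram * V.Kinv := by rw [← h.K, ← mul_assoc, V.Kinv_mul_K, one_mul]

theorem aeval_mul_comm {ι : Type} [Fintype ι] [DecidableEq ι] {M A : Matrix ι ι ℂ}
    (h : M * A = A * M) (p : Polynomial ℂ) :
    Polynomial.aeval M p * A = A * Polynomial.aeval M p := by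
  induction p using Polynomial.induction_on' with
  | add p r hp hr => rw [map_add, add_mul, mul_add, hp, hr]
  | monomial n c =>
    have hn : M ^ n * A = A * M ^ n := (Commute.pow_left (show Commute M A from h) n)
    rw [Polynomial.aeval_monomial, Algebra.algebraMap_eq_smul_one, Matrix.smul_mul, one_mul,
      Matrix.smul_mul, Matrix.mul_smul, hn]

theorem RBar_eq (s : Circle) (V W : QMod q) :
    RBar s V W = RMat s V W * invSqrt q s (monodromy s V W) := rfl

theorem RBar_mul_E (hq : ∀ k : ℕ, 0 < k → q ^ k ≠ 1) {s : Circle} (hs : s ^ 2 = q) (V W : QMod q) :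
    RBar s V W * (V.E ⊗ₖ (1 : Matrix W.ι W.ι ℂ) + V.K ⊗ₖ W.E) =
      ((1 : Matrix V.ι V.ι ℂ) ⊗ₖ W.E + V.E ⊗ₖ W.K) * RBar s V W := by
  have h : monodromy s V W * (V.E ⊗ₖ (1 : Matrix W.ι W.ι ℂ) + V.K ⊗ₖ W.E) =
      (V.E ⊗ₖ (1 : Matrix W.ι W.ι ℂ) + V.K ⊗ₖ W.E) * monodromy s V W :=
    Mult.E_comm (monodromy_mem_Mult hq hs V W)
  rw [RBar_eq, mul_assoc, invSqrt, aeval_mul_comm h, ← mul_assoc, RMat_mul_E hq hs, mul_assoc]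

theorem RBar_mul_F (hq : ∀ k : ℕ, 0 < k → q ^ k ≠ 1) {s : Circle} (hs : s ^ 2 = q) (V W : QMod q) :
    RBar s V W * ((1 : Matrix V.ι V.ι ℂ) ⊗ₖ W.F + V.F ⊗ₖ W.Kinv) =
      (V.F ⊗ₖ (1 : Matrix W.ι W.ι ℂ) + V.Kinv ⊗ₖ W.F) * RBar s V W := by
  have h : monodromy s V W * ((1 : Matrix V.ι V.ι ℂ) ⊗ₖ W.F + V.F ⊗ₖ W.Kinv) =
      ((1 : Matrix V.ι V.ι ℂ) ⊗ₖ W.F + V.F ⊗ₖ W.Kinv) * monodromy s V W :=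
    Mult.F_comm (monodromy_mem_Mult hq hs V W)
  rw [RBar_eq, mul_assoc, invSqrt, aeval_mul_comm h, ← mul_assoc, RMat_mul_F hq hs, mul_assoc]

theorem RBar_mul_K (s : Circle) (V W : QMod q) :
    RBar s V W * (V.K ⊗ₖ W.K) = (V.K ⊗ₖ W.K) * RBar s V W := by
  have h : monodromy s V W * (V.K ⊗ₖ W.K) = (V.K ⊗ₖ W.K) * monodromy s V W := by
    rw [monodromy, mul_assoc, RMat_mul_K, ← mul_assoc, R21Mat_mul_K, mul_assoc]
  rw [RBar_eq, mul_assoc, invSqrt, aeval_mul_comm h, ← mul_assoc, RMat_mul_K, mul_assoc]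

theorem kronecker_transpose {ι κ l m : Type} (A : Matrix ι κ ℂ) (B : Matrix l m ℂ) :
    (A ⊗ₖ B)ᵀ = Aᵀ ⊗ₖ Bᵀ := rfl

/-- For the product form the adjoint of Δ^op(E) is Δ(F), since K is adjoint to K⁻¹, and likewise
with E and F exchanged. The unitarized R-matrix in the first argument turns Δ into Δ^op: R does so,
and its other factor is a polynomial in the monodromy, which commutes with Δ. -/
theorem tensor_isContravariant (hq : ∀ k : ℕ, 0 < k → q ^ k ≠ 1) {s : Circle} (hs : s ^ 2 = q)
    {V W : QMod q} (hV : V.IsContravariant) (hW : W.IsContravariant) :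
    (tensor s V W).IsContravariant := by
  have hE : (V.E ⊗ₖ (1 : Matrix W.ι W.ι ℂ) + V.K ⊗ₖ W.E)ᵀ *
      ((RBar s V W)ᵀ * (V.gram ⊗ₖ W.gram)) = (RBar s V W)ᵀ * (V.gram ⊗ₖ W.gram) *
      ((1 : Matrix V.ι V.ι ℂ) ⊗ₖ W.F + V.F ⊗ₖ W.Kinv).map star := by
    rw [← mul_assoc, ← Matrix.transpose_mul, RBar_mul_E hq hs, Matrix.transpose_mul, mul_assoc,
      mul_assoc]
    congr 1
    rw [map_star_add, map_star_kronecker, map_star_kronecker, map_star_one, Matrix.transpose_add,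
      kronecker_transpose, kronecker_transpose, add_mul, mul_add,
      ← Matrix.mul_kronecker_mul, ← Matrix.mul_kronecker_mul, ← Matrix.mul_kronecker_mul,
      ← Matrix.mul_kronecker_mul, hV.E, hW.E, W.Kinv_map_star, W.K_transpose, hW.K,
      Matrix.transpose_one, one_mul, mul_one]
  have hF : ((1 : Matrix V.ι V.ι ℂ) ⊗ₖ W.F + V.F ⊗ₖ W.Kinv)ᵀ *
      ((RBar s V W)ᵀ * (V.gram ⊗ₖ W.gram)) = (RBar s V W)ᵀ * (V.gram ⊗ₖ W.gram) *
      (V.E ⊗ₖ (1 : Matrix W.ι W.ι ℂ) + V.K ⊗ₖ W.E).map star := by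
    rw [← mul_assoc, ← Matrix.transpose_mul, RBar_mul_F hq hs, Matrix.transpose_mul, mul_assoc,
      mul_assoc]
    congr 1
    rw [map_star_add, map_star_kronecker, map_star_kronecker, map_star_one, Matrix.transpose_add,
      kronecker_transpose, kronecker_transpose, add_mul, mul_add,
      ← Matrix.mul_kronecker_mul, ← Matrix.mul_kronecker_mul, ← Matrix.mul_kronecker_mul,
      ← Matrix.mul_kronecker_mul, hV.F, hW.F, V.K_map_star, V.Kinv_transpose, hV.Kinv,
      Matrix.transpose_one, one_mul, mul_one]
  have hK : kMat q (fun p : V.ι × W.ι => V.wt p.1 + W.wt p.2) *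
      ((RBar s V W)ᵀ * (V.gram ⊗ₖ W.gram)) = (RBar s V W)ᵀ * (V.gram ⊗ₖ W.gram) *
      kMat q (fun p : V.ι × W.ι => V.wt p.1 + W.wt p.2) := by
    have hVW : kMat q (fun p : V.ι × W.ι => V.wt p.1 + W.wt p.2) = V.K ⊗ₖ W.K :=
      kMat_kronecker q V.wt W.wt
    have hT : (V.K ⊗ₖ W.K)ᵀ = V.K ⊗ₖ W.K := by
      rw [kronecker_transpose, V.K_transpose, W.K_transpose]
    rw [hVW]
    nth_rewrite 1 [← hT]
    rw [← mul_assoc, ← Matrix.transpose_mul, RBar_mul_K, Matrix.transpose_mul, hT, mul_assoc,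
      mul_assoc, ← Matrix.mul_kronecker_mul, ← Matrix.mul_kronecker_mul, hV.K, hW.K]
  exact ⟨hE, hF, hK⟩

/-! ### The basis of the simple modules -/

/-- The basis vector `v_k` of `V_c`, zero if `k > c`. -/
noncomputable def simpleVec (q : Circle) (c k : ℕ) : (simple q c).ι → ℂ :=
  fun i : Fin (c + 1) => if (i : ℕ) = k then 1 else 0

theorem highest_eq (q : Circle) (c : ℕ) : highest q c = simpleVec q c 0 := by
  funext (i : Fin (c + 1))
  simp only [highest, simpleVec, Pi.single_apply, Fin.ext_iff]
  rfl

theorem simpleVec_eq_zero (q : Circle) {c k : ℕ} (h : c < k) : simpleVec q c k = 0 := by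
  funext (i : Fin (c + 1))
  exact if_neg (by omega)

theorem simpleVec_eq_single (q : Circle) (c : ℕ) (k : Fin (c + 1)) :
    simpleVec q c k = Pi.single (M := fun _ : Fin (c + 1) => ℂ) k 1 := by
  funext (i : Fin (c + 1))
  simp only [simpleVec, Pi.single_apply, Fin.ext_iff]

theorem simple_E_mulVec_zero (q : Circle) (c : ℕ) :
    (simple q c).E *ᵥ simpleVec q c 0 = 0 := by
  funext (i : Fin (c + 1))
  change ∑ j : Fin (c + 1), (if (j : ℕ) = i + 1 then qInt q ((c : ℤ) - (j : ℕ) + 1) else 0) *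
    (if (j : ℕ) = 0 then 1 else 0) = (0 : ℂ)
  refine Finset.sum_eq_zero fun j _ => ?_
  by_cases h : (j : ℕ) = 0
  · rw [if_neg (by omega), zero_mul]
  · rw [if_neg h, mul_zero]

theorem simple_E_mulVec_succ (q : Circle) (c k : ℕ) :
    (simple q c).E *ᵥ simpleVec q c (k + 1) = qInt q ((c : ℤ) - k) • simpleVec q c k := by
  funext (i : Fin (c + 1))
  change ∑ j : Fin (c + 1), (if (j : ℕ) = i + 1 then qInt q ((c : ℤ) - (j : ℕ) + 1) else 0) *
    (if (j : ℕ) = k + 1 then 1 else 0) = qInt q ((c : ℤ) - k) * (if (i : ℕ) = k then 1 else 0)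
  by_cases hi : (i : ℕ) = k
  · by_cases hk : k + 1 ≤ c
    · rw [Finset.sum_eq_single (⟨k + 1, by omega⟩ : Fin (c + 1))]
      · simp only [hi, if_true, mul_one]
        congr 1; push_cast; ring
      · intro j _ hj
        have : (j : ℕ) ≠ k + 1 := fun h => hj (Fin.ext h)
        simp [this]
      · simp
    · have hkc : k = c := by omega
      rw [Finset.sum_eq_zero]
      · simp [hkc]
      · intro j _
        have : (j : ℕ) ≠ k + 1 := by omega
        simp [this]
  · rw [Finset.sum_eq_zero]
    · simp [hi]
    · intro j _
      by_cases hj : (j : ℕ) = k + 1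
      · have : (j : ℕ) ≠ i + 1 := by omega
        simp [this]
      · simp [hj]

theorem simple_F_mulVec (q : Circle) (c k : ℕ) :
    (simple q c).F *ᵥ simpleVec q c k = qInt q ((k : ℤ) + 1) • simpleVec q c (k + 1) := by
  funext (i : Fin (c + 1))
  change ∑ j : Fin (c + 1), (if (i : ℕ) = j + 1 then qInt q ((j : ℕ) + 1) else 0) *
    (if (j : ℕ) = k then 1 else 0) = qInt q ((k : ℤ) + 1) * (if (i : ℕ) = k + 1 then 1 else 0)
  by_cases hi : (i : ℕ) = k + 1
  · rw [Finset.sum_eq_single (⟨k, by omega⟩ : Fin (c + 1))]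
    · simp [hi]
    · intro j _ hj
      have : (j : ℕ) ≠ k := fun h => hj (Fin.ext h)
      simp [this]
    · simp
  · rw [Finset.sum_eq_zero]
    · simp [hi]
    · intro j _
      by_cases hj : (j : ℕ) = k
      · have : (i : ℕ) ≠ j + 1 := by omega
        simp [this]
      · simp [hj]

theorem simple_K_mulVec (q : Circle) (c k : ℕ) :
    (simple q c).K *ᵥ simpleVec q c k = (q : ℂ) ^ ((c : ℤ) - 2 * k) • simpleVec q c k := by
  funext (i : Fin (c + 1))
  refine (Matrix.mulVec_diagonal _ _ _).trans ?_
  change (q : ℂ) ^ ((c : ℤ) - 2 * (i : ℕ)) * (if (i : ℕ) = k then 1 else 0) =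
    (q : ℂ) ^ ((c : ℤ) - 2 * k) * (if (i : ℕ) = k then 1 else 0)
  by_cases hi : (i : ℕ) = k
  · rw [hi]
  · simp [hi]

theorem simple_mulVec_ext {κ : Type} {c : ℕ} {A B : Matrix κ (simple q c).ι ℂ}
    (h : ∀ k, k ≤ c → A *ᵥ simpleVec q c k = B *ᵥ simpleVec q c k) : A = B := by
  refine Matrix.ext_of_mulVec_single fun k : Fin (c + 1) => ?_
  have := h k (by omega)
  rw [simpleVec_eq_single] at this
  exact this

theorem Mult.mulVec_simpleVec_succ (hq : ∀ k : ℕ, 0 < k → q ^ k ≠ 1) {c : ℕ} {T : QMod q}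
    {f : Matrix T.ι (simple q c).ι ℂ} (hf : f ∈ Mult (simple q c) T) (k : ℕ) :
    f *ᵥ simpleVec q c (k + 1) = (qInt q ((k : ℤ) + 1))⁻¹ • (T.F *ᵥ (f *ᵥ simpleVec q c k)) := by
  rw [Matrix.mulVec_mulVec, ← Mult.F_comm hf, ← Matrix.mulVec_mulVec, simple_F_mulVec,
    Matrix.mulVec_smul, smul_smul, inv_mul_cancel₀ (qInt_ne_zero hq (by omega)), one_smul]

/-- The vectors v_k are multiples of the images of v_0 under powers of F, so a morphism from V_c is
determined by the image of v_0. -/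
theorem Mult.ext_highest (hq : ∀ k : ℕ, 0 < k → q ^ k ≠ 1) {c : ℕ} {T : QMod q}
    {f g : Matrix T.ι (simple q c).ι ℂ} (hf : f ∈ Mult (simple q c) T)
    (hg : g ∈ Mult (simple q c) T) (h : f *ᵥ highest q c = g *ᵥ highest q c) : f = g := by
  refine simple_mulVec_ext fun k _ => ?_
  induction k with
  | zero => simpa only [highest_eq] using h
  | succ k ih =>
    rw [Mult.mulVec_simpleVec_succ hq hf, Mult.mulVec_simpleVec_succ hq hg, ih (by omega)]

theorem Mult.E_mulVec_highest {c : ℕ} {T : QMod q} {f : Matrix T.ι (simple q c).ι ℂ}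
    (hf : f ∈ Mult (simple q c) T) : T.E *ᵥ (f *ᵥ highest q c) = 0 := by
  rw [Matrix.mulVec_mulVec, ← Mult.E_comm hf, ← Matrix.mulVec_mulVec, highest_eq,
    simple_E_mulVec_zero, Matrix.mulVec_zero]

theorem Mult.K_mulVec_highest {c : ℕ} {T : QMod q} {f : Matrix T.ι (simple q c).ι ℂ}
    (hf : f ∈ Mult (simple q c) T) :
    T.K *ᵥ (f *ᵥ highest q c) = (q : ℂ) ^ (c : ℤ) • (f *ᵥ highest q c) := by
  rw [Matrix.mulVec_mulVec, ← Mult.K_comm hf, ← Matrix.mulVec_mulVec, highest_eq,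
    simple_K_mulVec, Matrix.mulVec_smul]
  simp

/-! ### Highest weight vectors -/

theorem qInt_step (q : Circle) (c i : ℤ) :
    qInt q (i + 1) * qInt q (c - i) = qInt q i * qInt q (c - i + 1) + qInt q (c - 2 * i) := by
  have h := qInt_identity q c i
  rw [sub_eq_iff_eq_add] at h
  rw [mul_comm, h, qInt, qInt, qInt]
  ring

theorem QMod.Kinv_mulVec (V : QMod q) {x : V.ι → ℂ} {c : ℤ} (h : V.K *ᵥ x = (q : ℂ) ^ c • x) :
    V.Kinv *ᵥ x = (q : ℂ) ^ (-c) • x := by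
  have h1 := congrArg (fun y => V.Kinv *ᵥ y) h
  simp only [Matrix.mulVec_mulVec, V.Kinv_mul_K, Matrix.one_mulVec, Matrix.mulVec_smul] at h1
  rw [h1, smul_smul, ← zpow_add₀ q.coe_ne_zero]
  simp [← h1]

theorem QMod.E_F_mulVec (V : QMod q) {x : V.ι → ℂ} {c : ℤ} (h : V.K *ᵥ x = (q : ℂ) ^ c • x) :
    V.E *ᵥ (V.F *ᵥ x) = V.F *ᵥ (V.E *ᵥ x) + qInt q c • x := by
  have h1 := congrArg (fun M => M *ᵥ x) V.relEF
  simp only [Matrix.sub_mulVec, Matrix.smul_mulVec] at h1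
  have h2 : kMat q V.wt *ᵥ x = (q : ℂ) ^ c • x := h
  have h3 : kMat q (-V.wt) *ᵥ x = (q : ℂ) ^ (-c) • x := V.Kinv_mulVec h
  rw [h2, h3, ← sub_smul, smul_smul, mul_comm, ← div_eq_mul_inv, sub_eq_iff_eq_add'] at h1
  rw [Matrix.mulVec_mulVec, Matrix.mulVec_mulVec, h1, qInt]

theorem QMod.K_F_pow_mulVec (V : QMod q) {x : V.ι → ℂ} {c : ℤ} (h : V.K *ᵥ x = (q : ℂ) ^ c • x)
    (n : ℕ) : V.K *ᵥ (V.F ^ n *ᵥ x) = (q : ℂ) ^ (c - 2 * n) • (V.F ^ n *ᵥ x) := by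
  induction n with
  | zero => simpa using h
  | succ n ih =>
    rw [pow_succ', ← Matrix.mulVec_mulVec, Matrix.mulVec_mulVec _ V.K, V.K_mul_F,
      Matrix.smul_mulVec, ← Matrix.mulVec_mulVec, ih, Matrix.mulVec_smul, smul_smul,
      ← zpow_add₀ q.coe_ne_zero]
    congr 2; push_cast; ring

theorem QMod.E_F_pow_mulVec (hq : ∀ k : ℕ, 0 < k → q ^ k ≠ 1) (V : QMod q) {x : V.ι → ℂ} {c : ℤ}
    (hE : V.E *ᵥ x = 0) (hK : V.K *ᵥ x = (q : ℂ) ^ c • x) (n : ℕ) :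
    V.E *ᵥ (V.F ^ (n + 1) *ᵥ x) = (qInt q ((n : ℤ) + 1) * qInt q (c - n)) • (V.F ^ n *ᵥ x) := by
  induction n with
  | zero =>
    simp only [zero_add, pow_one, pow_zero, Matrix.one_mulVec]
    rw [V.E_F_mulVec hK, hE]
    simp [qInt_one hq]
  | succ n ih =>
    rw [pow_succ', ← Matrix.mulVec_mulVec, V.E_F_mulVec (V.K_F_pow_mulVec hK (n + 1)), ih,
      Matrix.mulVec_smul, Matrix.mulVec_mulVec, ← pow_succ', ← add_smul]
    congr 1
    have h := qInt_step q c ((n : ℤ) + 1)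
    push_cast
    rw [h, show c - ((n : ℤ) + 1) + 1 = c - n by ring]

/-- Otherwise this vector is a highest weight vector of weight -c-2. The scalars [n+1][-c-2-n]
arising from E on its descendants never vanish, so no power of F kills it, against nilpotency. -/
theorem QMod.F_pow_mulVec_eq_zero (hq : ∀ k : ℕ, 0 < k → q ^ k ≠ 1) (V : QMod q) {x : V.ι → ℂ}
    {c : ℕ} (hE : V.E *ᵥ x = 0) (hK : V.K *ᵥ x = (q : ℂ) ^ (c : ℤ) • x) :
    V.F ^ (c + 1) *ᵥ x = 0 := by
  by_contra hne
  have hE' : V.E *ᵥ (V.F ^ (c + 1) *ᵥ x) = 0 := by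
    rw [V.E_F_pow_mulVec hq hE hK]; simp
  have hK' := V.K_F_pow_mulVec hK (c + 1)
  have h : ∀ n : ℕ, V.F ^ n *ᵥ (V.F ^ (c + 1) *ᵥ x) ≠ 0 := by
    intro n
    induction n with
    | zero => simpa using hne
    | succ n ih =>
      intro h0
      have h1 := V.E_F_pow_mulVec hq hE' hK' n
      rw [h0, Matrix.mulVec_zero, eq_comm, smul_eq_zero, or_iff_left ih] at h1
      rcases mul_eq_zero.1 h1 with h2 | h2
      · exact qInt_ne_zero hq (by omega) h2
      · exact qInt_ne_zero hq (by push_cast; omega) h2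
  refine h (Fintype.card V.ι) ?_
  rw [V.F_pow_card hq, Matrix.zero_mulVec]

/-- A highest weight vector of weight `c ≥ 0` is the image of `v_0` under a morphism from `V_c`. -/
theorem exists_mem_Mult (hq : ∀ k : ℕ, 0 < k → q ^ k ≠ 1) (V : QMod q) {x : V.ι → ℂ} {c : ℕ}
    (hE : V.E *ᵥ x = 0) (hK : V.K *ᵥ x = (q : ℂ) ^ (c : ℤ) • x) :
    ∃ f ∈ Mult (simple q c) V, f *ᵥ highest q c = x := by
  -- The choice v_k ↦ F^k x / [k]! is forced by v_k = F^k v_0 / [k]!.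
  let f : Matrix V.ι (Fin (c + 1)) ℂ := Matrix.of fun p k => (qFact q k)⁻¹ * (V.F ^ (k : ℕ) *ᵥ x) p
  let f' : Matrix V.ι (simple q c).ι ℂ := f
  have hf : ∀ k, f' *ᵥ simpleVec q c k = (qFact q k)⁻¹ • (V.F ^ k *ᵥ x) := by
    intro k
    by_cases hk : k ≤ c
    · have h1 := simpleVec_eq_single q c ⟨k, by omega⟩
      simp only at h1
      rw [h1]
      change f *ᵥ Pi.single (⟨k, by omega⟩ : Fin (c + 1)) 1 = _
      rw [Matrix.mulVec_single_one]
      rfl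
    -- Beyond k = c both sides are zero, so the formula holds for all k and the relation F v_c = 0
    -- needs no separate treatment.
    · rw [simpleVec_eq_zero q (by omega), Matrix.mulVec_zero, ← Nat.sub_add_cancel
        (show c + 1 ≤ k by omega), pow_add, ← Matrix.mulVec_mulVec, V.F_pow_mulVec_eq_zero hq hE hK,
        Matrix.mulVec_zero, smul_zero]
  refine ⟨f', ⟨?_, ?_, ?_⟩, ?_⟩
  · refine simple_mulVec_ext fun k _ => ?_
    rw [← Matrix.mulVec_mulVec, ← Matrix.mulVec_mulVec, hf]
    cases k with
    | zero => simp [simple_E_mulVec_zero, hE]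
    | succ k =>
      rw [simple_E_mulVec_succ, Matrix.mulVec_smul, hf, Matrix.mulVec_smul,
        V.E_F_pow_mulVec hq hE hK, smul_smul, smul_smul, qFact_succ]
      congr 1
      have := qInt_ne_zero hq (show (k : ℤ) + 1 ≠ 0 by omega)
      have := qFact_ne_zero hq k
      field_simp
  · refine simple_mulVec_ext fun k _ => ?_
    rw [← Matrix.mulVec_mulVec, ← Matrix.mulVec_mulVec, hf, simple_F_mulVec, Matrix.mulVec_smul,
      hf, Matrix.mulVec_smul, Matrix.mulVec_mulVec, ← pow_succ', smul_smul, qFact_succ]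
    congr 1
    have := qInt_ne_zero hq (show (k : ℤ) + 1 ≠ 0 by omega)
    have := qFact_ne_zero hq k
    field_simp
  · refine simple_mulVec_ext fun k _ => ?_
    rw [← Matrix.mulVec_mulVec, ← Matrix.mulVec_mulVec, hf, simple_K_mulVec, Matrix.mulVec_smul,
      hf, Matrix.mulVec_smul, V.K_F_pow_mulVec hK, smul_comm]
  · rw [highest_eq, hf]
    simp

/-! ### Forms and morphisms -/

theorem QMod.form_smul_left (V : QMod q) (c : ℂ) (x y : V.ι → ℂ) :
    V.form (c • x) y = c * V.form x y := smul_dotProduct _ _ _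

theorem QMod.form_add_right (V : QMod q) (x y y' : V.ι → ℂ) :
    V.form x (y + y') = V.form x y + V.form x y' := by
  rw [QMod.form, star_add, Matrix.mulVec_add, dotProduct_add]; rfl

theorem QMod.form_smul_right (V : QMod q) (c : ℂ) (x y : V.ι → ℂ) :
    V.form x (c • y) = star c * V.form x y := by
  rw [QMod.form, star_smul, Matrix.mulVec_smul, dotProduct_smul]; rfl

theorem QMod.form_zero_left (V : QMod q) (y : V.ι → ℂ) : V.form 0 y = 0 := zero_dotProduct _

theorem QMod.form_zero_right (V : QMod q) (x : V.ι → ℂ) : V.form x 0 = 0 := by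
  rw [QMod.form, star_zero, Matrix.mulVec_zero, dotProduct_zero]

theorem QMod.form_sum_left {α : Type*} (V : QMod q) (t : Finset α) (x : α → V.ι → ℂ)
    (y : V.ι → ℂ) : V.form (∑ i ∈ t, x i) y = ∑ i ∈ t, V.form (x i) y :=
  sum_dotProduct _ _ _

theorem QMod.form_sum_right {α : Type*} (V : QMod q) (t : Finset α) (x : V.ι → ℂ)
    (y : α → V.ι → ℂ) : V.form x (∑ i ∈ t, y i) = ∑ i ∈ t, V.form x (y i) := by
  classical
  induction t using Finset.induction_on with
  | empty => simp [V.form_zero_right]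
  | insert i t hi ih => rw [Finset.sum_insert hi, Finset.sum_insert hi, V.form_add_right, ih]

theorem dotProduct_pairing {ι κ l : Type} [Fintype ι] [Fintype κ] [Fintype l]
    (f : Matrix ι κ ℂ) (g : Matrix ι l ℂ) (G : Matrix ι ι ℂ) (x : κ → ℂ) (y : l → ℂ) :
    (f *ᵥ x) ⬝ᵥ (G *ᵥ star (g *ᵥ y)) = x ⬝ᵥ ((fᵀ * G * g.map star) *ᵥ star y) := by
  rw [← map_star_mulVec, ← Matrix.mulVec_mulVec, ← Matrix.mulVec_mulVec,
    Matrix.dotProduct_transpose_mulVec, dotProduct_comm]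

theorem QMod.form_mulVec_mulVec (V : QMod q) {κ l : Type} [Fintype κ] [Fintype l]
    (f : Matrix V.ι κ ℂ) (g : Matrix V.ι l ℂ) (x : κ → ℂ) (y : l → ℂ) :
    V.form (f *ᵥ x) (g *ᵥ y) = x ⬝ᵥ ((fᵀ * V.gram * g.map star) *ᵥ star y) :=
  dotProduct_pairing f g V.gram x y

theorem qBinom_succ (hq : ∀ k : ℕ, 0 < k → q ^ k ≠ 1) (x : ℤ) (k : ℕ) :
    qInt q ((k : ℤ) + 1) * qBinom q x (k + 1) = qInt q (x - k) * qBinom q x k := by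
  have := qInt_ne_zero hq (show (k : ℤ) + 1 ≠ 0 by omega)
  have := qFact_ne_zero hq k
  rw [qBinom, qBinom, Finset.prod_range_succ, qFact_succ]
  field_simp

theorem simple_isContravariant (hq : ∀ k : ℕ, 0 < k → q ^ k ≠ 1) (a : ℕ) :
    (simple q a).IsContravariant := by
  have hconj : ∀ k : ℤ, star (qInt q k) = qInt q k := conj_qInt q
  let E : Matrix (Fin (a + 1)) (Fin (a + 1)) ℂ :=
    Matrix.of fun i j => if (j : ℕ) = i + 1 then qInt q ((a : ℤ) - (j : ℕ) + 1) else 0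
  let F : Matrix (Fin (a + 1)) (Fin (a + 1)) ℂ :=
    Matrix.of fun i j => if (i : ℕ) = j + 1 then qInt q ((j : ℕ) + 1) else 0
  let G : Matrix (Fin (a + 1)) (Fin (a + 1)) ℂ := Matrix.diagonal fun i => qBinom q a i
  have hE : Eᵀ * G = G * F.map star := by
    ext i j
    simp only [E, F, G, Matrix.mul_diagonal, Matrix.diagonal_mul, Matrix.transpose_apply,
      Matrix.of_apply, Matrix.map_apply]
    split_ifs with h
    · rw [hconj, h]
      have := qBinom_succ hq a j
      push_cast at this ⊢
      rw [mul_comm (qBinom q _ _), this]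
      congr 2
      ring
    · simp
  have hF : Fᵀ * G = G * E.map star := by
    ext i j
    simp only [E, F, G, Matrix.mul_diagonal, Matrix.diagonal_mul, Matrix.transpose_apply,
      Matrix.of_apply, Matrix.map_apply]
    split_ifs with h
    · rw [hconj, h]
      have := qBinom_succ hq a i
      push_cast at this ⊢
      rw [this, mul_comm]
      congr 2
      ring
    · simp
  have hK : kMat q (fun i : Fin (a + 1) => (a : ℤ) - 2 * (i : ℕ)) * G =
      G * kMat q (fun i : Fin (a + 1) => (a : ℤ) - 2 * (i : ℕ)) := by
    simp only [kMat, G, Matrix.diagonal_mul_diagonal, mul_comm]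
  exact ⟨hE, hF, hK⟩

theorem simple_form_eq_zero (hq : ∀ k : ℕ, 0 < k → q ^ k ≠ 1) {c : ℕ} {x : (simple q c).ι → ℂ}
    (h : ∀ y, (simple q c).form x y = 0) : x = 0 := by
  funext (k : Fin (c + 1))
  have h1 := h (Pi.single (M := fun _ : Fin (c + 1) => ℂ) k 1)
  have h2 : ∑ i : Fin (c + 1), x i * ((Matrix.diagonal fun i : Fin (c + 1) => qBinom q c i) *ᵥ
      star (Pi.single k (1 : ℂ))) i = x k * qBinom q c k := by
    simp only [Matrix.mulVec_diagonal]
    rw [Finset.sum_eq_single k]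
    · simp
    · intro i _ hi
      simp [hi]
    · simp
  exact (mul_eq_zero.1 (h2.symm.trans h1)).resolve_right (qBinom_ne_zero hq (by omega))

/-- Contravariance trades an F in the first argument for an E in the second. The scalars that
accumulate are those of the Shapovalov form, whose recursion is `qBinom_succ`. -/
theorem form_simpleVec (hq : ∀ k : ℕ, 0 < k → q ^ k ≠ 1) {T : QMod q} (hT : T.IsContravariant)
    {c c' : ℕ} {f : Matrix T.ι (simple q c).ι ℂ} {g : Matrix T.ι (simple q c').ι ℂ}
    (hf : f ∈ Mult (simple q c) T) (hg : g ∈ Mult (simple q c') T) (k l : ℕ) :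
    T.form (f *ᵥ simpleVec q c k) (g *ᵥ simpleVec q c' l) =
      if k = l then qBinom q c' k * T.form (f *ᵥ highest q c) (g *ᵥ highest q c') else 0 := by
  have hconj : ∀ k : ℤ, star (qInt q k) = qInt q k := conj_qInt q
  induction k generalizing l with
  | zero =>
    cases l with
    | zero => simp [highest_eq]
    | succ l =>
      rw [Mult.mulVec_simpleVec_succ hq hg, T.form_smul_right,
        ← T.form_mulVec_left hT.E, ← highest_eq, Mult.E_mulVec_highest hf, T.form_zero_left]
      simp
  | succ k ih =>
    rw [Mult.mulVec_simpleVec_succ hq hf, T.form_smul_left, T.form_mulVec_left hT.F,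
      Matrix.mulVec_mulVec, ← Mult.E_comm hg, ← Matrix.mulVec_mulVec]
    cases l with
    | zero => simp [simple_E_mulVec_zero, T.form_zero_right]
    | succ l =>
      rw [simple_E_mulVec_succ, Matrix.mulVec_smul, T.form_smul_right, ih, hconj]
      by_cases h : k = l
      · subst h
        simp only [if_true]
        rw [← mul_assoc (qInt q _), ← qBinom_succ hq, mul_assoc,
          inv_mul_cancel_left₀ (qInt_ne_zero hq (by omega))]
      · simp [h]

/-- K is unitary for the form, and its eigenvalues q^c and q^c' on the two vectors are different. -/
theorem form_highest_of_ne (hq : ∀ k : ℕ, 0 < k → q ^ k ≠ 1) {T : QMod q}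
    (hT : T.IsContravariant) {c c' : ℕ} (hc : c ≠ c') {f : Matrix T.ι (simple q c).ι ℂ}
    {g : Matrix T.ι (simple q c').ι ℂ} (hf : f ∈ Mult (simple q c) T)
    (hg : g ∈ Mult (simple q c') T) : T.form (f *ᵥ highest q c) (g *ᵥ highest q c') = 0 := by
  have hK : T.Kᵀ * T.gram = T.gram * T.Kinv.map star := by
    rw [T.K_transpose, T.Kinv_map_star, hT.K]
  have h := T.form_mulVec_left hK (f *ᵥ highest q c) (g *ᵥ highest q c')
  rw [Mult.K_mulVec_highest hf, T.Kinv_mulVec (Mult.K_mulVec_highest hg), T.form_smul_left,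
    T.form_smul_right, star_coe_zpow, neg_neg] at h
  by_contra hne
  rw [mul_left_inj' hne, zpow_inj hq] at h
  exact hc (by exact_mod_cast h)

theorem simple_ext_pairing {c c' : ℕ} {A B : Matrix (simple q c).ι (simple q c').ι ℂ}
    (h : ∀ k l, k ≤ c → l ≤ c' → simpleVec q c k ⬝ᵥ (A *ᵥ star (simpleVec q c' l)) =
      simpleVec q c k ⬝ᵥ (B *ᵥ star (simpleVec q c' l))) : A = B := by
  ext (k : Fin (c + 1)) (l : Fin (c' + 1))
  have h1 := h k l (by omega) (by omega)
  rw [simpleVec_eq_single, simpleVec_eq_single] at h1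
  have key : ∀ M : Matrix (Fin (c + 1)) (Fin (c' + 1)) ℂ,
      (Pi.single k 1 : Fin (c + 1) → ℂ) ⬝ᵥ (M *ᵥ star (Pi.single l 1)) = M k l := by
    intro M
    rw [← Pi.single_star, star_one, Matrix.mulVec_single_one, single_one_dotProduct]
    rfl
  exact (key A).symm.trans (h1.trans (key B))

/-- A contravariant form on a simple module is unique up to a scalar, and the scalar is read off on
the highest weight vector, where the Shapovalov form is 1. -/
theorem pairing_same (hq : ∀ k : ℕ, 0 < k → q ^ k ≠ 1) {T : QMod q} (hT : T.IsContravariant)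
    {c : ℕ} {f g : Matrix T.ι (simple q c).ι ℂ} (hf : f ∈ Mult (simple q c) T)
    (hg : g ∈ Mult (simple q c) T) :
    fᵀ * T.gram * g.map star = T.form (f *ᵥ highest q c) (g *ᵥ highest q c) •
      (simple q c).gram := by
  refine simple_ext_pairing fun k l hk hl => ?_
  rw [← T.form_mulVec_mulVec, form_simpleVec hq hT hf hg, Matrix.smul_mulVec, dotProduct_smul,
    smul_eq_mul]
  have h : simpleVec q c k ⬝ᵥ ((simple q c).gram *ᵥ star (simpleVec q c l)) =
      if k = l then qBinom q c k else 0 := by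
    change ∑ i : Fin (c + 1), (if (i : ℕ) = k then 1 else 0) *
      ((Matrix.diagonal fun i : Fin (c + 1) => qBinom q c i) *ᵥ
      fun i : Fin (c + 1) => star (if (i : ℕ) = l then (1 : ℂ) else 0)) i = _
    simp only [Matrix.mulVec_diagonal]
    rw [Finset.sum_eq_single (⟨k, by omega⟩ : Fin (c + 1))]
    · by_cases hkl : k = l <;> simp [hkl]
    · intro i _ hi
      have : (i : ℕ) ≠ k := fun h => hi (Fin.ext h)
      simp [this]
    · simp
  rw [h]
  by_cases hkl : k = l <;> simp [hkl, mul_comm]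

/-! ### Highest weight vectors in the tensor product of two simple modules -/

theorem kronecker_diagonal_mulVec {ι κ : Type} [Fintype ι] [Fintype κ] [DecidableEq κ]
    (A : Matrix ι ι ℂ) (d : κ → ℂ) (x : ι × κ → ℂ) (i : ι) (j : κ) :
    ((A ⊗ₖ Matrix.diagonal d) *ᵥ x) (i, j) = d j * (A *ᵥ fun i' => x (i', j)) i := by
  simp only [Matrix.mulVec, dotProduct, Fintype.sum_prod_type, Matrix.kroneckerMap_apply,
    Matrix.diagonal_apply, Finset.mul_sum]
  refine Finset.sum_congr rfl fun i' _ => ?_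
  rw [Finset.sum_eq_single j]
  · simp; ring
  · intro j' _ hj
    simp [Ne.symm hj]
  · simp

theorem diagonal_kronecker_mulVec {ι κ : Type} [Fintype ι] [Fintype κ] [DecidableEq ι]
    (d : ι → ℂ) (B : Matrix κ κ ℂ) (x : ι × κ → ℂ) (i : ι) (j : κ) :
    ((Matrix.diagonal d ⊗ₖ B) *ᵥ x) (i, j) = d i * (B *ᵥ fun j' => x (i, j')) j := by
  simp only [Matrix.mulVec, dotProduct, Fintype.sum_prod_type, Matrix.kroneckerMap_apply,
    Matrix.diagonal_apply, Finset.mul_sum]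
  rw [Finset.sum_eq_single i]
  · refine Finset.sum_congr rfl fun j' _ => ?_
    simp; ring
  · intro i' _ hi
    simp [Ne.symm hi]
  · simp

/-- The matrix of `E` on the simple module `V_a`. -/
noncomputable def simpleE (q : Circle) (a : ℕ) : Matrix (Fin (a + 1)) (Fin (a + 1)) ℂ :=
  (simple q a).E

theorem simpleE_mulVec_of_lt (q : Circle) (a : ℕ) (y : Fin (a + 1) → ℂ) (i : Fin (a + 1))
    (h : (i : ℕ) + 1 < a + 1) :
    (simpleE q a *ᵥ y) i = qInt q ((a : ℤ) - (i : ℕ)) * y ⟨i + 1, h⟩ := by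
  change ∑ j : Fin (a + 1), (if (j : ℕ) = i + 1 then qInt q ((a : ℤ) - (j : ℕ) + 1) else 0) * y j = _
  rw [Finset.sum_eq_single (⟨i + 1, h⟩ : Fin (a + 1))]
  · simp only [if_true]
    congr 2; push_cast; ring
  · intro j _ hj
    have : (j : ℕ) ≠ i + 1 := fun h => hj (Fin.ext h)
    simp [this]
  · simp

theorem simpleE_mulVec_eq_zero (q : Circle) (a : ℕ) (y : Fin (a + 1) → ℂ) (i : Fin (a + 1))
    (h : ∀ j : Fin (a + 1), (j : ℕ) = i + 1 → y j = 0) :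
    (simpleE q a *ᵥ y) i = 0 := by
  change ∑ j : Fin (a + 1), (if (j : ℕ) = i + 1 then qInt q ((a : ℤ) - (j : ℕ) + 1) else 0) * y j = _
  refine Finset.sum_eq_zero fun j _ => ?_
  by_cases hj : (j : ℕ) = i + 1
  · rw [h j hj, mul_zero]
  · rw [if_neg hj, zero_mul]

/-- A raising operator `E ⊗ d' + d ⊗ E` on `V_a ⊗ V_b`, with diagonal `d` and `d'`. -/
noncomputable def raising (q : Circle) (a b : ℕ) (d d' : ℕ → ℂ) :
    Matrix (Fin (a + 1) × Fin (b + 1)) (Fin (a + 1) × Fin (b + 1)) ℂ :=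
  simpleE q a ⊗ₖ Matrix.diagonal (fun j : Fin (b + 1) => d' j) +
    Matrix.diagonal (fun i : Fin (a + 1) => d i) ⊗ₖ simpleE q b

/-- The vector `∑_{i+j=m} c_i v_i ⊗ w_j`. -/
noncomputable def levelVec (a b m : ℕ) (c : ℕ → ℂ) : Fin (a + 1) × Fin (b + 1) → ℂ :=
  fun p => if (p.1 : ℕ) + p.2 = m then c p.1 else 0

theorem raising_mulVec_apply (q : Circle) (a b : ℕ) (d d' : ℕ → ℂ)
    (x : Fin (a + 1) × Fin (b + 1) → ℂ) (i : Fin (a + 1)) (j : Fin (b + 1)) :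
    (raising q a b d d' *ᵥ x) (i, j) = d' j * (simpleE q a *ᵥ fun i' => x (i', j)) i +
      d i * (simpleE q b *ᵥ fun j' => x (i, j')) j := by
  rw [raising, Matrix.add_mulVec, Pi.add_apply, kronecker_diagonal_mulVec,
    diagonal_kronecker_mulVec]

theorem raising_mulVec_levelVec (q : Circle) {a b m : ℕ} (ha : m ≤ a) (hb : m ≤ b)
    {d d' c : ℕ → ℂ}
    (h : ∀ i j, i + j + 1 = m → d' j * (qInt q ((a : ℤ) - i) * c (i + 1)) +
      d i * (qInt q ((b : ℤ) - j) * c i) = 0) :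
    raising q a b d d' *ᵥ levelVec a b m c = 0 := by
  funext ⟨i, j⟩
  rw [raising_mulVec_apply, Pi.zero_apply]
  by_cases hij : (i : ℕ) + j + 1 = m
  · rw [simpleE_mulVec_of_lt q a _ i (by omega), simpleE_mulVec_of_lt q b _ j (by omega)]
    simp only [levelVec]
    rw [if_pos (by omega), if_pos (by omega)]
    exact h i j hij
  · rw [simpleE_mulVec_eq_zero, simpleE_mulVec_eq_zero]
    · simp
    · intro j' hj'
      exact if_neg (by simp only; omega)
    · intro i' hi'
      exact if_neg (by simp only; omega)

/-- The component of the equation at (n, j) expresses the coefficient with first index n+1 through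
the one with first index n, the divisor being d'_j [a-n]. This is the uniqueness of highest weight
vectors with prescribed coefficient at v_0 ⊗ w_m, used for both coproducts. -/
theorem eq_zero_of_raising_mulVec (hq : ∀ k : ℕ, 0 < k → q ^ k ≠ 1) {a b m : ℕ} (hb : m ≤ b) {d d' : ℕ → ℂ} (hd' : ∀ j, d' j ≠ 0) {x : Fin (a + 1) × Fin (b + 1) → ℂ}
    (hx : raising q a b d d' *ᵥ x = 0)
    (hlev : ∀ (i : Fin (a + 1)) (j : Fin (b + 1)), (i : ℕ) + j ≠ m → x (i, j) = 0)
    (h0 : ∀ (i : Fin (a + 1)) (j : Fin (b + 1)), (i : ℕ) = 0 → (j : ℕ) = m → x (i, j) = 0) :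
    x = 0 := by
  have key : ∀ (n : ℕ) (i : Fin (a + 1)) (j : Fin (b + 1)), (i : ℕ) = n → (i : ℕ) + j = m →
      x (i, j) = 0 := by
    intro n
    induction n with
    | zero => exact fun i j hi hj => h0 i j hi (by omega)
    | succ n ih =>
      intro i j hi hj
      have h1 := congrFun hx (⟨n, by omega⟩, j)
      rw [raising_mulVec_apply, simpleE_mulVec_of_lt q a _ _ (by simp only; omega),
        simpleE_mulVec_of_lt q b _ j (by omega), ih ⟨n, by omega⟩ _ rfl (by simp only; omega)] at h1
      have hi' : i = ⟨n + 1, by omega⟩ := Fin.ext hi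
      simp only [mul_zero, add_zero, Pi.zero_apply] at h1
      rw [hi']
      exact ((mul_eq_zero.1 h1).resolve_left (hd' _) |> mul_eq_zero.1).resolve_left
        (qInt_ne_zero hq (by omega))
  funext ⟨i, j⟩
  by_cases hij : (i : ℕ) + j = m
  · exact key i i j rfl hij
  · exact hlev i j hij

/-- The ratios `∏_{t<i} [b-m+t+1] / [a-t]`. -/
noncomputable def hwRatio (q : Circle) (a b m : ℕ) (i : ℕ) : ℂ :=
  ∏ t ∈ Finset.range i, (qInt q ((b : ℤ) - m + t + 1) / qInt q ((a : ℤ) - t))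

/-- The coefficients of the highest weight vector at level `m` for the coproduct. -/
noncomputable def hwCoeff (q : Circle) (a b m : ℕ) (i : ℕ) : ℂ :=
  (-1) ^ i * (q : ℂ) ^ ((i : ℤ) * (a - i + 1)) * hwRatio q a b m i

/-- The coefficients of the highest weight vector at level `m` for the opposite coproduct. -/
noncomputable def hwCoeffOp (q : Circle) (a b m : ℕ) (i : ℕ) : ℂ :=
  (-1) ^ i * (q : ℂ) ^ (-(i : ℤ) * (b - 2 * m + i + 1)) * hwRatio q a b m i

theorem hwRatio_succ (hq : ∀ k : ℕ, 0 < k → q ^ k ≠ 1) {a b m i : ℕ} (h : i < a) :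
    qInt q ((a : ℤ) - i) * hwRatio q a b m (i + 1) =
      qInt q ((b : ℤ) - m + i + 1) * hwRatio q a b m i := by
  have := qInt_ne_zero hq (show (a : ℤ) - i ≠ 0 by omega)
  rw [hwRatio, Finset.prod_range_succ, ← hwRatio]
  field_simp

theorem hwRatio_ne_zero (hq : ∀ k : ℕ, 0 < k → q ^ k ≠ 1) {a b m i : ℕ} (ha : i ≤ a)
    (hb : m ≤ b) : hwRatio q a b m i ≠ 0 := by
  refine Finset.prod_ne_zero_iff.2 fun t ht => div_ne_zero (qInt_ne_zero hq ?_) (qInt_ne_zero hq ?_)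
  · omega
  · have := Finset.mem_range.1 ht
    omega

/-- Each step t → t+1 of the recursion multiplies the coefficient by -q^(a-2t) [b-m+t+1] / [a-t],
and the exponents a-2t for t < i add up to i(a-i+1). -/
theorem coproduct_E_mulVec_levelVec (hq : ∀ k : ℕ, 0 < k → q ^ k ≠ 1) {a b m : ℕ} (ha : m ≤ a)
    (hb : m ≤ b) :
    raising q a b (fun i => (q : ℂ) ^ ((a : ℤ) - 2 * i)) (fun _ => 1) *ᵥ
      levelVec a b m (hwCoeff q a b m) = 0 := by
  refine raising_mulVec_levelVec q ha hb fun i j hij => ?_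
  have h := hwRatio_succ hq (show i < a by omega) (b := b) (m := m)
  have h1 : (b : ℤ) - j = b - m + i + 1 := by omega
  have h2 : (q : ℂ) ^ (((i + 1 : ℕ) : ℤ) * (a - (i + 1 : ℕ) + 1)) =
      (q : ℂ) ^ ((a : ℤ) - 2 * i) * (q : ℂ) ^ ((i : ℤ) * (a - i + 1)) := by
    rw [← zpow_add₀ q.coe_ne_zero]
    congr 1; push_cast; ring
  rw [h1, hwCoeff, hwCoeff, h2]
  linear_combination ((-1) ^ (i + 1) * (q : ℂ) ^ ((a : ℤ) - 2 * i) *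
    (q : ℂ) ^ ((i : ℤ) * (a - i + 1))) * h

/-- Here the power of q sits on the other factor: step t contributes q^(-(b-2j)) with j = m-1-t, and
these exponents add up to -i(b-2m+i+1). -/
theorem op_coproduct_E_mulVec_levelVec (hq : ∀ k : ℕ, 0 < k → q ^ k ≠ 1) {a b m : ℕ} (ha : m ≤ a)
    (hb : m ≤ b) :
    raising q a b (fun _ => 1) (fun j => (q : ℂ) ^ ((b : ℤ) - 2 * j)) *ᵥ
      levelVec a b m (hwCoeffOp q a b m) = 0 := by
  refine raising_mulVec_levelVec q ha hb fun i j hij => ?_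
  have h := hwRatio_succ hq (show i < a by omega) (b := b) (m := m)
  have h1 : (b : ℤ) - j = b - m + i + 1 := by omega
  have h2 : (q : ℂ) ^ ((b : ℤ) - 2 * j) *
      (q : ℂ) ^ (-((i + 1 : ℕ) : ℤ) * (b - 2 * m + (i + 1 : ℕ) + 1)) =
      (q : ℂ) ^ (-(i : ℤ) * (b - 2 * m + i + 1)) := by
    rw [← zpow_add₀ q.coe_ne_zero]
    congr 1
    rw [← hij]
    push_cast; ring
  rw [h1, hwCoeffOp, hwCoeffOp]
  linear_combination ((-1) ^ (i + 1) * qInt q ((a : ℤ) - i) * hwRatio q a b m (i + 1)) * h2 +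
    ((-1) ^ (i + 1) * (q : ℂ) ^ (-(i : ℤ) * (b - 2 * m + i + 1))) * h

/-! ### The action of the `R`-matrix on highest weight vectors -/

theorem pow_succ_apply_eq_zero {ι : Type} [Fintype ι] [DecidableEq ι] {M : Matrix ι ι ℂ} {i : ι}
    (h : ∀ j, M i j = 0) (n : ℕ) (j : ι) : (M ^ (n + 1)) i j = 0 := by
  rw [pow_succ', Matrix.mul_apply]
  exact Finset.sum_eq_zero fun l _ => by rw [h, zero_mul]

theorem simple_F_pow_succ_zero (q : Circle) (a n : ℕ) (i : Fin (a + 1)) :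
    ((simple q a).F ^ (n + 1)) (0 : Fin (a + 1)) i = 0 :=
  pow_succ_apply_eq_zero (M := (simple q a).F)
    (fun j : Fin (a + 1) => if_neg (by simp)) n i

/-- The image of F has no v_0 component, so only the Cartan factor of R is visible in these
coordinates. -/
theorem RMat_mulVec_zero (s : Circle) (a : ℕ) (W : QMod q) (x : (simple q a).ι × W.ι → ℂ)
    (j : W.ι) : (RMat s (simple q a) W *ᵥ x) ((0 : Fin (a + 1)), j) =
      (s : ℂ) ^ ((a : ℤ) * W.wt j) * x ((0 : Fin (a + 1)), j) := by
  rw [RMat, ← Matrix.mulVec_mulVec, Matrix.mulVec_diagonal]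
  have hwt : (simple q a).wt (0 : Fin (a + 1)) = a := by
    change (a : ℤ) - 2 * ((0 : Fin (a + 1)) : ℕ) = a
    simp
  simp only [hwt]
  congr 1
  have hcard : Fintype.card (simple q a).ι = a + 1 := Fintype.card_fin (a + 1)
  rw [hcard, Finset.sum_range_succ', Matrix.add_mulVec, Pi.add_apply, Matrix.sum_mulVec,
    Finset.sum_apply, Finset.sum_eq_zero]
  · simp
  · intro n _
    rw [Matrix.smul_mulVec, Pi.smul_apply, Matrix.mulVec, dotProduct, Finset.sum_eq_zero, smul_zero]
    intro p _
    rw [Matrix.kroneckerMap_apply]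
    have : ((simple q a).F ^ (n + 1)) (0 : Fin (a + 1)) p.1 = 0 := simple_F_pow_succ_zero q a n p.1
    rw [this, zero_mul, zero_mul]

theorem R21Mat_mulVec (s : Circle) (V W : QMod q) (x : V.ι × W.ι → ℂ) :
    R21Mat s V W *ᵥ x = (RMat s W V *ᵥ (x ∘ Prod.swap)) ∘ Prod.swap := by
  rw [R21Mat]
  exact Matrix.submatrix_mulVec_equiv (RMat s W V) x Prod.swap (Equiv.prodComm _ _)

/-- The action of `R` on `V_a ⊗ V_b`. -/
noncomputable def simpleR (q s : Circle) (a b : ℕ) :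
    Matrix (Fin (a + 1) × Fin (b + 1)) (Fin (a + 1) × Fin (b + 1)) ℂ :=
  RMat s (simple q a) (simple q b)

/-- The action of `R²¹` on `V_a ⊗ V_b`. -/
noncomputable def simpleR21 (q s : Circle) (a b : ℕ) :
    Matrix (Fin (a + 1) × Fin (b + 1)) (Fin (a + 1) × Fin (b + 1)) ℂ :=
  R21Mat s (simple q a) (simple q b)

/-- The action of `K` on `V_a ⊗ V_b`. -/
noncomputable def simpleKK (q : Circle) (a b : ℕ) :
    Matrix (Fin (a + 1) × Fin (b + 1)) (Fin (a + 1) × Fin (b + 1)) ℂ :=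
  (simple q a).K ⊗ₖ (simple q b).K

/-- The action of `Δ E` on `V_a ⊗ V_b`. -/
noncomputable def simpleDelta (q : Circle) (a b : ℕ) :
    Matrix (Fin (a + 1) × Fin (b + 1)) (Fin (a + 1) × Fin (b + 1)) ℂ :=
  raising q a b (fun i => (q : ℂ) ^ ((a : ℤ) - 2 * i)) (fun _ => 1)

/-- The action of `Δ^op E` on `V_a ⊗ V_b`. -/
noncomputable def simpleDeltaOp (q : Circle) (a b : ℕ) :
    Matrix (Fin (a + 1) × Fin (b + 1)) (Fin (a + 1) × Fin (b + 1)) ℂ :=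
  raising q a b (fun _ => 1) (fun j => (q : ℂ) ^ ((b : ℤ) - 2 * j))

theorem op_coproduct_E_eq (q : Circle) (a b : ℕ) :
    (1 : Matrix (simple q a).ι (simple q a).ι ℂ) ⊗ₖ (simple q b).E +
      (simple q a).E ⊗ₖ (simple q b).K = simpleDeltaOp q a b :=
  add_comm _ _

theorem simpleR_mul_simpleDelta (hq : ∀ k : ℕ, 0 < k → q ^ k ≠ 1) {s : Circle} (hs : s ^ 2 = q)
    (a b : ℕ) : simpleR q s a b * simpleDelta q a b = simpleDeltaOp q a b * simpleR q s a b := by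
  have h := RMat_mul_E hq hs (simple q a) (simple q b)
  rw [op_coproduct_E_eq] at h
  exact h

theorem simpleR21_mul_simpleDeltaOp (hq : ∀ k : ℕ, 0 < k → q ^ k ≠ 1) {s : Circle}
    (hs : s ^ 2 = q) (a b : ℕ) :
    simpleR21 q s a b * simpleDeltaOp q a b = simpleDelta q a b * simpleR21 q s a b := by
  have h := R21Mat_mul_E hq hs (simple q a) (simple q b)
  rw [op_coproduct_E_eq] at h
  exact h

theorem simpleR_mul_simpleKK (q s : Circle) (a b : ℕ) :
    simpleR q s a b * simpleKK q a b = simpleKK q a b * simpleR q s a b :=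
  RMat_mul_K s (simple q a) (simple q b)

theorem simpleR21_mul_simpleKK (q s : Circle) (a b : ℕ) :
    simpleR21 q s a b * simpleKK q a b = simpleKK q a b * simpleR21 q s a b :=
  R21Mat_mul_K s (simple q a) (simple q b)

theorem simpleR_mulVec_zero (q s : Circle) (a b : ℕ) (x : Fin (a + 1) × Fin (b + 1) → ℂ)
    (j : Fin (b + 1)) : (simpleR q s a b *ᵥ x) (0, j) =
      (s : ℂ) ^ ((a : ℤ) * (b - 2 * (j : ℕ))) * x (0, j) :=
  RMat_mulVec_zero s a (simple q b) x j

theorem simpleR21_mulVec_zero (q s : Circle) (a b : ℕ) (x : Fin (a + 1) × Fin (b + 1) → ℂ)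
    (i : Fin (a + 1)) : (simpleR21 q s a b *ᵥ x) (i, 0) =
      (s : ℂ) ^ ((b : ℤ) * (a - 2 * (i : ℕ))) * x (i, 0) :=
  (congrFun (R21Mat_mulVec s (simple q a) (simple q b) x) (i, (0 : Fin (b + 1)))).trans
    (RMat_mulVec_zero s b (simple q a) _ i)

theorem simpleKK_mulVec_apply (q : Circle) (a b : ℕ)
    (x : Fin (a + 1) × Fin (b + 1) → ℂ) (i : Fin (a + 1)) (j : Fin (b + 1)) :
    (simpleKK q a b *ᵥ x) (i, j) = (q : ℂ) ^ ((a : ℤ) + b - 2 * (i + j : ℕ)) * x (i, j) := by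
  refine (kronecker_diagonal_mulVec _ _ x i j).trans ?_
  refine (congrArg _ (Matrix.mulVec_diagonal _ _ _)).trans ?_
  rw [← mul_assoc]
  congr 1
  change (q : ℂ) ^ ((b : ℤ) - 2 * (j : ℕ)) * (q : ℂ) ^ ((a : ℤ) - 2 * (i : ℕ)) = _
  rw [← zpow_add₀ q.coe_ne_zero]
  congr 1; push_cast; ring

theorem simpleKK_mulVec_eq_smul_iff (hq : ∀ k : ℕ, 0 < k → q ^ k ≠ 1) (a b m : ℕ)
    (x : Fin (a + 1) × Fin (b + 1) → ℂ) :
    simpleKK q a b *ᵥ x = (q : ℂ) ^ ((a : ℤ) + b - 2 * m) • x ↔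
      ∀ (i : Fin (a + 1)) (j : Fin (b + 1)), (i : ℕ) + j ≠ m → x (i, j) = 0 := by
  constructor
  · intro h i j hij
    have h1 := congrFun h (i, j)
    rw [simpleKK_mulVec_apply] at h1
    by_contra hne
    have h2 := mul_right_cancel₀ hne h1
    rw [zpow_inj hq] at h2
    omega
  · intro h
    funext ⟨i, j⟩
    rw [simpleKK_mulVec_apply]
    by_cases hij : (i : ℕ) + j = m
    · rw [hij]; rfl
    · simp [h i j hij]

theorem levelVec_of_ne {a b m : ℕ} (c : ℕ → ℂ) (i : Fin (a + 1)) (j : Fin (b + 1))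
    (h : (i : ℕ) + j ≠ m) : levelVec a b m c (i, j) = 0 := if_neg h

/-- The levels are the eigenspaces of K ⊗ K, hence are preserved by every operator commuting with
it. -/
theorem mulVec_levelVec_of_ne (hq : ∀ k : ℕ, 0 < k → q ^ k ≠ 1) {a b m : ℕ}
    {M : Matrix (Fin (a + 1) × Fin (b + 1)) (Fin (a + 1) × Fin (b + 1)) ℂ}
    (hM : M * simpleKK q a b = simpleKK q a b * M) (c : ℕ → ℂ) (i : Fin (a + 1)) (j : Fin (b + 1))
    (h : (i : ℕ) + j ≠ m) : (M *ᵥ levelVec a b m c) (i, j) = 0 := by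
  refine (simpleKK_mulVec_eq_smul_iff hq a b m _).1 ?_ i j h
  have h1 := (simpleKK_mulVec_eq_smul_iff hq a b m (levelVec a b m c)).2
    (fun i j h => levelVec_of_ne _ i j h)
  rw [Matrix.mulVec_mulVec, ← hM, ← Matrix.mulVec_mulVec, h1, Matrix.mulVec_smul]

/-- Both sides are highest weight vectors for Δ^op at level m, so it suffices to compare them at v_0
⊗ w_m. -/
theorem simpleR_mulVec_levelVec (hq : ∀ k : ℕ, 0 < k → q ^ k ≠ 1) {s : Circle} (hs : s ^ 2 = q)
    {a b m : ℕ} (ha : m ≤ a) (hb : m ≤ b) :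
    simpleR q s a b *ᵥ levelVec a b m (hwCoeff q a b m) =
      (s : ℂ) ^ ((a : ℤ) * (b - 2 * m)) • levelVec a b m (hwCoeffOp q a b m) := by
  rw [← sub_eq_zero]
  refine eq_zero_of_raising_mulVec hq hb (d := fun _ => 1)
    (d' := fun j => (q : ℂ) ^ ((b : ℤ) - 2 * j)) (fun j => zpow_ne_zero _ q.coe_ne_zero) ?_ ?_ ?_
  · rw [Matrix.mulVec_sub, Matrix.mulVec_smul, op_coproduct_E_mulVec_levelVec hq ha hb, smul_zero,
      sub_zero, Matrix.mulVec_mulVec, ← simpleDeltaOp, ← simpleR_mul_simpleDelta hq hs,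
      ← Matrix.mulVec_mulVec, simpleDelta, coproduct_E_mulVec_levelVec hq ha hb, Matrix.mulVec_zero]
  · intro i j hij
    rw [Pi.sub_apply, mulVec_levelVec_of_ne hq (simpleR_mul_simpleKK q s a b) _ i j hij,
      Pi.smul_apply, levelVec_of_ne _ i j hij, smul_zero, sub_zero]
  · intro i j hi hj
    have hi' : i = 0 := Fin.ext hi
    rw [hi', Pi.sub_apply, simpleR_mulVec_zero, Pi.smul_apply, hj]
    simp [levelVec, hj, hwCoeff, hwCoeffOp, hwRatio]

theorem hwCoeff_ne_zero (hq : ∀ k : ℕ, 0 < k → q ^ k ≠ 1) {a b m i : ℕ} (ha : i ≤ a)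
    (hb : m ≤ b) : hwCoeff q a b m i ≠ 0 :=
  mul_ne_zero (mul_ne_zero (pow_ne_zero _ (by norm_num)) (zpow_ne_zero _ q.coe_ne_zero))
    (hwRatio_ne_zero hq ha hb)

theorem coe_zpow_eq {q s : Circle} (hs : s ^ 2 = q) (k : ℤ) :
    (q : ℂ) ^ k = (s : ℂ) ^ (2 * k) := by
  rw [← hs, zpow_mul]; norm_cast

theorem simpleR21_mulVec_levelVec (hq : ∀ k : ℕ, 0 < k → q ^ k ≠ 1) {s : Circle} (hs : s ^ 2 = q)
    {a b m : ℕ} (ha : m ≤ a) (hb : m ≤ b) :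
    simpleR21 q s a b *ᵥ levelVec a b m (hwCoeffOp q a b m) =
      (s : ℂ) ^ ((b : ℤ) * (a - 2 * m) - 2 * m * (a + b - 2 * m + 2)) •
        levelVec a b m (hwCoeff q a b m) := by
  obtain ⟨ν, hν⟩ : ∃ ν : ℂ, simpleR21 q s a b *ᵥ levelVec a b m (hwCoeffOp q a b m) =
      ν • levelVec a b m (hwCoeff q a b m) := by
    -- Proportionality follows from uniqueness, with ν the still unknown coefficient at v_0 ⊗ w_m.
    -- R²¹ is not diagonal in that coordinate.
    refine ⟨(simpleR21 q s a b *ᵥ levelVec a b m (hwCoeffOp q a b m)) (0, ⟨m, by omega⟩), ?_⟩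
    rw [← sub_eq_zero]
    refine eq_zero_of_raising_mulVec hq hb (d := fun i => (q : ℂ) ^ ((a : ℤ) - 2 * i))
      (d' := fun _ => 1) (fun _ => one_ne_zero) ?_ ?_ ?_
    · rw [Matrix.mulVec_sub, Matrix.mulVec_smul, coproduct_E_mulVec_levelVec hq ha hb, smul_zero,
        sub_zero, Matrix.mulVec_mulVec, ← simpleDelta, ← simpleR21_mul_simpleDeltaOp hq hs,
        ← Matrix.mulVec_mulVec, simpleDeltaOp, op_coproduct_E_mulVec_levelVec hq ha hb,
        Matrix.mulVec_zero]
    · intro i j hij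
      rw [Pi.sub_apply, mulVec_levelVec_of_ne hq (simpleR21_mul_simpleKK q s a b) _ i j hij,
        Pi.smul_apply, levelVec_of_ne _ i j hij, smul_zero, sub_zero]
    · intro i j hi hj
      have hi' : i = 0 := Fin.ext hi
      have hj' : j = ⟨m, by omega⟩ := Fin.ext hj
      rw [hi', hj', Pi.sub_apply, Pi.smul_apply]
      simp [levelVec, hwCoeff, hwRatio]
  -- At v_m ⊗ w_0 only the Cartan factor of R²¹ contributes. The price is the ratio of the two m-th
  -- coefficients, computed in `h7`.
  have h2 := congrFun hν (⟨m, by omega⟩, 0)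
  rw [simpleR21_mulVec_zero, Pi.smul_apply, smul_eq_mul] at h2
  simp only [levelVec, Fin.val_zero, add_zero, if_true] at h2
  have h7 : hwCoeffOp q a b m m = (s : ℂ) ^ (-(2 * m * (a + b - 2 * m + 2)) : ℤ) *
      hwCoeff q a b m m := by
    have : (q : ℂ) ^ (-(m : ℤ) * (b - 2 * m + m + 1)) =
        (s : ℂ) ^ (-(2 * m * (a + b - 2 * m + 2)) : ℤ) * (q : ℂ) ^ ((m : ℤ) * (a - m + 1)) := by
      rw [coe_zpow_eq hs, coe_zpow_eq hs, ← zpow_add₀ s.coe_ne_zero]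
      congr 1; ring
    rw [hwCoeffOp, hwCoeff, this]
    ring
  rw [h7, ← mul_assoc] at h2
  have h8 := mul_right_cancel₀ (hwCoeff_ne_zero hq ha hb) h2
  rw [← zpow_add₀ s.coe_ne_zero, ← sub_eq_add_neg] at h8
  rw [hν, h8]

/-- The exponent `k` of the eigenvalue `q^k` of `R²¹ R` on `V_{a+b-2m} ⊂ V_a ⊗ V_b`. -/
def monodromyExp (a b m : ℕ) : ℤ := (a : ℤ) * b - 2 * m * (a + b + 1 - m)

theorem simple_monodromy_mulVec_levelVec (hq : ∀ k : ℕ, 0 < k → q ^ k ≠ 1) {s : Circle}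
    (hs : s ^ 2 = q) {a b m : ℕ} (ha : m ≤ a) (hb : m ≤ b) :
    (simpleR21 q s a b * simpleR q s a b) *ᵥ levelVec a b m (hwCoeff q a b m) =
      (q : ℂ) ^ monodromyExp a b m • levelVec a b m (hwCoeff q a b m) := by
  rw [← Matrix.mulVec_mulVec, simpleR_mulVec_levelVec hq hs ha hb, Matrix.mulVec_smul,
    simpleR21_mulVec_levelVec hq hs ha hb, smul_smul, ← zpow_add₀ s.coe_ne_zero, coe_zpow_eq hs,
    monodromyExp]
  congr 2
  ring

/-- Composing with the monodromy and multiplying by its eigenvalue give two morphisms that agree on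
the highest weight vector, so the eigenvalue equation holds on the whole submodule. -/
theorem exists_simple_tensor_morphism (hq : ∀ k : ℕ, 0 < k → q ^ k ≠ 1) {s : Circle}
    (hs : s ^ 2 = q) {a b m : ℕ} (ha : m ≤ a) (hb : m ≤ b) :
    ∃ f : Matrix ((simple q a).ι × (simple q b).ι) (simple q (a + b - 2 * m)).ι ℂ,
      f ∈ Mult (simple q (a + b - 2 * m)) (tensor s (simple q a) (simple q b)) ∧
      f *ᵥ highest q (a + b - 2 * m) = levelVec a b m (hwCoeff q a b m) ∧
      monodromy s (simple q a) (simple q b) * f = (q : ℂ) ^ monodromyExp a b m • f := by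
  have hE : (tensor s (simple q a) (simple q b)).E *ᵥ levelVec a b m (hwCoeff q a b m) = 0 :=
    coproduct_E_mulVec_levelVec hq ha hb
  have hK : (tensor s (simple q a) (simple q b)).K *ᵥ levelVec a b m (hwCoeff q a b m) =
      (q : ℂ) ^ ((a + b - 2 * m : ℕ) : ℤ) • levelVec a b m (hwCoeff q a b m) := by
    rw [tensor_K, show ((a + b - 2 * m : ℕ) : ℤ) = (a : ℤ) + b - 2 * m by omega]
    exact (simpleKK_mulVec_eq_smul_iff hq a b m _).2 (fun i j h => levelVec_of_ne _ i j h)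
  obtain ⟨f, hf, hfu⟩ := exists_mem_Mult hq _ hE hK
  refine ⟨f, hf, hfu, ?_⟩
  refine Mult.ext_highest hq (Mult.mul_mem (monodromy_mem_Mult hq hs _ _) hf)
    (Submodule.smul_mem _ _ hf) ?_
  refine (Matrix.mulVec_mulVec _ _ _).symm.trans
    (Eq.trans ?_ (Matrix.smul_mulVec _ _ _).symm)
  rw [hfu]
  exact (congrArg (fun x : Fin (a + 1) × Fin (b + 1) → ℂ =>
    (simpleR21 q s a b * simpleR q s a b) *ᵥ x) hfu).trans
    (simple_monodromy_mulVec_levelVec hq hs ha hb)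

/-! ### The norm of the highest weight vectors -/

/-- The action of the unitarized `R`-matrix on `V_a ⊗ V_b`. -/
noncomputable def simpleRBar (q s : Circle) (a b : ℕ) :
    Matrix (Fin (a + 1) × Fin (b + 1)) (Fin (a + 1) × Fin (b + 1)) ℂ :=
  RBar s (simple q a) (simple q b)

/-- The exponent a(b-2m) of s coming from R, minus the exponent of the monodromy eigenvalue, is
2m(b-m+1). It is even, so only a power of q remains and the choice of s drops out. -/
theorem simpleRBar_mulVec_levelVec (hq : ∀ k : ℕ, 0 < k → q ^ k ≠ 1) {s : Circle}
    (hs : s ^ 2 = q) {a b m : ℕ} (ha : m ≤ a) (hb : m ≤ b) :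
    simpleRBar q s a b *ᵥ levelVec a b m (hwCoeff q a b m) =
      (q : ℂ) ^ ((m : ℤ) * (b - m + 1)) • levelVec a b m (hwCoeffOp q a b m) := by
  obtain ⟨f, -, hfu, hM⟩ := exists_simple_tensor_morphism hq hs ha hb
  let I : Matrix (Fin (a + 1) × Fin (b + 1)) (Fin (a + 1) × Fin (b + 1)) ℂ :=
    invSqrt q s (monodromy s (simple q a) (simple q b))
  have h1 : I *ᵥ levelVec a b m (hwCoeff q a b m) =
      (s : ℂ) ^ (-monodromyExp a b m) • levelVec a b m (hwCoeff q a b m) := by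
    have h2 := congrArg (fun g => g *ᵥ highest q (a + b - 2 * m)) (invSqrt_mul hq s hM)
    rw [← hfu]
    exact (Matrix.mulVec_mulVec _ _ _).trans (h2.trans (Matrix.smul_mulVec _ _ _))
  have h3 : simpleRBar q s a b = simpleR q s a b * I := rfl
  rw [h3, ← Matrix.mulVec_mulVec, h1, Matrix.mulVec_smul, simpleR_mulVec_levelVec hq hs ha hb,
    smul_smul, ← zpow_add₀ s.coe_ne_zero, coe_zpow_eq hs, monodromyExp]
  congr 2
  ring

/-! ### The square norm as a q-Vandermonde sum -/

theorem hwRatio_eq_qFact (hq : ∀ k : ℕ, 0 < k → q ^ k ≠ 1) (a β m i : ℕ) (h : i ≤ a) :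
    hwRatio q a (β + m) m i * (qFact q β * qFact q a) = qFact q (β + i) * qFact q (a - i) := by
  induction i with
  | zero => simp [hwRatio]
  | succ i ih =>
    have h1 := ih (by omega)
    have h2 : a - i = a - (i + 1) + 1 := by omega
    have h3 := hwRatio_succ hq (show i < a by omega) (b := β + m) (m := m)
    have h4 : ((a - (i + 1) : ℕ) : ℤ) + 1 = (a : ℤ) - i := by omega
    have h5 : (((β + m : ℕ) : ℤ) - m + i + 1) = ((β + i : ℕ) : ℤ) + 1 := by push_cast; ring
    rw [h2, qFact_succ, h4] at h1
    rw [h5] at h3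
    have h6 := qInt_ne_zero hq (show (a : ℤ) - i ≠ 0 by omega)
    rw [← add_assoc, qFact_succ]
    refine mul_left_cancel₀ h6 ?_
    linear_combination (qFact q β * qFact q a) * h3 + qInt q (((β + i : ℕ) : ℤ) + 1) * h1

/-- Once everything is written in q-factorials, the weight of v_i ⊗ w_j in the norm becomes a
prefactor independent of i times a summand of the Vandermonde identity. -/
theorem hwRatio_sq_mul (hq : ∀ k : ℕ, 0 < k → q ^ k ≠ 1) {a b m i j : ℕ} (ha : m ≤ a)
    (hb : m ≤ b) (hij : i + j = m) :
    hwRatio q a b m i ^ 2 * (qBinom q a i * qBinom q b j) =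
      qBinom q b m / qBinom q a m *
        (qBinom q ((b : ℤ) - m + i) i * qBinom q ((a : ℤ) - m + j) j) := by
  obtain ⟨α, rfl⟩ := Nat.exists_eq_add_of_le' ha
  obtain ⟨β, rfl⟩ := Nat.exists_eq_add_of_le' hb
  have h1 := hwRatio_eq_qFact hq (α + m) β m i (by omega)
  rw [show α + m - i = α + j by omega] at h1
  have e1 : qBinom q ((α + m : ℕ) : ℤ) i = qFact q (α + m) / (qFact q i * qFact q (α + j)) := by
    have := qBinom_eq_qFact hq (α + j) i
    rwa [show α + j + i = α + m by omega] at this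
  have e2 : qBinom q ((β + m : ℕ) : ℤ) j = qFact q (β + m) / (qFact q j * qFact q (β + i)) := by
    have := qBinom_eq_qFact hq (β + i) j
    rwa [show β + i + j = β + m by omega] at this
  have e3 : qBinom q (((β + m : ℕ) : ℤ) - m + i) i = qFact q (β + i) / (qFact q i * qFact q β) := by
    rw [← qBinom_eq_qFact hq]
    congr 1; push_cast; ring
  have e4 : qBinom q (((α + m : ℕ) : ℤ) - m + j) j = qFact q (α + j) / (qFact q j * qFact q α) := by
    rw [← qBinom_eq_qFact hq]
    congr 1; push_cast; ring
  rw [e1, e2, e3, e4, qBinom_eq_qFact hq, qBinom_eq_qFact hq]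
  have n1 := qFact_ne_zero hq (α + m)
  have n2 := qFact_ne_zero hq (β + m)
  have n3 := qFact_ne_zero hq i
  have n4 := qFact_ne_zero hq j
  have n5 := qFact_ne_zero hq α
  have n6 := qFact_ne_zero hq β
  have n7 := qFact_ne_zero hq (α + j)
  have n8 := qFact_ne_zero hq (β + i)
  have n9 := qFact_ne_zero hq m
  rw [← eq_div_iff (mul_ne_zero n6 n1)] at h1
  rw [h1]
  field_simp

theorem sum_level_eq_sum_antidiagonal {a b m : ℕ} (ha : m ≤ a) (hb : m ≤ b) (g : ℕ → ℕ → ℂ) :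
    ∑ p : Fin (a + 1) × Fin (b + 1), (if (p.1 : ℕ) + p.2 = m then g p.1 p.2 else 0) =
      ∑ p ∈ Finset.HasAntidiagonal.antidiagonal m, g p.1 p.2 := by
  rw [Fintype.sum_prod_type]
  have h1 : ∀ i : Fin (a + 1), ∑ j : Fin (b + 1), (if (i : ℕ) + j = m then g i j else 0) =
      ∑ j ∈ Finset.range (b + 1), (if (i : ℕ) + j = m then g i j else 0) := fun i =>
    Fin.sum_univ_eq_sum_range (fun j => if (i : ℕ) + j = m then g i j else 0) (b + 1)
  simp only [h1]
  rw [Fin.sum_univ_eq_sum_range (fun i => ∑ j ∈ Finset.range (b + 1),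
    (if i + j = m then g i j else 0)) (a + 1), ← Finset.sum_product', ← Finset.sum_filter]
  refine Finset.sum_congr ?_ fun _ _ => rfl
  ext ⟨i, j⟩
  simp only [Finset.mem_filter, Finset.mem_product, Finset.mem_range,
    Finset.HasAntidiagonal.mem_antidiagonal]
  omega

theorem conj_hwRatio (q : Circle) (a b m i : ℕ) :
    star (hwRatio q a b m i) = hwRatio q a b m i := by
  rw [RCLike.star_def, hwRatio, map_prod]
  simp only [map_div₀, conj_qInt]

/-- The square norm of the highest weight vector at level `m` of `V_a ⊗ V_b`. -/
theorem form_levelVec (hq : ∀ k : ℕ, 0 < k → q ^ k ≠ 1) {s : Circle}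
    (hs : s ^ 2 = q) {a b m : ℕ} (ha : m ≤ a) (hb : m ≤ b) :
    (tensor s (simple q a) (simple q b)).form (levelVec a b m (hwCoeff q a b m))
      (levelVec a b m (hwCoeff q a b m)) =
      qBinom q b m / qBinom q a m * qBinom q ((a : ℤ) + b + 1 - m) m := by
  let G : Matrix (Fin (a + 1) × Fin (b + 1)) (Fin (a + 1) × Fin (b + 1)) ℂ :=
    Matrix.diagonal (fun i : Fin (a + 1) => qBinom q a i) ⊗ₖ
      Matrix.diagonal (fun j : Fin (b + 1) => qBinom q b j)
  have h1 : levelVec a b m (hwCoeff q a b m) ⬝ᵥ (((simpleRBar q s a b)ᵀ * G) *ᵥ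
      star (levelVec a b m (hwCoeff q a b m))) =
      (simpleRBar q s a b *ᵥ levelVec a b m (hwCoeff q a b m)) ⬝ᵥ
        (G *ᵥ star (levelVec a b m (hwCoeff q a b m))) := by
    rw [← Matrix.mulVec_mulVec, Matrix.dotProduct_transpose_mulVec, dotProduct_comm]
  refine h1.trans ?_
  rw [simpleRBar_mulVec_levelVec hq hs ha hb, smul_dotProduct, smul_eq_mul]
  -- Complex conjugation inverts powers of q, so the exponents of the two coefficient families
  -- combine to -i(b-2m+i+1) - i(a-i+1), which is linear in i.
  let g : ℕ → ℕ → ℂ := fun i j => (q : ℂ) ^ (-(i : ℤ) * (a + b - 2 * m + 2)) *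
    (hwRatio q a b m i ^ 2 * (qBinom q a i * qBinom q b j))
  have h2 : levelVec a b m (hwCoeffOp q a b m) ⬝ᵥ
      (G *ᵥ star (levelVec a b m (hwCoeff q a b m))) =
      ∑ p : Fin (a + 1) × Fin (b + 1), (if (p.1 : ℕ) + p.2 = m then g p.1 p.2 else 0) := by
    refine Finset.sum_congr rfl ?_
    rintro ⟨i, j⟩ -
    simp only [g, G, Matrix.diagonal_kronecker_diagonal, Matrix.mulVec_diagonal, levelVec,
      Pi.star_apply]
    split_ifs with hij
    · simp only [hwCoeff, hwCoeffOp, star_mul', star_pow, star_neg, star_one, star_coe_zpow,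
        conj_hwRatio]
      have e1 : (q : ℂ) ^ (-(i : ℕ) * ((b : ℤ) - 2 * m + (i : ℕ) + 1)) *
          (q : ℂ) ^ (-(((i : ℕ) : ℤ) * (a - (i : ℕ) + 1))) =
          (q : ℂ) ^ (-((i : ℕ) : ℤ) * (a + b - 2 * m + 2)) := by
        rw [← zpow_add₀ q.coe_ne_zero]
        congr 1; ring
      have e2 : ((-1 : ℂ) ^ (i : ℕ)) * (-1) ^ (i : ℕ) = 1 := by
        rw [← mul_pow]; simp
      rw [← e1]
      linear_combination ((q : ℂ) ^ (-(i : ℕ) * ((b : ℤ) - 2 * m + (i : ℕ) + 1)) *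
          (q : ℂ) ^ (-(((i : ℕ) : ℤ) * (a - (i : ℕ) + 1))) *
          (hwRatio q a b m i ^ 2 * (qBinom q a i * qBinom q b j))) * e2
    · simp
  rw [h2.trans (sum_level_eq_sum_antidiagonal ha hb g)]
  -- With α = a-m+1 and β = b-m+1 the total exponent mβ - i(α+β) equals jβ - iα for i + j = m.
  have h3 := qBinom_vandermonde hq ((b : ℤ) - m + 1) (a - m + 1) m
  have h4 : (((a - m + 1 : ℕ) : ℤ)) = (a : ℤ) - m + 1 := by omega
  rw [h4] at h3
  rw [show (a : ℤ) + b + 1 - m = a - m + 1 + (b - m + 1) + m - 1 by ring, ← h3, Finset.mul_sum,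
    Finset.mul_sum]
  refine Finset.sum_congr rfl ?_
  rintro ⟨i, j⟩ hij
  have hij' : i + j = m := Finset.HasAntidiagonal.mem_antidiagonal.1 hij
  simp only [g]
  rw [hwRatio_sq_mul hq ha hb hij', ← mul_assoc ((q : ℂ) ^ _), ← zpow_add₀ q.coe_ne_zero,
    show (b : ℤ) - m + 1 - 1 + i = b - m + i by ring,
    show (a : ℤ) - m + 1 - 1 + j = a - m + j by ring, mul_left_comm]
  congr 2
  congr 1
  rw [← hij']
  push_cast
  ring

theorem isUnitHighest_levelVec (hq : ∀ k : ℕ, 0 < k → q ^ k ≠ 1) (s : Circle)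
    {a b m : ℕ} (ha : m ≤ a) (hb : m ≤ b) :
    IsUnitHighest (q := q) s a b m (levelVec a b m (hwCoeff q a b m)) := by
  refine ⟨coproduct_E_mulVec_levelVec hq ha hb, fun i j h => levelVec_of_ne _ i j h, ?_⟩
  intro i j hi hj
  have : levelVec a b m (hwCoeff q a b m) (i, j) = hwCoeff q a b m i := if_pos (by simp only; omega)
  refine this.trans ?_
  rw [hi]
  simp [hwCoeff, hwRatio]

theorem IsUnitHighest.eq_levelVec (hq : ∀ k : ℕ, 0 < k → q ^ k ≠ 1) {s : Circle}
    {a b m : ℕ} (ha : m ≤ a) (hb : m ≤ b)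
    {u : (tensor s (simple q a) (simple q b)).ι → ℂ} (hu : IsUnitHighest s a b m u) :
    u = levelVec a b m (hwCoeff q a b m) := by
  have hv := isUnitHighest_levelVec hq s ha hb
  let u' : Fin (a + 1) × Fin (b + 1) → ℂ := u
  have h : u' - levelVec a b m (hwCoeff q a b m) = 0 := by
    refine eq_zero_of_raising_mulVec hq hb (d := fun i => (q : ℂ) ^ ((a : ℤ) - 2 * i))
      (d' := fun _ => 1) (fun _ => one_ne_zero) ?_ ?_ ?_
    · rw [Matrix.mulVec_sub, coproduct_E_mulVec_levelVec hq ha hb, sub_zero]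
      exact hu.1
    · intro i j hij
      rw [Pi.sub_apply, levelVec_of_ne _ i j hij, sub_zero]
      exact hu.2.1 i j hij
    · intro i j hi hj
      rw [Pi.sub_apply, sub_eq_zero]
      exact (hu.2.2 i j hi hj).trans (hv.2.2 i j hi hj).symm
  exact sub_eq_zero.1 h

/-! ### Decompositions into simple modules -/

/-- An orthogonal decomposition of a module with a contravariant form into simple modules. -/
structure Decomp (T : QMod q) where
  I : Type
  [fintypeI : Fintype I]
  [decEqI : DecidableEq I]
  c : I → ℕ
  ε : I → ℝ
  f : ∀ i, Matrix T.ι (simple q (c i)).ι ℂ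
  contra : T.IsContravariant
  mem : ∀ i, f i ∈ Mult (simple q (c i)) T
  ε_ne : ∀ i, ε i ≠ 0
  form_self : ∀ i, T.form (f i *ᵥ highest q (c i)) (f i *ᵥ highest q (c i)) = ε i
  form_ne : ∀ i j, i ≠ j → T.form (f i *ᵥ highest q (c i)) (f j *ᵥ highest q (c j)) = 0
  span : ∀ x : T.ι → ℂ, ∃ y : ∀ i, (simple q (c i)).ι → ℂ, x = ∑ i, f i *ᵥ y i

attribute [instance] Decomp.fintypeI Decomp.decEqI

theorem pairing_eq_zero (hq : ∀ k : ℕ, 0 < k → q ^ k ≠ 1) {T : QMod q} (hT : T.IsContravariant)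
    {c c' : ℕ} {f : Matrix T.ι (simple q c).ι ℂ} {g : Matrix T.ι (simple q c').ι ℂ}
    (hf : f ∈ Mult (simple q c) T) (hg : g ∈ Mult (simple q c') T)
    (h : T.form (f *ᵥ highest q c) (g *ᵥ highest q c') = 0) : fᵀ * T.gram * g.map star = 0 := by
  refine simple_ext_pairing fun k l _ _ => ?_
  rw [← T.form_mulVec_mulVec, form_simpleVec hq hT hf hg, h]
  simp

theorem form_eq_zero (hq : ∀ k : ℕ, 0 < k → q ^ k ≠ 1) {T : QMod q} (hT : T.IsContravariant)
    {c c' : ℕ} {f : Matrix T.ι (simple q c).ι ℂ} {g : Matrix T.ι (simple q c').ι ℂ}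
    (hf : f ∈ Mult (simple q c) T) (hg : g ∈ Mult (simple q c') T)
    (h : T.form (f *ᵥ highest q c) (g *ᵥ highest q c') = 0) (x : (simple q c).ι → ℂ)
    (y : (simple q c').ι → ℂ) : T.form (f *ᵥ x) (g *ᵥ y) = 0 := by
  rw [T.form_mulVec_mulVec, pairing_eq_zero hq hT hf hg h, Matrix.zero_mulVec, dotProduct_zero]

theorem form_mulVec_eq_mul (hq : ∀ k : ℕ, 0 < k → q ^ k ≠ 1) {T : QMod q}
    (hT : T.IsContravariant) {c : ℕ} {f g : Matrix T.ι (simple q c).ι ℂ}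
    (hf : f ∈ Mult (simple q c) T) (hg : g ∈ Mult (simple q c) T) (x y : (simple q c).ι → ℂ) :
    T.form (f *ᵥ x) (g *ᵥ y) =
      (simple q c).form x y * T.form (f *ᵥ highest q c) (g *ᵥ highest q c) := by
  rw [T.form_mulVec_mulVec, pairing_same hq hT hf hg, Matrix.smul_mulVec, dotProduct_smul,
    smul_eq_mul, mul_comm]
  rfl

/-- An orthogonal family of morphisms from simple modules has independent images. -/
theorem eq_zero_of_sum_mulVec_eq_zero (hq : ∀ k : ℕ, 0 < k → q ^ k ≠ 1) {T : QMod q}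
    (hT : T.IsContravariant) {I : Type} [Fintype I] {c : I → ℕ}
    {f : ∀ i, Matrix T.ι (simple q (c i)).ι ℂ} (hf : ∀ i, f i ∈ Mult (simple q (c i)) T)
    (h1 : ∀ i, T.form (f i *ᵥ highest q (c i)) (f i *ᵥ highest q (c i)) ≠ 0)
    (h2 : ∀ i j, i ≠ j → T.form (f i *ᵥ highest q (c i)) (f j *ᵥ highest q (c j)) = 0)
    {y : ∀ i, (simple q (c i)).ι → ℂ} (h : ∑ i, f i *ᵥ y i = 0) : y = 0 := by
  funext j
  refine simple_form_eq_zero hq fun z => ?_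
  have h3 : T.form (∑ i, f i *ᵥ y i) (f j *ᵥ z) = 0 := by rw [h, T.form_zero_left]
  rw [T.form_sum_left, Finset.sum_eq_single j] at h3
  · rw [form_mulVec_eq_mul hq hT (hf j) (hf j)] at h3
    exact (mul_eq_zero.1 h3).resolve_right (h1 j)
  · exact fun i _ hij => form_eq_zero hq hT (hf i) (hf j) (h2 i j hij) _ _
  · simp

/-- Orthogonality with nonzero norms gives injectivity of the sum map, and equality of dimensions
then gives surjectivity. -/
theorem span_of_card (hq : ∀ k : ℕ, 0 < k → q ^ k ≠ 1) {T : QMod q}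
    (hT : T.IsContravariant) {I : Type} [Fintype I] {c : I → ℕ}
    {f : ∀ i, Matrix T.ι (simple q (c i)).ι ℂ} (hf : ∀ i, f i ∈ Mult (simple q (c i)) T)
    (h1 : ∀ i, T.form (f i *ᵥ highest q (c i)) (f i *ᵥ highest q (c i)) ≠ 0)
    (h2 : ∀ i j, i ≠ j → T.form (f i *ᵥ highest q (c i)) (f j *ᵥ highest q (c j)) = 0)
    (hcard : ∑ i, (c i + 1) = Fintype.card T.ι) (x : T.ι → ℂ) :
    ∃ y : ∀ i, (simple q (c i)).ι → ℂ, x = ∑ i, f i *ᵥ y i := by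
  let L : (∀ i, (simple q (c i)).ι → ℂ) →ₗ[ℂ] (T.ι → ℂ) :=
    ∑ i, (f i).mulVecLin ∘ₗ LinearMap.proj i
  have hL : ∀ y, L y = ∑ i, f i *ᵥ y i := fun y => by simp [L]
  have hinj : Function.Injective L := by
    rw [injective_iff_map_eq_zero]
    intro y hy
    rw [hL] at hy
    exact eq_zero_of_sum_mulVec_eq_zero hq hT hf h1 h2 hy
  have hdim : Module.finrank ℂ (∀ i, (simple q (c i)).ι → ℂ) = Module.finrank ℂ (T.ι → ℂ) := by
    rw [Module.finrank_pi_fintype, Module.finrank_fintype_fun_eq_card, ← hcard]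
    refine Finset.sum_congr rfl fun i _ => ?_
    rw [Module.finrank_fintype_fun_eq_card]
    exact Fintype.card_fin _
  obtain ⟨y, hy⟩ := (LinearMap.injective_iff_surjective_of_finrank_eq_finrank hdim).1 hinj x
  exact ⟨y, by rw [← hy, hL]⟩

/-! ### Two simple factors -/

/-- The embedding `V_{a+b-2m} → V_a ⊗ V_b`. -/
noncomputable def tensorMor (hq : ∀ k : ℕ, 0 < k → q ^ k ≠ 1) {s : Circle}
    (hs : s ^ 2 = q) {a b m : ℕ} (ha : m ≤ a) (hb : m ≤ b) :
    Matrix ((simple q a).ι × (simple q b).ι) (simple q (a + b - 2 * m)).ι ℂ :=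
  (exists_simple_tensor_morphism hq hs ha hb).choose

theorem tensorMor_mem (hq : ∀ k : ℕ, 0 < k → q ^ k ≠ 1) {s : Circle}
    (hs : s ^ 2 = q) {a b m : ℕ} (ha : m ≤ a) (hb : m ≤ b) :
    tensorMor hq hs ha hb ∈ Mult (simple q (a + b - 2 * m)) (tensor s (simple q a) (simple q b)) :=
  (exists_simple_tensor_morphism hq hs ha hb).choose_spec.1

theorem tensorMor_highest (hq : ∀ k : ℕ, 0 < k → q ^ k ≠ 1) {s : Circle}
    (hs : s ^ 2 = q) {a b m : ℕ} (ha : m ≤ a) (hb : m ≤ b) :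
    tensorMor hq hs ha hb *ᵥ highest q (a + b - 2 * m) = levelVec a b m (hwCoeff q a b m) :=
  (exists_simple_tensor_morphism hq hs ha hb).choose_spec.2.1

theorem monodromy_mul_tensorMor (hq : ∀ k : ℕ, 0 < k → q ^ k ≠ 1) {s : Circle}
    (hs : s ^ 2 = q) {a b m : ℕ} (ha : m ≤ a) (hb : m ≤ b) :
    monodromy s (simple q a) (simple q b) * tensorMor hq hs ha hb =
      (q : ℂ) ^ monodromyExp a b m • tensorMor hq hs ha hb :=
  (exists_simple_tensor_morphism hq hs ha hb).choose_spec.2.2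

/-- The square norm of the highest weight vector of `V_{a+b-2m} ⊂ V_a ⊗ V_b`. -/
noncomputable def hwNorm (q : Circle) (a b m : ℕ) : ℝ :=
  (qBinom q b m / qBinom q a m * qBinom q ((a : ℤ) + b + 1 - m) m).re

theorem coe_hwNorm (q : Circle) (a b m : ℕ) : (hwNorm q a b m : ℂ) =
    qBinom q b m / qBinom q a m * qBinom q ((a : ℤ) + b + 1 - m) m := by
  rw [hwNorm]
  refine Complex.conj_eq_iff_re.1 ?_
  rw [map_mul, map_div₀, conj_qBinom, conj_qBinom, conj_qBinom]

theorem hwNorm_ne_zero (hq : ∀ k : ℕ, 0 < k → q ^ k ≠ 1) {a b m : ℕ} (ha : m ≤ a) (hb : m ≤ b) :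
    hwNorm q a b m ≠ 0 := by
  have h : (hwNorm q a b m : ℂ) ≠ 0 := by
    rw [coe_hwNorm]
    exact mul_ne_zero (div_ne_zero (qBinom_ne_zero hq (by omega)) (qBinom_ne_zero hq (by omega)))
      (qBinom_ne_zero hq (by omega))
  exact_mod_cast h

theorem form_tensorMor (hq : ∀ k : ℕ, 0 < k → q ^ k ≠ 1) {s : Circle}
    (hs : s ^ 2 = q) {a b m : ℕ} (ha : m ≤ a) (hb : m ≤ b) :
    (tensor s (simple q a) (simple q b)).form
      (tensorMor hq hs ha hb *ᵥ highest q (a + b - 2 * m))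
      (tensorMor hq hs ha hb *ᵥ highest q (a + b - 2 * m)) = hwNorm q a b m := by
  rw [coe_hwNorm, ← form_levelVec hq hs ha hb]
  exact congrArg (fun u => (tensor s (simple q a) (simple q b)).form u u)
    (tensorMor_highest hq hs ha hb)

/-- At n = min a b the right side is (a+1)(b+1), the Clebsch–Gordan dimension count. -/
theorem sum_dim_tensor (a b n : ℕ) (ha : n ≤ a) (hb : n ≤ b) :
    ∑ m ∈ Finset.range (n + 1), (a + b - 2 * m + 1) = (n + 1) * (a + b + 1 - n) := by
  induction n with
  | zero => simp
  | succ n ih =>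
    rw [Finset.sum_range_succ, ih (by omega) (by omega)]
    zify [show 2 * (n + 1) ≤ a + b by omega, show n ≤ a + b + 1 by omega,
      show n + 1 ≤ a + b + 1 by omega]
    ring

theorem simple_tensor_span (hq : ∀ k : ℕ, 0 < k → q ^ k ≠ 1) {s : Circle}
    (hs : s ^ 2 = q) (a b : ℕ) (x : (simple q a).ι × (simple q b).ι → ℂ) :
    ∃ y : ∀ m : Fin (min a b + 1), (simple q (a + b - 2 * m)).ι → ℂ,
      x = ∑ m : Fin (min a b + 1),
        tensorMor hq hs (show (m : ℕ) ≤ a by omega) (show (m : ℕ) ≤ b by omega) *ᵥ y m := by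
  refine span_of_card hq (T := tensor s (simple q a) (simple q b))
    (tensor_isContravariant hq hs (simple_isContravariant hq a) (simple_isContravariant hq b))
    (c := fun m : Fin (min a b + 1) => a + b - 2 * m)
    (fun m => tensorMor_mem hq hs (show (m : ℕ) ≤ a by omega) (show (m : ℕ) ≤ b by omega))
    ?_ ?_ ?_ x
  · intro m
    rw [form_tensorMor]
    exact_mod_cast hwNorm_ne_zero hq (by omega) (by omega)
  · intro m m' hm
    refine form_highest_of_ne hq (tensor_isContravariant hq hs (simple_isContravariant hq a)
      (simple_isContravariant hq b)) ?_ (tensorMor_mem hq hs _ _) (tensorMor_mem hq hs _ _)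
    have : (m : ℕ) ≠ m' := fun h => hm (Fin.ext h)
    omega
  · have h1 : Fintype.card (tensor s (simple q a) (simple q b)).ι = (a + 1) * (b + 1) := by
      refine (Fintype.card_prod (Fin (a + 1)) (Fin (b + 1))).trans ?_
      rw [Fintype.card_fin, Fintype.card_fin]
    rw [h1, Fin.sum_univ_eq_sum_range (fun m => a + b - 2 * m + 1) (min a b + 1),
      sum_dim_tensor a b _ (min_le_left _ _) (min_le_right _ _)]
    rcases le_total a b with h | h
    · rw [min_eq_left h, show a + b + 1 - a = b + 1 by omega]
    · rw [min_eq_right h, show a + b + 1 - b = a + 1 by omega, mul_comm]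

/-! ### Decomposition of a tensor product with a simple module -/

theorem monodromy_mul_kronecker_one_mul (hq : ∀ k : ℕ, 0 < k → q ^ k ≠ 1) (s : Circle)
    {V T : QMod q} (W : QMod q) {f : Matrix T.ι V.ι ℂ} (hf : f ∈ Mult V T) {κ : Type}
    {g : Matrix (V.ι × W.ι) κ ℂ} {k : ℤ} (hg : monodromy s V W * g = (q : ℂ) ^ k • g) :
    monodromy s T W * ((f ⊗ₖ (1 : Matrix W.ι W.ι ℂ)) * g) =
      (q : ℂ) ^ k • ((f ⊗ₖ (1 : Matrix W.ι W.ι ℂ)) * g) := by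
  rw [← Matrix.mul_assoc, monodromy_mul_kronecker_one hq s W hf, Matrix.mul_assoc, hg,
    Matrix.mul_smul]

/-- The inverse square roots on V ⊗ W and on T ⊗ W come from different interpolating polynomials.
They are therefore compared on eigenvectors of the monodromy, where both act by the same power of s.
-/
theorem RBar_mul_kronecker_one_mul (hq : ∀ k : ℕ, 0 < k → q ^ k ≠ 1) (s : Circle)
    {V T : QMod q} (W : QMod q) {f : Matrix T.ι V.ι ℂ} (hf : f ∈ Mult V T) {κ : Type}
    {g : Matrix (V.ι × W.ι) κ ℂ} {k : ℤ} (hg : monodromy s V W * g = (q : ℂ) ^ k • g) :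
    RBar s T W * ((f ⊗ₖ (1 : Matrix W.ι W.ι ℂ)) * g) =
      (f ⊗ₖ (1 : Matrix W.ι W.ι ℂ)) * (RBar s V W * g) := by
  rw [RBar_eq, RBar_eq, Matrix.mul_assoc, Matrix.mul_assoc, invSqrt_mul hq s hg,
    invSqrt_mul hq s (monodromy_mul_kronecker_one_mul hq s W hf hg), Matrix.mul_smul,
    Matrix.mul_smul, Matrix.mul_smul, ← Matrix.mul_assoc, RMat_mul_kronecker_one hq s W hf,
    Matrix.mul_assoc]

/-- This reduces the form on T ⊗ W to the form of T pulled back along f and f'. Only the first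
argument meets the unitarized R-matrix, so no eigenvalue condition is imposed on g'. -/
theorem tensor_pairing (hq : ∀ k : ℕ, 0 < k → q ^ k ≠ 1) (s : Circle)
    {V V' T : QMod q} (W : QMod q) {f : Matrix T.ι V.ι ℂ} {f' : Matrix T.ι V'.ι ℂ}
    (hf : f ∈ Mult V T) {κ κ' : Type}
    {g : Matrix (V.ι × W.ι) κ ℂ} {g' : Matrix (V'.ι × W.ι) κ' ℂ} {k : ℤ}
    (hg : monodromy s V W * g = (q : ℂ) ^ k • g) :
    ((f ⊗ₖ (1 : Matrix W.ι W.ι ℂ)) * g)ᵀ * ((RBar s T W)ᵀ * (T.gram ⊗ₖ W.gram)) *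
        ((f' ⊗ₖ (1 : Matrix W.ι W.ι ℂ)) * g').map star =
      gᵀ * (RBar s V W)ᵀ * ((fᵀ * T.gram * f'.map star) ⊗ₖ W.gram) * g'.map star := by
  rw [← Matrix.mul_assoc (_)ᵀ, ← Matrix.transpose_mul, RBar_mul_kronecker_one_mul hq s W hf hg,
    Matrix.transpose_mul, Matrix.transpose_mul, map_star_mul, map_star_kronecker, map_star_one,
    kronecker_transpose, Matrix.transpose_one]
  have h : (fᵀ * T.gram * f'.map star) ⊗ₖ W.gram = (fᵀ ⊗ₖ (1 : Matrix W.ι W.ι ℂ)) *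
      (T.gram ⊗ₖ W.gram) * (f'.map star ⊗ₖ (1 : Matrix W.ι W.ι ℂ)) := by
    rw [← Matrix.mul_kronecker_mul, ← Matrix.mul_kronecker_mul, Matrix.one_mul, Matrix.mul_one]
  rw [h]
  simp only [Matrix.mul_assoc]

theorem tensor_form_mulVec (s : Circle) (T W : QMod q) {κ κ' : Type} [Fintype κ] [Fintype κ']
    (h : Matrix (T.ι × W.ι) κ ℂ) (h' : Matrix (T.ι × W.ι) κ' ℂ) (x : κ → ℂ) (y : κ' → ℂ) :
    (tensor s T W).form (h *ᵥ x) (h' *ᵥ y) =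
      x ⬝ᵥ ((hᵀ * ((RBar s T W)ᵀ * (T.gram ⊗ₖ W.gram)) * h'.map star) *ᵥ star y) :=
  dotProduct_pairing h h' _ x y

namespace Decomp

variable {T : QMod q}

/-- The embeddings of the simple summands into `T ⊗ V_b`. -/
noncomputable def tensorF (hq : ∀ k : ℕ, 0 < k → q ^ k ≠ 1) {s : Circle} (hs : s ^ 2 = q)
    (D : Decomp T) (b : ℕ) (p : Σ i : D.I, Fin (min (D.c i) b + 1)) :
    Matrix (T.ι × (simple q b).ι) (simple q (D.c p.1 + b - 2 * p.2)).ι ℂ :=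
  (D.f p.1 ⊗ₖ (1 : Matrix (simple q b).ι (simple q b).ι ℂ)) *
    tensorMor hq hs (show (p.2 : ℕ) ≤ D.c p.1 by omega) (show (p.2 : ℕ) ≤ b by omega)

theorem tensorF_mem (hq : ∀ k : ℕ, 0 < k → q ^ k ≠ 1) {s : Circle} (hs : s ^ 2 = q)
    (D : Decomp T) (b : ℕ) (p : Σ i : D.I, Fin (min (D.c i) b + 1)) :
    D.tensorF hq hs b p ∈ Mult (simple q (D.c p.1 + b - 2 * p.2)) (tensor s T (simple q b)) :=
  Mult.mul_mem (V := simple q (D.c p.1 + b - 2 * p.2))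
    (T := QSig.tensor s (simple q (D.c p.1)) (simple q b)) (S := QSig.tensor s T (simple q b))
    (f := tensorMor hq hs (show (p.2 : ℕ) ≤ D.c p.1 by omega) (show (p.2 : ℕ) ≤ b by omega))
    (g := D.f p.1 ⊗ₖ (1 : Matrix (simple q b).ι (simple q b).ι ℂ))
    (kronecker_one_mem_Mult s (simple q b) (D.mem p.1)) (tensorMor_mem hq hs _ _)

theorem monodromy_mul_tensorF (hq : ∀ k : ℕ, 0 < k → q ^ k ≠ 1) {s : Circle} (hs : s ^ 2 = q)
    (D : Decomp T) (b : ℕ) (p : Σ i : D.I, Fin (min (D.c i) b + 1)) :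
    monodromy s T (simple q b) * D.tensorF hq hs b p =
      (q : ℂ) ^ monodromyExp (D.c p.1) b p.2 • D.tensorF hq hs b p :=
  monodromy_mul_kronecker_one_mul hq s (simple q b) (D.mem p.1) (monodromy_mul_tensorMor hq hs _ _)

theorem tensorF_span (hq : ∀ k : ℕ, 0 < k → q ^ k ≠ 1) {s : Circle} (hs : s ^ 2 = q)
    (D : Decomp T) (b : ℕ) (x : T.ι × (simple q b).ι → ℂ) :
    ∃ y : ∀ p : Σ i : D.I, Fin (min (D.c i) b + 1), (simple q (D.c p.1 + b - 2 * p.2)).ι → ℂ,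
      x = ∑ p, D.tensorF hq hs b p *ᵥ y p := by
  -- T is decomposed separately for each basis vector w of V_b. Collecting the coordinates gives for
  -- each i a vector of V_(c_i) ⊗ V_b, to which the two-factor decomposition applies.
  choose y hy using fun w => D.span (fun t => x (t, w))
  choose z hz using fun i => simple_tensor_span hq hs (D.c i) b (fun p => y p.2 i p.1)
  refine ⟨fun p => z p.1 p.2, ?_⟩
  rw [Fintype.sum_sigma]
  have h1 : ∀ i, ∑ m, D.tensorF hq hs b ⟨i, m⟩ *ᵥ z i m =
      (D.f i ⊗ₖ (1 : Matrix (simple q b).ι (simple q b).ι ℂ)) *ᵥ (fun p => y p.2 i p.1) := by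
    intro i
    rw [hz i, Matrix.mulVec_sum]
    refine Finset.sum_congr rfl fun m _ => ?_
    rw [Matrix.mulVec_mulVec]
    rfl
  simp only [h1]
  funext ⟨t, w⟩
  have h2 := congrFun (hy w) t
  simp only [Finset.sum_apply] at h2 ⊢
  rw [h2]
  refine Finset.sum_congr rfl fun i _ => ?_
  simp only [Matrix.mulVec, dotProduct, Fintype.sum_prod_type, Matrix.kroneckerMap_apply,
    Matrix.one_apply]
  refine Finset.sum_congr rfl fun t' _ => ?_
  rw [Finset.sum_eq_single w]
  · simp
  · intro w' _ hw
    simp [Ne.symm hw]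
  · simp

theorem pairing_self (hq : ∀ k : ℕ, 0 < k → q ^ k ≠ 1) (D : Decomp T) (i : D.I) :
    (D.f i)ᵀ * T.gram * (D.f i).map star = (D.ε i : ℂ) • (simple q (D.c i)).gram := by
  rw [pairing_same hq D.contra (D.mem i) (D.mem i), D.form_self]

theorem form_tensorF_ne (hq : ∀ k : ℕ, 0 < k → q ^ k ≠ 1) {s : Circle} (hs : s ^ 2 = q)
    (D : Decomp T) (b : ℕ) {i j : D.I} (hij : i ≠ j) (m : Fin (min (D.c i) b + 1))
    (m' : Fin (min (D.c j) b + 1)) (x : (simple q (D.c i + b - 2 * m)).ι → ℂ)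
    (y : (simple q (D.c j + b - 2 * m')).ι → ℂ) :
    (tensor s T (simple q b)).form (D.tensorF hq hs b ⟨i, m⟩ *ᵥ x)
      (D.tensorF hq hs b ⟨j, m'⟩ *ᵥ y) = 0 := by
  rw [tensor_form_mulVec]
  have h := tensor_pairing hq s (simple q b) (f' := D.f j) (D.mem i)
    (g' := tensorMor hq hs (show (m' : ℕ) ≤ D.c j by omega) (show (m' : ℕ) ≤ b by omega))
    (monodromy_mul_tensorMor hq hs (show (m : ℕ) ≤ D.c i by omega) (show (m : ℕ) ≤ b by omega))
  rw [pairing_eq_zero hq D.contra (D.mem i) (D.mem j) (D.form_ne i j hij), Matrix.zero_kronecker,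
    Matrix.mul_zero, Matrix.zero_mul] at h
  refine (congrArg (fun M => x ⬝ᵥ (M *ᵥ star y)) h).trans ?_
  simp

/-- The form of T restricted to the i-th summand is ε_i times the Shapovalov form, so the form on
its product with V_b is ε_i times the two-factor form. -/
theorem form_tensorF_same (hq : ∀ k : ℕ, 0 < k → q ^ k ≠ 1) {s : Circle} (hs : s ^ 2 = q)
    (D : Decomp T) (b : ℕ) (i : D.I) (m m' : Fin (min (D.c i) b + 1))
    (x : (simple q (D.c i + b - 2 * m)).ι → ℂ) (y : (simple q (D.c i + b - 2 * m')).ι → ℂ) :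
    (tensor s T (simple q b)).form (D.tensorF hq hs b ⟨i, m⟩ *ᵥ x)
      (D.tensorF hq hs b ⟨i, m'⟩ *ᵥ y) =
    D.ε i * (tensor s (simple q (D.c i)) (simple q b)).form
      (tensorMor hq hs (show (m : ℕ) ≤ D.c i by omega) (show (m : ℕ) ≤ b by omega) *ᵥ x)
      (tensorMor hq hs (show (m' : ℕ) ≤ D.c i by omega) (show (m' : ℕ) ≤ b by omega) *ᵥ y) := by
  rw [tensor_form_mulVec, tensor_form_mulVec]
  have h := tensor_pairing hq s (simple q b) (f' := D.f i) (D.mem i)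
    (g' := tensorMor hq hs (show (m' : ℕ) ≤ D.c i by omega) (show (m' : ℕ) ≤ b by omega))
    (monodromy_mul_tensorMor hq hs (show (m : ℕ) ≤ D.c i by omega) (show (m : ℕ) ≤ b by omega))
  rw [D.pairing_self hq, Matrix.smul_kronecker, Matrix.mul_smul, Matrix.smul_mul] at h
  refine (congrArg (fun M => x ⬝ᵥ (M *ᵥ star y)) h).trans ?_
  simp only [Matrix.smul_mulVec, dotProduct_smul, smul_eq_mul, Matrix.mul_assoc]

/-- The decomposition of `T ⊗ V_b` induced by a decomposition of `T`. -/
noncomputable def tensor (hq : ∀ k : ℕ, 0 < k → q ^ k ≠ 1) {s : Circle} (hs : s ^ 2 = q)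
    (D : Decomp T) (b : ℕ) : Decomp (tensor s T (simple q b)) where
  I := Σ i : D.I, Fin (min (D.c i) b + 1)
  c := fun p => D.c p.1 + b - 2 * p.2
  ε := fun p => D.ε p.1 * hwNorm q (D.c p.1) b p.2
  f := D.tensorF hq hs b
  contra := tensor_isContravariant hq hs D.contra (simple_isContravariant hq b)
  mem := D.tensorF_mem hq hs b
  ε_ne := fun p => mul_ne_zero (D.ε_ne p.1) (hwNorm_ne_zero hq (by omega) (by omega))
  form_self := by
    rintro ⟨i, m⟩
    rw [form_tensorF_same, form_tensorMor, Complex.ofReal_mul]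
  form_ne := by
    rintro ⟨i, m⟩ ⟨j, m'⟩ hne
    by_cases hij : i = j
    · subst hij
      -- Within one V_(c_i) ⊗ V_b the summands have different highest weights.
      refine form_highest_of_ne hq (tensor_isContravariant hq hs D.contra
        (simple_isContravariant hq b)) ?_ (D.tensorF_mem hq hs b _) (D.tensorF_mem hq hs b _)
      have : (m : ℕ) ≠ m' := fun h => hne (by rw [Fin.ext h])
      simp only
      omega
    · exact D.form_tensorF_ne hq hs b hij m m' _ _
  span := D.tensorF_span hq hs b

/-- The images of the embeddings are eigenspaces that span, and on each the exponents 2k, -k, -k of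
s cancel. -/
theorem invSqrt_sq_mul (hq : ∀ k : ℕ, 0 < k → q ^ k ≠ 1) {s : Circle} (hs : s ^ 2 = q)
    (D : Decomp T) (b : ℕ) :
    invSqrt q s (monodromy s T (simple q b)) ^ 2 * monodromy s T (simple q b) = 1 := by
  refine Matrix.ext_iff_mulVec.2 fun x => ?_
  obtain ⟨y, hy⟩ := D.tensorF_span hq hs b x
  rw [hy, Matrix.mulVec_sum, Matrix.one_mulVec]
  refine Finset.sum_congr rfl fun p _ => ?_
  have h := D.monodromy_mul_tensorF hq hs b p
  have h' := invSqrt_mul hq s h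
  rw [Matrix.mulVec_mulVec, pow_two, Matrix.mul_assoc, h, Matrix.mul_smul, Matrix.mul_assoc, h',
    Matrix.mul_smul, h', smul_smul, smul_smul, coe_zpow_eq hs, ← zpow_add₀ s.coe_ne_zero,
    ← zpow_add₀ s.coe_ne_zero]
  rw [show 2 * monodromyExp (D.c p.1) b p.2 + -monodromyExp (D.c p.1) b p.2 +
    -monodromyExp (D.c p.1) b p.2 = 0 by ring, zpow_zero, one_smul]

/-- The decomposition of a simple module. -/
noncomputable def ofSimple (hq : ∀ k : ℕ, 0 < k → q ^ k ≠ 1) (a : ℕ) : Decomp (simple q a) where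
  I := Unit
  c := fun _ => a
  ε := fun _ => 1
  f := fun _ => 1
  contra := simple_isContravariant hq a
  mem := fun _ => by
    refine ⟨?_, ?_, ?_⟩ <;> rw [Matrix.one_mul, Matrix.mul_one]
  ε_ne := fun _ => one_ne_zero
  form_self := by
    intro _
    -- For the identity morphism this says that the Gram matrix is (v_0, v_0) times itself. Its
    -- entry at (0, 0) is 1, which gives the norm.
    have h := pairing_same hq (simple_isContravariant hq a)
      (f := (1 : Matrix (simple q a).ι (simple q a).ι ℂ))
      (g := (1 : Matrix (simple q a).ι (simple q a).ι ℂ))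
      (by refine ⟨?_, ?_, ?_⟩ <;> rw [Matrix.one_mul, Matrix.mul_one])
      (by refine ⟨?_, ?_, ?_⟩ <;> rw [Matrix.one_mul, Matrix.mul_one])
    rw [map_star_one, Matrix.transpose_one, one_mul, mul_one] at h
    have h1 : (simple q a).gram (0 : Fin (a + 1)) (0 : Fin (a + 1)) = 1 := by
      refine (Matrix.diagonal_apply_eq _ _).trans ?_
      simp
    have h2 : (simple q a).gram (0 : Fin (a + 1)) (0 : Fin (a + 1)) =
        _ * (simple q a).gram (0 : Fin (a + 1)) (0 : Fin (a + 1)) :=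
      congrFun (congrFun h (0 : Fin (a + 1))) (0 : Fin (a + 1))
    rw [h1, mul_one] at h2
    rw [Complex.ofReal_one]
    exact h2.symm
  form_ne := fun i j hij => absurd (Subsingleton.elim i j) hij
  span := fun x => ⟨fun _ => x, by simp⟩

end Decomp

/-! ### Signatures of diagonal forms -/

section Signature

variable {X S : Type} [AddCommGroup X] [Module ℂ X] [Fintype S] {e : X ≃ₗ[ℂ] (S → ℂ)}
  {ε : S → ℝ}

/-- The projection to the coordinates satisfying `p`. -/
noncomputable def coordProj (e : X ≃ₗ[ℂ] (S → ℂ)) (p : S → Prop) : X →ₗ[ℂ] ({i // p i} → ℂ) :=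
  LinearMap.funLeft ℂ ℂ (Subtype.val : {i // p i} → S) ∘ₗ e.toLinearMap

theorem finrank_ker_coordProj (e : X ≃ₗ[ℂ] (S → ℂ)) (p : S → Prop) [DecidablePred p] :
    Module.finrank ℂ (LinearMap.ker (coordProj e fun i => ¬ p i)) = Fintype.card {i // p i} := by
  have : Module.Finite ℂ X := Module.Finite.equiv e.symm
  have h1 := LinearMap.finrank_range_add_finrank_ker (coordProj e fun i => ¬ p i)
  have h2 : LinearMap.range (coordProj e fun i => ¬ p i) = ⊤ := by
    rw [LinearMap.range_eq_top]
    exact (LinearMap.funLeft_surjective_of_injective ℂ ℂ _ Subtype.val_injective).comp e.surjective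
  rw [h2, finrank_top, Module.finrank_fintype_fun_eq_card, e.finrank_eq,
    Module.finrank_fintype_fun_eq_card] at h1
  have h3 := Fintype.card_subtype_compl p
  have h4 := Fintype.card_subtype_le p
  omega

/-- Sylvester's law: the span of the positive coordinates attains the maximum, and a positive
definite subspace meets the span of the other coordinates only in 0, hence projects injectively to
the positive ones. The real function `Q` can be replaced by -Q to treat negative definite subspaces.
-/
theorem isGreatest_finrank_of_pos (e : X ≃ₗ[ℂ] (S → ℂ)) (ε : S → ℝ) {Q : X → ℝ}
    (hQ : ∀ x, Q x = ∑ i, ε i * Complex.normSq (e x i)) :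
    IsGreatest {d : ℕ | ∃ W : Submodule ℂ X, Module.finrank ℂ W = d ∧ ∀ w ∈ W, w ≠ 0 → 0 < Q w}
      (Fintype.card {i // 0 < ε i}) := by
  have : Module.Finite ℂ X := Module.Finite.equiv e.symm
  constructor
  · refine ⟨_, finrank_ker_coordProj e fun i => 0 < ε i, fun w hw hw0 => ?_⟩
    have h1 : ∀ i, ¬ 0 < ε i → e w i = 0 := fun i hi => congrFun (LinearMap.mem_ker.1 hw) ⟨i, hi⟩
    rw [hQ]
    refine Finset.sum_pos' (fun i _ => ?_) ?_
    · by_cases hi : 0 < ε i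
      · exact mul_nonneg hi.le (Complex.normSq_nonneg _)
      · simp [h1 i hi]
    · obtain ⟨i, hi⟩ : ∃ i, e w i ≠ 0 := by
        by_contra! hne
        exact hw0 (e.map_eq_zero_iff.1 (funext hne))
      have hpos : 0 < ε i := by
        by_contra h
        exact hi (h1 i h)
      exact ⟨i, Finset.mem_univ i, mul_pos hpos (Complex.normSq_pos.2 hi)⟩
  · rintro d ⟨W, rfl, hW⟩
    have hinj : Function.Injective (coordProj e (fun i => 0 < ε i) ∘ₗ W.subtype) := by
      rw [injective_iff_map_eq_zero]
      rintro ⟨w, hw⟩ h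
      by_contra hne
      have hw0 : w ≠ 0 := fun h => hne (by simp [h])
      have h1 : ∀ i, 0 < ε i → e w i = 0 := fun i hi => congrFun h ⟨i, hi⟩
      have h2 := hW w hw hw0
      rw [hQ] at h2
      refine absurd h2 (not_lt.2 (Finset.sum_nonpos fun i _ => ?_))
      by_cases hi : 0 < ε i
      · simp [h1 i hi]
      · exact mul_nonpos_of_nonpos_of_nonneg (not_lt.1 hi) (Complex.normSq_nonneg _)
    have := LinearMap.finrank_le_finrank_of_injective hinj
    rwa [Module.finrank_fintype_fun_eq_card] at this

theorem signature_eq_sum_sign (e : X ≃ₗ[ℂ] (S → ℂ)) (ε : S → ℝ) {h : X → X → ℂ}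
    (hh : ∀ x, (h x x).re = ∑ i, ε i * Complex.normSq (e x i)) :
    signature h = ∑ i, (SignType.sign (ε i) : ℤ) := by
  have h1 := (isGreatest_finrank_of_pos e ε (Q := fun x => (h x x).re) hh).csSup_eq
  have h2 := (isGreatest_finrank_of_pos e (fun i => -ε i) (Q := fun x => -(h x x).re)
    (fun x => by simp [hh])).csSup_eq
  simp only [Left.neg_pos_iff] at h2
  rw [signature, h1, h2, Fintype.card_subtype, Fintype.card_subtype, Finset.card_filter,
    Finset.card_filter]
  push_cast
  rw [← Finset.sum_sub_distrib]
  refine Finset.sum_congr rfl fun i _ => ?_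
  rcases lt_trichotomy (ε i) 0 with hi | hi | hi
  · simp [hi, hi.not_gt]
  · simp [hi]
  · simp [hi, hi.not_gt]

end Signature

/-! ### Consequences of a decomposition -/

theorem simple_form_star (q : Circle) (c : ℕ) (x y : (simple q c).ι → ℂ) :
    (simple q c).form y x = star ((simple q c).form x y) := by
  have h : ∀ x y : Fin (c + 1) → ℂ,
      x ⬝ᵥ ((Matrix.diagonal fun i : Fin (c + 1) => qBinom q c i) *ᵥ star y) =
        ∑ i : Fin (c + 1), x i * (qBinom q c i * star (y i)) := fun x y =>
    Finset.sum_congr rfl fun i _ => by rw [Matrix.mulVec_diagonal, Pi.star_apply]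
  have h' : ∀ x y : Fin (c + 1) → ℂ, ∑ i : Fin (c + 1), y i * (qBinom q c i * star (x i)) =
      star (∑ i : Fin (c + 1), x i * (qBinom q c i * star (y i))) := by
    intro x y
    rw [star_sum]
    refine Finset.sum_congr rfl fun i _ => ?_
    have h1 : star (qBinom q c i) = qBinom q c i := conj_qBinom q c i
    rw [star_mul', star_mul', star_star, h1]
    ring
  exact (h y x).trans ((h' x y).trans (congrArg star (h x y)).symm)

theorem eq_smul_highest_of_E_mulVec (hq : ∀ k : ℕ, 0 < k → q ^ k ≠ 1) {c : ℕ}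
    {x : (simple q c).ι → ℂ} (h : (simple q c).E *ᵥ x = 0) :
    x = x (0 : Fin (c + 1)) • highest q c := by
  funext (i : Fin (c + 1))
  have h1 : highest q c i = if (i : ℕ) = 0 then 1 else 0 := congrFun (highest_eq q c) i
  refine Eq.trans ?_ (congrArg (fun z => x (0 : Fin (c + 1)) * z) h1).symm
  by_cases hi : (i : ℕ) = 0
  · have : i = 0 := Fin.ext hi
    simp [this]
  · rw [if_neg hi, mul_zero]
    have h2 := simpleE_mulVec_of_lt q c x ⟨i - 1, by omega⟩ (by simp only; omega)
    have h3 : (simpleE q c *ᵥ x) ⟨i - 1, by omega⟩ = 0 := congrFun h _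
    rw [h3] at h2
    have h4 := (mul_eq_zero.1 h2.symm).resolve_left (qInt_ne_zero hq (by simp only; omega))
    have h5 : (⟨(i : ℕ) - 1 + 1, by omega⟩ : Fin (c + 1)) = i := Fin.ext (by simp only; omega)
    exact (congrArg x h5.symm).trans h4

namespace Decomp

variable {T : QMod q}

theorem form_sum (hq : ∀ k : ℕ, 0 < k → q ^ k ≠ 1) (D : Decomp T)
    (x y : ∀ i, (simple q (D.c i)).ι → ℂ) :
    T.form (∑ i, D.f i *ᵥ x i) (∑ i, D.f i *ᵥ y i) =
      ∑ i, (simple q (D.c i)).form (x i) (y i) * D.ε i := by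
  rw [T.form_sum_left]
  refine Finset.sum_congr rfl fun i _ => ?_
  rw [T.form_sum_right, Finset.sum_eq_single i]
  · rw [form_mulVec_eq_mul hq D.contra (D.mem i) (D.mem i), D.form_self]
  · exact fun j _ hj => form_eq_zero hq D.contra (D.mem i) (D.mem j) (D.form_ne i j hj.symm) _ _
  · simp

theorem eq_zero_of_sum (hq : ∀ k : ℕ, 0 < k → q ^ k ≠ 1) (D : Decomp T)
    {y : ∀ i, (simple q (D.c i)).ι → ℂ} (h : ∑ i, D.f i *ᵥ y i = 0) : y = 0 :=
  eq_zero_of_sum_mulVec_eq_zero hq D.contra D.mem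
    (fun i => by rw [D.form_self]; exact_mod_cast D.ε_ne i) D.form_ne h

/-- Symmetry is not apparent from the Gram matrix, which involves the unitarized R-matrix. It comes
from the decomposition, where the form is a sum of Shapovalov forms with real weights ε_i. -/
theorem form_star (hq : ∀ k : ℕ, 0 < k → q ^ k ≠ 1) (D : Decomp T) (x y : T.ι → ℂ) :
    T.form y x = star (T.form x y) := by
  obtain ⟨x, rfl⟩ := D.span x
  obtain ⟨y, rfl⟩ := D.span y
  rw [D.form_sum hq, D.form_sum hq, star_sum]
  refine Finset.sum_congr rfl fun i _ => ?_
  have h : star (D.ε i : ℂ) = D.ε i := Complex.conj_ofReal _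
  rw [star_mul', simple_form_star q _ (x i), h]

theorem eq_zero_of_form (hq : ∀ k : ℕ, 0 < k → q ^ k ≠ 1) (D : Decomp T) {x : T.ι → ℂ}
    (h : ∀ y, T.form x y = 0) : x = 0 := by
  obtain ⟨x, rfl⟩ := D.span x
  have hx : x = 0 := by
    funext j
    refine simple_form_eq_zero hq fun z => ?_
    have h1 := h (D.f j *ᵥ z)
    rw [T.form_sum_left, Finset.sum_eq_single j] at h1
    · rw [form_mulVec_eq_mul hq D.contra (D.mem j) (D.mem j), D.form_self] at h1
      exact (mul_eq_zero.1 h1).resolve_right (by exact_mod_cast D.ε_ne j)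
    · exact fun i _ hij => form_eq_zero hq D.contra (D.mem i) (D.mem j) (D.form_ne i j hij) _ _
    · simp
  simp [hx]

theorem card_eq (hq : ∀ k : ℕ, 0 < k → q ^ k ≠ 1) (D : Decomp T) :
    Fintype.card T.ι = ∑ i, (D.c i + 1) := by
  let L : (∀ i, (simple q (D.c i)).ι → ℂ) →ₗ[ℂ] (T.ι → ℂ) :=
    ∑ i, (D.f i).mulVecLin ∘ₗ LinearMap.proj i
  have hL : ∀ y, L y = ∑ i, D.f i *ᵥ y i := fun y => by simp [L]
  have hbij : Function.Bijective L := by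
    constructor
    · rw [injective_iff_map_eq_zero]
      intro y hy
      rw [hL] at hy
      exact D.eq_zero_of_sum hq hy
    · intro x
      obtain ⟨y, rfl⟩ := D.span x
      exact ⟨y, hL y⟩
  have h := (LinearEquiv.ofBijective L hbij).finrank_eq
  rw [Module.finrank_pi_fintype, Module.finrank_fintype_fun_eq_card] at h
  rw [← h]
  refine Finset.sum_congr rfl fun i _ => ?_
  rw [Module.finrank_fintype_fun_eq_card]
  exact Fintype.card_fin _

/-- The morphism `f i`, seen as an element of the multiplicity space of `V_c` with `c = c_i`. -/
def morphism (D : Decomp T) {c : ℕ} (i : {i // D.c i = c}) : Mult (simple q c) T :=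
  i.2 ▸ ⟨D.f i, D.mem i⟩

theorem morphism_mulVec_highest (D : Decomp T) {c : ℕ} (i : {i // D.c i = c}) :
    (D.morphism i).1 *ᵥ highest q c = D.f i *ᵥ highest q (D.c i) := by
  obtain ⟨i, rfl⟩ := i
  rfl

theorem exists_morphism_mulVec (D : Decomp T) {c : ℕ} (i : {i // D.c i = c})
    (x : (simple q (D.c i)).ι → ℂ) :
    ∃ (g : Mult (simple q c) T) (y : (simple q c).ι → ℂ), g.1 *ᵥ y = D.f i *ᵥ x := by
  obtain ⟨i, rfl⟩ := i
  exact ⟨⟨D.f i, D.mem i⟩, x, rfl⟩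

theorem multForm_morphism (D : Decomp T) {c : ℕ} (i j : {i // D.c i = c}) :
    multForm (D.morphism i) (D.morphism j) = if i = j then (D.ε i : ℂ) else 0 := by
  rw [multForm, D.morphism_mulVec_highest, D.morphism_mulVec_highest]
  by_cases h : i = j
  · subst h
    rw [D.form_self, if_pos rfl]
  · rw [D.form_ne _ _ (fun h' => h (Subtype.ext h')), if_neg h]

theorem multForm_sum_smul_left {α : Type*} {c : ℕ} (t : Finset α) (r : α → ℂ)
    (g : α → Mult (simple q c) T) (g' : Mult (simple q c) T) :
    multForm (∑ i ∈ t, r i • g i) g' = ∑ i ∈ t, r i * multForm (g i) g' := by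
  simp only [multForm]
  rw [AddSubmonoidClass.coe_finsetSum, Matrix.sum_mulVec, T.form_sum_left]
  refine Finset.sum_congr rfl fun i _ => ?_
  rw [Submodule.coe_smul, Matrix.smul_mulVec, T.form_smul_left]

theorem multForm_sum_smul_right {α : Type*} {c : ℕ} (t : Finset α) (r : α → ℂ)
    (g' : Mult (simple q c) T) (g : α → Mult (simple q c) T) :
    multForm g' (∑ i ∈ t, r i • g i) = ∑ i ∈ t, star (r i) * multForm g' (g i) := by
  simp only [multForm]
  rw [AddSubmonoidClass.coe_finsetSum, Matrix.sum_mulVec, T.form_sum_right]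
  refine Finset.sum_congr rfl fun i _ => ?_
  rw [Submodule.coe_smul, Matrix.smul_mulVec, T.form_smul_right]

/-- Independence of the summands passes the equations for E and K on g v_0 to each component. Such a
component is a multiple of the highest weight vector, and it vanishes unless c_i = c. -/
theorem exists_eq_sum_morphism (hq : ∀ k : ℕ, 0 < k → q ^ k ≠ 1) (D : Decomp T) {c : ℕ}
    (g : Mult (simple q c) T) : ∃ r : {i // D.c i = c} → ℂ, g = ∑ i, r i • D.morphism i := by
  obtain ⟨x, hx⟩ := D.span (g.1 *ᵥ highest q c)
  have hE := Mult.E_mulVec_highest g.2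
  have hK := Mult.K_mulVec_highest g.2
  rw [hx, Matrix.mulVec_sum] at hE hK
  have h1 : ∀ i, (simple q (D.c i)).E *ᵥ x i = 0 := by
    refine congrFun (D.eq_zero_of_sum hq (y := fun i => (simple q (D.c i)).E *ᵥ x i) ?_)
    rw [← hE]
    refine Finset.sum_congr rfl fun i _ => ?_
    rw [Matrix.mulVec_mulVec, Matrix.mulVec_mulVec, Mult.E_comm (D.mem i)]
  have h2 : ∀ i, (simple q (D.c i)).K *ᵥ x i - (q : ℂ) ^ (c : ℤ) • x i = 0 := by
    refine congrFun (D.eq_zero_of_sum hq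
      (y := fun i => (simple q (D.c i)).K *ᵥ x i - (q : ℂ) ^ (c : ℤ) • x i) ?_)
    rw [← sub_eq_zero, Finset.smul_sum, ← Finset.sum_sub_distrib] at hK
    rw [← hK]
    refine Finset.sum_congr rfl fun i _ => ?_
    rw [Matrix.mulVec_sub, Matrix.mulVec_smul, Matrix.mulVec_mulVec, Matrix.mulVec_mulVec,
      Mult.K_comm (D.mem i)]
  have h3 := fun i => eq_smul_highest_of_E_mulVec hq (h1 i)
  set r : D.I → ℂ := fun i => x i (0 : Fin (D.c i + 1)) with hr
  have h4 : ∀ i, D.c i ≠ c → r i = 0 := by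
    intro i hi
    have h5 := h2 i
    rw [h3 i, Matrix.mulVec_smul, highest_eq, simple_K_mulVec, smul_comm, ← sub_smul,
      smul_eq_zero] at h5
    rcases h5 with h5 | h5
    · rw [sub_eq_zero, zpow_inj hq] at h5
      exact absurd (by push_cast at h5; omega) hi
    · have h6 : x i (0 : Fin (D.c i + 1)) * highest q (D.c i) (0 : Fin (D.c i + 1)) = 0 := by
        rw [highest_eq]
        exact congrFun h5 (0 : Fin (D.c i + 1))
      have h7 : highest q (D.c i) (0 : Fin (D.c i + 1)) = 1 :=
        Pi.single_eq_same (M := fun _ : Fin (D.c i + 1) => ℂ) 0 1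
      rwa [h7, mul_one] at h6
  refine ⟨fun i => r i, Subtype.ext (Mult.ext_highest hq g.2 (Submodule.coe_mem _) ?_)⟩
  rw [hx, AddSubmonoidClass.coe_finsetSum, Matrix.sum_mulVec]
  have h5 : ∀ i : {i // D.c i = c}, (r i • D.morphism i : Mult (simple q c) T).1 *ᵥ highest q c =
      D.f i *ᵥ x i := by
    intro i
    rw [Submodule.coe_smul, Matrix.smul_mulVec, D.morphism_mulVec_highest, h3 i,
      Matrix.mulVec_smul]
  rw [Finset.sum_congr rfl fun i _ => h5 i,
    ← Finset.sum_filter_of_ne (s := Finset.univ) (p := fun i => D.c i = c)]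
  · exact Finset.sum_subtype _ (fun i => by simp) _
  · intro i _ hi
    by_contra hc
    refine hi ?_
    have h6 : x i (0 : Fin (D.c i + 1)) = 0 := h4 i hc
    rw [h3 i, h6, zero_smul, Matrix.mulVec_zero]

end Decomp

/-- The domain is assumed to be only an additive monoid, to fit the direct sum in `decompMap`.
Multiplication by -1 supplies the negatives. -/
theorem bijective_of_surjective_of_finrank_eq {V W : Type*} [AddCommMonoid V] [Module ℂ V]
    [Module.Finite ℂ V] [AddCommGroup W] [Module ℂ W] [Module.Finite ℂ W]
    (h : Module.finrank ℂ V = Module.finrank ℂ W) {f : V →ₗ[ℂ] W} (hf : Function.Surjective f) :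
    Function.Bijective f := by
  let := Module.addCommMonoidToAddCommGroup ℂ (M := V)
  exact ⟨(LinearMap.injective_iff_surjective_of_finrank_eq_finrank h).2 hf, hf⟩

/-! ### Bases and signatures of the multiplicity spaces, and the evaluation isomorphism -/

namespace Decomp

variable {T : QMod q}

/-- The linear combinations of the morphisms `f i` with `c_i = c`. -/
noncomputable def multMap (D : Decomp T) (c : ℕ) :
    ({i // D.c i = c} → ℂ) →ₗ[ℂ] Mult (simple q c) T :=
  Fintype.linearCombination ℂ fun i => D.morphism i

theorem multMap_apply (D : Decomp T) (c : ℕ) (r : {i // D.c i = c} → ℂ) :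
    D.multMap c r = ∑ i, r i • D.morphism i :=
  Fintype.linearCombination_apply ℂ _ r

/-- The multiplicity space of `V_c` has the morphisms `f i` with `c_i = c` as a basis. -/
noncomputable def multEquiv (hq : ∀ k : ℕ, 0 < k → q ^ k ≠ 1) (D : Decomp T) (c : ℕ) :
    ({i // D.c i = c} → ℂ) ≃ₗ[ℂ] Mult (simple q c) T :=
  LinearEquiv.ofBijective (D.multMap c) (by
    constructor
    · rw [injective_iff_map_eq_zero]
      intro r hr
      funext j
      -- Pairing a combination with the j-th morphism isolates r_j ε_j, and ε_j is nonzero.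
      have h : multForm (∑ i, r i • D.morphism i) (D.morphism j) = 0 := by
        have h0 : ∑ i, r i • D.morphism i = 0 := by rw [← multMap_apply, hr]
        rw [h0]
        change T.form ((0 : Matrix T.ι (simple q c).ι ℂ) *ᵥ _) _ = 0
        rw [Matrix.zero_mulVec, T.form_zero_left]
      rw [multForm_sum_smul_left, Finset.sum_eq_single j] at h
      · rw [multForm_morphism, if_pos rfl] at h
        exact (mul_eq_zero.1 h).resolve_right (by exact_mod_cast D.ε_ne j)
      · intro i _ hij
        rw [multForm_morphism, if_neg hij, mul_zero]
      · simp
    · intro g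
      obtain ⟨r, rfl⟩ := D.exists_eq_sum_morphism hq g
      exact ⟨r, D.multMap_apply c r⟩)

theorem multEquiv_apply (hq : ∀ k : ℕ, 0 < k → q ^ k ≠ 1) (D : Decomp T) (c : ℕ)
    (r : {i // D.c i = c} → ℂ) : D.multEquiv hq c r = ∑ i, r i • D.morphism i :=
  D.multMap_apply c r

theorem finrank_Mult (hq : ∀ k : ℕ, 0 < k → q ^ k ≠ 1) (D : Decomp T) (c : ℕ) :
    Module.finrank ℂ (Mult (simple q c) T) = Fintype.card {i // D.c i = c} := by
  rw [← (D.multEquiv hq c).finrank_eq, Module.finrank_fintype_fun_eq_card]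

theorem signature_multForm (hq : ∀ k : ℕ, 0 < k → q ^ k ≠ 1) (D : Decomp T) (c : ℕ) :
    signature (fun f g : Mult (simple q c) T => multForm f g) =
      ∑ i with D.c i = c, (SignType.sign (D.ε i) : ℤ) := by
  rw [signature_eq_sum_sign (D.multEquiv hq c).symm fun i => D.ε i]
  · exact (Finset.sum_subtype (Finset.univ.filter fun i => D.c i = c) (fun i => by simp)
      fun i => (SignType.sign (D.ε i) : ℤ)).symm
  · intro x
    obtain ⟨r, rfl⟩ := (D.multEquiv hq c).surjective x
    simp only [LinearEquiv.symm_apply_apply]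
    rw [multEquiv_apply, multForm_sum_smul_left, Complex.re_sum]
    refine Finset.sum_congr rfl fun i _ => ?_
    rw [multForm_sum_smul_right, Finset.sum_eq_single i]
    · rw [multForm_morphism, if_pos rfl, ← mul_assoc]
      have h : r i * star (r i) = (Complex.normSq (r i) : ℂ) := Complex.mul_conj _
      rw [h, ← Complex.ofReal_mul, Complex.ofReal_re, mul_comm]
    · intro j _ hj
      rw [multForm_morphism, if_neg hj.symm, mul_zero]
    · simp

theorem multForm_star (hq : ∀ k : ℕ, 0 < k → q ^ k ≠ 1) (D : Decomp T) {c : ℕ}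
    (f g : Mult (simple q c) T) : multForm g f = star (multForm f g) :=
  D.form_star hq _ _

theorem eq_zero_of_multForm (hq : ∀ k : ℕ, 0 < k → q ^ k ≠ 1) (D : Decomp T) {c : ℕ}
    {f : Mult (simple q c) T} (h : ∀ g, multForm f g = 0) : f = 0 := by
  obtain ⟨r, rfl⟩ := (D.multEquiv hq c).surjective f
  have hr : r = 0 := by
    funext j
    have h1 := h (D.morphism j)
    rw [multEquiv_apply, multForm_sum_smul_left, Finset.sum_eq_single j] at h1
    · rw [multForm_morphism, if_pos rfl] at h1
      exact (mul_eq_zero.1 h1).resolve_right (by exact_mod_cast D.ε_ne j)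
    · intro i _ hij
      rw [multForm_morphism, if_neg hij, mul_zero]
    · simp
  rw [hr, map_zero]

theorem decompMap_lof (T : QMod q) (A : ℕ) (m : Fin (A / 2 + 1))
    (x : (simple q (A - 2 * m)).ι → ℂ) (f : Mult (simple q (A - 2 * m)) T) :
    decompMap T A (DirectSum.lof ℂ _ (fun m : Fin (A / 2 + 1) =>
      (((simple q (A - 2 * m)).ι → ℂ) ⊗[ℂ] Mult (simple q (A - 2 * m)) T)) m (x ⊗ₜ f)) =
      f.1 *ᵥ x := by
  rw [decompMap, DirectSum.toModule_lof, TensorProduct.lift.tmul]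
  rfl

/-- Each image of V_(c_i) lies in the image of one isotypic summand, which gives surjectivity. The
hypothesis `hA` places every i at exactly one level m ≤ A/2, so both sides have dimension equal to
the sum of the c_i + 1. -/
theorem decompMap_bijective (hq : ∀ k : ℕ, 0 < k → q ^ k ≠ 1) (D : Decomp T) {A : ℕ}
    (hA : ∀ i, ∃ m, D.c i + 2 * m = A) : Function.Bijective (decompMap T A) := by
  have hfin : ∀ m : Fin (A / 2 + 1), Module.Finite ℂ
      (((simple q (A - 2 * m)).ι → ℂ) ⊗[ℂ] Mult (simple q (A - 2 * m)) T) := fun m => inferInstance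
  have hsurj : Function.Surjective (decompMap T A) := by
    intro x
    obtain ⟨y, rfl⟩ := D.span x
    rw [← LinearMap.mem_range]
    refine Submodule.sum_mem _ fun i _ => ?_
    obtain ⟨m, hm⟩ := hA i
    obtain ⟨g, z, hz⟩ := D.exists_morphism_mulVec (c := A - 2 * m) ⟨i, by omega⟩ (y i)
    rw [← hz]
    exact ⟨_, decompMap_lof T A ⟨m, by omega⟩ z g⟩
  refine bijective_of_surjective_of_finrank_eq ?_ hsurj
  rw [Module.finrank_directSum, Module.finrank_fintype_fun_eq_card, D.card_eq hq]
  have h1 : ∀ m : Fin (A / 2 + 1), Module.finrank ℂ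
      (((simple q (A - 2 * m)).ι → ℂ) ⊗[ℂ] Mult (simple q (A - 2 * m)) T) =
      ∑ i with D.c i = A - 2 * m, (D.c i + 1) := by
    intro m
    rw [Module.finrank_tensorProduct, Module.finrank_fintype_fun_eq_card, D.finrank_Mult hq,
      Finset.sum_congr rfl fun i hi => congrArg (· + 1) (Finset.mem_filter.1 hi).2,
      Finset.sum_const, smul_eq_mul, Fintype.card_subtype, mul_comm]
    exact congrArg _ (Fintype.card_fin _)
  rw [Finset.sum_congr rfl fun m _ => h1 m]
  simp only [Finset.sum_filter]
  rw [Finset.sum_comm]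
  refine Finset.sum_congr rfl fun i _ => ?_
  obtain ⟨m, hm⟩ := hA i
  rw [Finset.sum_eq_single (⟨m, by omega⟩ : Fin (A / 2 + 1))]
  · rw [if_pos (by simp only; omega)]
  · intro m' _ hne
    have : (m' : ℕ) ≠ m := fun h => hne (Fin.ext h)
    exact if_neg (by omega)
  · simp

end Decomp

/-! ### The sign formula -/

/-- The sign of the square norm of the highest weight vector of `V_{a+b-2m} ⊂ V_a ⊗ V_b`. -/
noncomputable def pairSign (q : Circle) (a b : ℤ) (m : ℕ) : ℤ :=
  csign (qBinom q (1 + (a + b) - m) m * qBinom q a m * qBinom q b m)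

theorem signFormula_one (q : Circle) (a : ℕ → ℕ) (m : ℕ) :
    signFormula q a 1 m = if m = 0 then 1 else 0 := by
  rw [signFormula, show Finset.Icc 1 (1 - 1) = ∅ from rfl, Finset.piAntidiag_empty]
  split_ifs <;> simp

/-- Splits off the last part m_(n+1) = p.1 of the composition. The preceding parts sum to p.2, so
the last factor depends on them only through p.2. -/
theorem signFormula_add_two (q : Circle) (a : ℕ → ℕ) (n m : ℕ) :
    signFormula q a (n + 2) m = ∑ p ∈ Finset.HasAntidiagonal.antidiagonal m,
      signFormula q a (n + 1) p.2 *
        pairSign q ((∑ k ∈ Finset.Icc 1 (n + 1), (a k : ℤ)) - 2 * p.2) (a (n + 2)) p.1 := by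
  have hn : n + 1 ∉ Finset.Icc 1 n := by simp
  have hI : Finset.Icc 1 (n + 2 - 1) = Finset.cons (n + 1) (Finset.Icc 1 n) hn := by
    rw [Finset.cons_eq_insert]
    ext k
    simp only [Finset.mem_Icc, Finset.mem_insert]
    omega
  rw [signFormula, hI, Finset.piAntidiag_cons hn, Finset.sum_disjiUnion]
  refine Finset.sum_congr rfl fun p _ => ?_
  rw [Finset.sum_map, signFormula, Finset.sum_mul, show n + 1 - 1 = n from rfl]
  refine Finset.sum_congr rfl fun μ hμ => ?_
  rw [Finset.mem_piAntidiag] at hμ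
  have h0 : μ (n + 1) = 0 := by
    by_contra h
    exact hn (hμ.2 _ h)
  simp only [addRightEmbedding_apply]
  have h1 : ∀ k, k ≤ n → (μ + fun t => if t = n + 1 then p.1 else 0) k = μ k := by
    intro k hk
    simp [show k ≠ n + 1 by omega]
  have h2 : (μ + fun t => if t = n + 1 then p.1 else 0) (n + 1) = p.1 := by simp [h0]
  generalize (μ + fun t => if t = n + 1 then p.1 else 0) = ν at h1 h2 ⊢
  have h3 : ∀ j, j ≤ n → ∑ k ∈ Finset.Icc 1 j, (ν k : ℤ) = ∑ k ∈ Finset.Icc 1 j, (μ k : ℤ) :=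
    fun j hj => Finset.sum_congr rfl fun k hk => by
      rw [h1 k ((Finset.mem_Icc.1 hk).2.trans hj)]
  have h4 : ∑ k ∈ Finset.Icc 1 n, (μ k : ℤ) = p.2 := by
    rw [← hμ.1, Nat.cast_sum]
  have h5 : ∑ k ∈ Finset.Icc 1 (n + 2), (a k : ℤ) =
      ∑ k ∈ Finset.Icc 1 (n + 1), (a k : ℤ) + a (n + 2) :=
    Finset.sum_Icc_succ_top (by omega) _
  rw [Finset.prod_cons, mul_comm]
  refine congrArg₂ (· * ·) ?_ ?_
  · refine Finset.prod_congr rfl fun j hj => ?_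
    have hj' := (Finset.mem_Icc.1 hj).2
    rw [h1 j hj', h3 _ (by omega)]
  · rw [show n + 1 - 1 = n from rfl, h2, h3 n le_rfl, h4, h5, pairSign,
      show 1 + (∑ k ∈ Finset.Icc 1 (n + 1), (a k : ℤ) + a (n + 2)) - 2 * (p.2 : ℤ) - p.1 =
        1 + ((∑ k ∈ Finset.Icc 1 (n + 1), (a k : ℤ)) - 2 * p.2 + a (n + 2)) - p.1 by ring]

theorem pairSign_eq_zero {a b : ℤ} {m : ℕ} (h : qBinom q a m = 0 ∨ qBinom q b m = 0) :
    pairSign q a b m = 0 := by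
  rcases h with h | h <;> simp [pairSign, h, csign]

theorem signFormula_eq_zero (q : Circle) (a : ℕ → ℕ) (n m : ℕ)
    (h : ∑ k ∈ Finset.Icc 1 (n + 1), a k < 2 * m) : signFormula q a (n + 1) m = 0 := by
  induction n generalizing m with
  | zero => rw [signFormula_one, if_neg (by omega)]
  | succ n ih =>
    rw [signFormula_add_two]
    refine Finset.sum_eq_zero fun p hp => ?_
    rw [Finset.HasAntidiagonal.mem_antidiagonal] at hp
    rw [Finset.sum_Icc_succ_top (by omega)] at h
    by_cases h1 : ∑ k ∈ Finset.Icc 1 (n + 1), a k < 2 * p.2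
    · rw [ih _ h1, zero_mul]
    -- The remaining highest weight c is now nonnegative. This matters because a q-binomial with
    -- negative upper entry need not vanish. From c + a_(n+2) < 2 p.1 one of the two upper entries
    -- is smaller than p.1.
    · obtain ⟨c, hc⟩ := Nat.exists_eq_add_of_le (not_lt.1 h1)
      have h2 : (∑ k ∈ Finset.Icc 1 (n + 1), (a k : ℤ)) - 2 * p.2 = (c : ℕ) := by
        rw [← Nat.cast_sum, hc]
        push_cast
        ring
      rw [h2, pairSign_eq_zero, mul_zero]
      rcases lt_or_ge c p.1 with h3 | h3
      · exact Or.inl (qBinom_eq_zero q h3)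
      · refine Or.inr (qBinom_eq_zero q ?_)
        rw [show n + 1 + 1 = n + 2 from rfl] at h
        omega

/-- The norm contains a quotient by [a choose m] and the formula a product. They differ by the
square of that nonzero real number. -/
theorem sign_hwNorm (hq : ∀ k : ℕ, 0 < k → q ^ k ≠ 1) {a b m : ℕ} (ha : m ≤ a) :
    (SignType.sign (hwNorm q a b m) : ℤ) = pairSign q a b m := by
  have hre : ∀ x : ℤ, (((qBinom q x m).re : ℝ) : ℂ) = qBinom q x m := fun x =>
    Complex.conj_eq_iff_re.1 (conj_qBinom q x m)
  have h1 : hwNorm q a b m = (qBinom q b m).re / (qBinom q a m).re *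
      (qBinom q ((a : ℤ) + b + 1 - m) m).re := by
    refine Complex.ofReal_injective ?_
    rw [Complex.ofReal_mul, Complex.ofReal_div, hre, hre, hre, coe_hwNorm]
  have h2 : (qBinom q (1 + ((a : ℤ) + b) - m) m * qBinom q a m * qBinom q b m).re =
      (qBinom q b m).re * (qBinom q a m).re * (qBinom q ((a : ℤ) + b + 1 - m) m).re := by
    rw [← Complex.ofReal_re ((qBinom q b m).re * (qBinom q a m).re *
      (qBinom q ((a : ℤ) + b + 1 - m) m).re)]
    push_cast
    rw [hre, hre, hre, show 1 + ((a : ℤ) + b) - m = (a : ℤ) + b + 1 - m by ring]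
    ring_nf
  have ha0 : (qBinom q a m).re ≠ 0 := by
    intro h
    refine qBinom_ne_zero hq (x := a) (m := m) (by exact_mod_cast ha) ?_
    rw [← hre, h, Complex.ofReal_zero]
  have h3 : (qBinom q b m).re * (qBinom q a m).re * (qBinom q ((a : ℤ) + b + 1 - m) m).re =
      hwNorm q a b m * (qBinom q a m).re ^ 2 := by
    rw [h1]
    field_simp
  have h4 : 0 < (qBinom q a m).re ^ 2 := by positivity
  rw [pairSign, csign, h2, h3, sign_mul, sign_pos h4, mul_one]

/-! ### The recursion for the sign sums along the iterated tensor product -/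

namespace Decomp

variable {T : QMod q}

/-- A summand of level d in T contributes to level d + k of the product through V_(c_i+b-2k). Terms
with k > min(c_i, b) have no summand, and their sign is 0. Writing levels as c + 2m = A avoids
truncated subtraction. -/
theorem sum_sign_tensor (hq : ∀ k : ℕ, 0 < k → q ^ k ≠ 1) {s : Circle} (hs : s ^ 2 = q)
    (D : Decomp T) (b : ℕ) {A : ℕ} (hA : ∀ i, ∃ m, D.c i + 2 * m = A) (m : ℕ) :
    ∑ p with (D.tensor hq hs b).c p + 2 * m = A + b,
        (SignType.sign ((D.tensor hq hs b).ε p) : ℤ) =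
      ∑ p ∈ Finset.HasAntidiagonal.antidiagonal m,
        (∑ i with D.c i + 2 * p.2 = A, (SignType.sign (D.ε i) : ℤ)) *
          pairSign q ((A : ℤ) - 2 * p.2) b p.1 := by
  rw [Finset.sum_filter]
  refine (Fintype.sum_sigma _).trans ?_
  simp only [Finset.sum_filter, Finset.sum_mul]
  rw [Finset.sum_comm]
  refine Finset.sum_congr rfl fun i _ => ?_
  obtain ⟨d, hd⟩ := hA i
  change ∑ k : Fin (min (D.c i) b + 1), (if D.c i + b - 2 * (k : ℕ) + 2 * m = A + b then
    (SignType.sign (D.ε i * hwNorm q (D.c i) b k) : ℤ) else 0) = _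
  have hR : ∀ p ∈ Finset.HasAntidiagonal.antidiagonal m,
      (if D.c i + 2 * p.2 = A then (SignType.sign (D.ε i) : ℤ) else 0) *
        pairSign q ((A : ℤ) - 2 * p.2) b p.1 =
      if p.2 = d then (SignType.sign (D.ε i) : ℤ) * pairSign q (D.c i) b p.1 else 0 := by
    intro p _
    by_cases hp : p.2 = d
    · rw [if_pos (by omega), if_pos hp, show (A : ℤ) - 2 * p.2 = D.c i by omega]
    · rw [if_neg (by omega), if_neg hp, zero_mul]
  rw [Finset.sum_congr rfl hR]
  have hL : ∀ k : Fin (min (D.c i) b + 1),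
      (if D.c i + b - 2 * (k : ℕ) + 2 * m = A + b then
        (SignType.sign (D.ε i * hwNorm q (D.c i) b k) : ℤ) else 0) =
      if (k : ℕ) + d = m then (SignType.sign (D.ε i) : ℤ) * pairSign q (D.c i) b k else 0 := by
    intro k
    by_cases hk : (k : ℕ) + d = m
    · rw [if_pos (by omega), if_pos hk, sign_mul, ← sign_hwNorm hq (by omega)]
      push_cast
      rfl
    · rw [if_neg (by omega), if_neg hk]
  rw [Finset.sum_congr rfl fun k _ => hL k]
  by_cases hdm : d ≤ m
  · rw [Finset.sum_eq_single (m - d, d), if_pos rfl]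
    · by_cases hmin : m - d ≤ min (D.c i) b
      · rw [Finset.sum_eq_single (⟨m - d, by omega⟩ : Fin (min (D.c i) b + 1))]
        · exact if_pos (by simp only; omega)
        · intro k _ hk
          exact if_neg fun h => hk (Fin.ext (by simp only; omega))
        · simp
      · rw [pairSign_eq_zero, mul_zero]
        · exact Finset.sum_eq_zero fun k _ => if_neg (by omega)
        · rcases lt_or_ge (D.c i) (m - d) with h | h
          · exact Or.inl (qBinom_eq_zero q h)
          · exact Or.inr (qBinom_eq_zero q (by omega))
    · rintro ⟨k, l⟩ hp hne
      rw [Finset.HasAntidiagonal.mem_antidiagonal] at hp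
      refine if_neg fun h => hne ?_
      simp only at h hp
      rw [Prod.mk.injEq]
      omega
    · intro h
      rw [Finset.HasAntidiagonal.mem_antidiagonal] at h
      simp only at h
      omega
  · rw [Finset.sum_eq_zero fun k _ => if_neg (by omega), Finset.sum_eq_zero]
    intro p hp
    rw [Finset.HasAntidiagonal.mem_antidiagonal] at hp
    exact if_neg (by omega)

end Decomp

/-- The induction carries the condition that every c_i is A minus an even number, which assigns a
level to each summand and makes the sign recursion applicable at the next factor. -/
theorem exists_decomp_tensorProd (hq : ∀ k : ℕ, 0 < k → q ^ k ≠ 1) {s : Circle} (hs : s ^ 2 = q)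
    (a : ℕ → ℕ) (n : ℕ) : ∃ D : Decomp (tensorProd q s a (n + 1)),
      (∀ i, ∃ m, D.c i + 2 * m = ∑ k ∈ Finset.Icc 1 (n + 1), a k) ∧
      ∀ m, ∑ i with D.c i + 2 * m = ∑ k ∈ Finset.Icc 1 (n + 1), a k,
        (SignType.sign (D.ε i) : ℤ) = signFormula q a (n + 1) m := by
  induction n with
  | zero =>
    refine ⟨Decomp.ofSimple hq (a 1), fun _ => ⟨0, by simp [Decomp.ofSimple]⟩, fun m => ?_⟩
    rw [signFormula_one, Finset.sum_filter]
    refine (Fintype.sum_unique (ι := Unit) _).trans ?_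
    by_cases hm : m = 0
    · simp [hm, Decomp.ofSimple]
    · simp [hm, Decomp.ofSimple]
  | succ n ih =>
    obtain ⟨D, hA, hsum⟩ := ih
    refine ⟨D.tensor hq hs (a (n + 2)), ?_, fun m => ?_⟩
    · rintro ⟨i, k⟩
      obtain ⟨m, hm⟩ := hA i
      refine ⟨m + k, ?_⟩
      rw [Finset.sum_Icc_succ_top (by omega), ← hm]
      change D.c i + a (n + 2) - 2 * (k : ℕ) + 2 * (m + k) = D.c i + 2 * m + a (n + 2)
      omega
    · rw [Finset.sum_Icc_succ_top (by omega)]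
      refine (D.sum_sign_tensor hq hs _ hA m).trans ?_
      rw [signFormula_add_two]
      refine Finset.sum_congr rfl fun p _ => ?_
      rw [hsum, Nat.cast_sum]

end QSig

theorem theorem1p4 (q s : Circle) (hq : ∀ k : ℕ, 0 < k → q ^ k ≠ 1) (hs : s ^ 2 = q) :
    -- the two-factor formula
    (∀ a b m : ℕ, m ≤ a → m ≤ b →
      ∃ u : (QSig.tensor s (QSig.simple q a) (QSig.simple q b)).ι → ℂ,
        QSig.IsUnitHighest s a b m u ∧ (∀ u', QSig.IsUnitHighest s a b m u' → u' = u) ∧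
        (QSig.tensor s (QSig.simple q a) (QSig.simple q b)).form u u =
          QSig.qBinom q b m / QSig.qBinom q a m * QSig.qBinom q ((a : ℤ) + b + 1 - m) m) ∧
    -- arbitrary tensor products `T = V_{a 1} ⊗ ⋯ ⊗ V_{a n}`
    (∀ (n : ℕ) (a : ℕ → ℕ) (A : ℕ) (T : QSig.QMod q), 1 ≤ n → A = ∑ k ∈ Finset.Icc 1 n, a k →
      T = QSig.tensorProd q s a n →
      -- the inverse square root used to form `T ⊗ V_b` is one
      (∀ b : ℕ,
        QSig.invSqrt q s (QSig.R21Mat s T (QSig.simple q b) * QSig.RMat s T (QSig.simple q b)) ^ 2 *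
          (QSig.R21Mat s T (QSig.simple q b) * QSig.RMat s T (QSig.simple q b)) = 1) ∧
      -- the form on `T` is Hermitian, nondegenerate and contravariant
      (∀ x y, T.form y x = star (T.form x y)) ∧
      (∀ x, (∀ y, T.form x y = 0) → x = 0) ∧
      (∀ x y, T.form (T.E *ᵥ x) y = T.form x (T.F *ᵥ y) ∧
        T.form (T.F *ᵥ x) y = T.form x (T.E *ᵥ y) ∧
        T.form (T.K *ᵥ x) y = T.form x (T.Kinv *ᵥ y)) ∧
      -- `T` is the direct sum of its isotypic components `V_{A-2m} ⊗ Hom (V_{A-2m}, T)`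
      Function.Bijective (QSig.decompMap T A) ∧
      -- distinct isotypic components are orthogonal
      (∀ m m' : ℕ, 2 * m ≤ A → 2 * m' ≤ A → m ≠ m' →
        ∀ (f : QSig.Mult (QSig.simple q (A - 2 * m)) T)
          (g : QSig.Mult (QSig.simple q (A - 2 * m')) T)
          (x : (QSig.simple q (A - 2 * m)).ι → ℂ) (y : (QSig.simple q (A - 2 * m')).ι → ℂ),
          T.form (f.1 *ᵥ x) (g.1 *ᵥ y) = 0) ∧
      (∀ m : ℕ, 2 * m ≤ A →
        -- each isotypic component carries the product of the Shapovalov form and `multForm`,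
        (∀ (f g : QSig.Mult (QSig.simple q (A - 2 * m)) T)
            (x y : (QSig.simple q (A - 2 * m)).ι → ℂ),
          T.form (f.1 *ᵥ x) (g.1 *ᵥ y) =
            (QSig.simple q (A - 2 * m)).form x y * QSig.multForm f g) ∧
        -- which is a nondegenerate Hermitian form on the multiplicity space,
        (∀ f g : QSig.Mult (QSig.simple q (A - 2 * m)) T,
          QSig.multForm g f = star (QSig.multForm f g)) ∧
        (∀ f : QSig.Mult (QSig.simple q (A - 2 * m)) T, (∀ g, QSig.multForm f g = 0) → f = 0) ∧
        -- with the following signature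
        QSig.signature
            (fun f g : QSig.Mult (QSig.simple q (A - 2 * m)) T => QSig.multForm f g) =
          QSig.signFormula q a n m) ∧
      -- the sum vanishes for the levels `m` at which there is no component
      (∀ m : ℕ, A < 2 * m → QSig.signFormula q a n m = 0)) := by
  refine ⟨fun a b m ha hb => ⟨QSig.levelVec a b m (QSig.hwCoeff q a b m),
    QSig.isUnitHighest_levelVec hq s ha hb, fun u' hu' => hu'.eq_levelVec hq ha hb,
    QSig.form_levelVec hq hs ha hb⟩, ?_⟩
  rintro n a A T hn hA rfl
  obtain ⟨n, rfl⟩ := Nat.exists_eq_add_of_le' hn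
  obtain ⟨D, hc, hsum⟩ := QSig.exists_decomp_tensorProd hq hs a n
  rw [← hA] at hc hsum
  -- From here on only the decomposition of the module and its sign sums matter.
  generalize QSig.tensorProd q s a (n + 1) = T at D hc hsum ⊢
  refine ⟨fun b => D.invSqrt_sq_mul hq hs b, D.form_star hq, fun x h => D.eq_zero_of_form hq h,
    fun x y => ⟨T.form_mulVec_left D.contra.E x y, T.form_mulVec_left D.contra.F x y,
      T.form_mulVec_left (by rw [T.K_transpose, T.Kinv_map_star, D.contra.K]) x y⟩,
    D.decompMap_bijective hq hc, ?_, ?_, ?_⟩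
  · intro m m' hm hm' hne f g x y
    exact QSig.form_eq_zero hq D.contra f.2 g.2
      (QSig.form_highest_of_ne hq D.contra (by omega) f.2 g.2) x y
  · intro m hm
    refine ⟨fun f g x y => QSig.form_mulVec_eq_mul hq D.contra f.2 g.2 x y,
      D.multForm_star hq, fun f h => D.eq_zero_of_multForm hq h, ?_⟩
    rw [D.signature_multForm hq, ← hsum]
    refine Finset.sum_congr (Finset.filter_congr fun i _ => ?_) fun _ _ => rfl
    omega
  · intro m hm
    exact QSig.signFormula_eq_zero q a n m (by omega)
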